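/- Let $X$ be a scheme on which $2$ is invertible, let $t\ge 0$, and let $T$ be a split torus of rank $t$ acting trivially on $X$, so that a $T$-equivariant vector bundle on $X$ is a vector bundle $E=\bigoplus_{\lambda\in\mathbb Z^t}E_\lambda$ with a $\mathbb Z^t$-grading with finite support. Let $K_0(X)$ and $R=K_0^T(X)$ be the Grothendieck rings of vector bundles and of $T$-equivariant vector bundles, and let $GW_0(X)$ and $RO=GW_0^T(X)$ be the Grothendieck–Witt rings of vector bundles, resp. $T$-equivariant vector bundles, with a non-degenerate symmetric bilinear form with values in $\mathcal O_X$ (with $\mathcal O_X$ in weight $0$). Let $\mathcal O_X(\lambda)$ be $\mathcal O_X$ placed in weight $\lambda$, put $x_i=[\mathcal O_X(e_i)]-1$ and $y_i=[\mathcal O_X(-e_i)]-1$ in $R$, and write $\boldsymbol x^{\gamma}=\prod_i x_i^{\gamma_i}$, $\boldsymbol y^{\gamma}=\prod_i y_i^{\gamma_i}$. Let $I=\ker(R\to K_0(X))$ and $IO=\ker(RO\to GW_0(X))$ be the kernels of the maps that forget the equivariant structure. Let $\vee:R\to R$ be the $K_0(X)$-linear ring involution with $x_i\mapsto y_i$ and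 $y_i\mapsto x_i$ (it replaces all weights by their negatives), let $R_+\subset R$ be the subring of $\vee$-fixed elements, and let $I_+=I\cap R_+$. 1. The natural map $K_0(X)[x_1,\dots,x_t,y_1,\dots,y_t]\to R$ is surjective with kernel $(x_iy_i+x_i+y_i\mid i=1,\dots,t)$. 2. As an ideal of $R_+$, $I_+$ is generated by the elements $\boldsymbol x^{\gamma}+\boldsymbol y^{\gamma}$ with $\gamma\in\{0,1\}^t\setminus\{0\}$. In particular $I_+$ is a finitely generated ideal, with a generating set of at most $2^t-1$ elements, and of exactly $2^t-1$ elements if $X\neq\emptyset$. 3. If $[E]=[E^\vee]$ in $K_0(X)$ for all vector bundles $E$ on $X$, then $\vee$ is the involution induced by the duality of $T$-equivariant vector bundles: $\vee[E]=[E^\vee]$ for every $T$-equivariant vector bundle $E$. 4. If the forgetful map $GW_0(X)\to K_0(X)$ is surjective (for example, if $X$ is the spectrum of a field of characteristic not $2$), then the forgetful map $RO\to R$ restricts to a bijection $IO\to I_+$, and $IO$ is generated, as an ideal of $RO$, by elements mapping to the $\boldsymbol x^{\gamma}+\boldsymbol y^{\gamma}$, $\gamma\in\{0,1\}^t\setminus\{0\}$;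 so it is generated by at most $2^t-1$ elements. -/

import Mathlib

open CategoryTheory AlgebraicGeometry

universe u

noncomputable section

namespace TorusGW

/-! ### Equivariant vector bundles -/

section Bundles

variable {X : Scheme.{u}} {W W' : Type} [AddCommGroup W] [AddCommGroup W']

/-- The structure sheaf as a module over itself. -/
abbrev structureSheaf (X : Scheme.{u}) : X.Modules := SheafOfModules.unit X.ringCatSheaf

theorem isQuasicoherent_structureSheaf (X : Scheme.{u}) : (structureSheaf X).IsQuasicoherent :=
  have h : (SheafOfModules.free.{u} (R := X.ringCatSheaf) PUnit.{u + 1}).IsQuasicoherent :=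
    inferInstance
  (SheafOfModules.isQuasicoherent X.ringCatSheaf).prop_of_iso (Limits.coproductUniqueIso _) h

/-- A finite locally free `𝒪_X`-module `mod` (quasi-coherent, with finite projective sections on
every affine open) together with a `W`-grading with finite support, recorded by the projections
`proj w` onto the homogeneous parts. For `W = ℤ^t` this is a vector bundle that is equivariant for
the trivial action of the split torus of rank `t` with character group `W`; for the trivial group
`W` it is just a vector bundle. -/
structure Bundle (X : Scheme.{u}) (W : Type) [AddCommGroup W] where
  mod : X.Modules
  quasicoherent : mod.IsQuasicoherent
  finite : ∀ U : X.Opens, IsAffineOpen U → Module.Finite Γ(X, U) Γ(mod, U)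
  projective : ∀ U : X.Opens, IsAffineOpen U → Module.Projective Γ(X, U) Γ(mod, U)
  proj : W →₀ (mod ⟶ mod)
  proj_idem : ∀ w, proj w ≫ proj w = proj w
  proj_orth : ∀ v w, v ≠ w → proj v ≫ proj w = 0
  proj_sum : proj.sum (fun _ p => p) = 𝟙 mod

/-- A section `s` of `E` is homogeneous of weight `w`. -/
def Bundle.HasWeight (E : Bundle X W) {U : X.Opens} (w : W) (s : Γ(E.mod, U)) : Prop :=
  (E.proj w).app U s = s

/-- A morphism of the underlying modules is equivariant iff it preserves the grading. -/
def IsEquivariant (E F : Bundle X W) (φ : E.mod ⟶ F.mod) : Prop :=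
  ∀ w, E.proj w ≫ φ = φ ≫ F.proj w

theorem Bundle.mapDomain_proj (f : W →+ W') (E : Bundle X W) (w : W') [DecidableEq W'] :
    E.proj.mapDomain f w = ∑ v ∈ E.proj.support, if f v = w then E.proj v else 0 := by
  simp [Finsupp.mapDomain, Finsupp.sum, Finsupp.finsetSum_apply, Finsupp.single_apply]

theorem Bundle.proj_comp (E : Bundle X W) (v w : W) [DecidableEq W] :
    E.proj v ≫ E.proj w = if v = w then E.proj v else 0 := by
  split_ifs with h
  · rw [← h, E.proj_idem]
  · exact E.proj_orth v w h

theorem Bundle.proj_mapDomain (f : W →+ W') (E : Bundle X W) (v : W) (w : W')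
    [DecidableEq W'] :
    E.proj v ≫ E.proj.mapDomain f w = if f v = w then E.proj v else 0 := by
  classical
  rw [E.mapDomain_proj, Preadditive.comp_sum, Finset.sum_eq_single v]
  · split_ifs with h
    · exact E.proj_idem v
    · simp
  · intro v' _ h
    split_ifs
    · exact E.proj_orth v v' (Ne.symm h)
    · simp
  · intro h
    rw [Finsupp.notMem_support_iff.mp h]
    simp

/-- Restriction of the equivariant structure along the homomorphism of diagonalizable groups that
corresponds to `f` on characters: a section of weight `w` becomes a section of weight `f w`. -/
def Bundle.push (f : W →+ W') (E : Bundle X W) : Bundle X W' where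
  mod := E.mod
  quasicoherent := E.quasicoherent
  finite := E.finite
  projective := E.projective
  proj := E.proj.mapDomain f
  proj_idem w := by
    classical
    conv_lhs => rw [E.mapDomain_proj f w, Preadditive.sum_comp]
    rw [E.mapDomain_proj f w]
    refine Finset.sum_congr rfl fun v _ => ?_
    rw [← E.mapDomain_proj f w]
    split_ifs with h
    · rw [E.proj_mapDomain, if_pos h]
    · simp
  proj_orth v w h := by
    classical
    rw [E.mapDomain_proj f v, Preadditive.sum_comp]
    refine Finset.sum_eq_zero fun v' _ => ?_
    split_ifs with h'
    · rw [E.proj_mapDomain, if_neg (h' ▸ h)]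
    · simp
  proj_sum := by
    rw [Finsupp.sum_mapDomain_index (fun _ => rfl) (fun _ _ _ => rfl), E.proj_sum]

/-- The line bundle `𝒪_X(w)`: the structure sheaf placed in weight `w`. -/
def lineBundle (X : Scheme.{u}) (w : W) : Bundle X W where
  mod := structureSheaf X
  quasicoherent := isQuasicoherent_structureSheaf X
  finite U _ := inferInstanceAs (Module.Finite Γ(X, U) Γ(X, U))
  projective U _ := inferInstanceAs (Module.Projective Γ(X, U) Γ(X, U))
  proj := Finsupp.single w (𝟙 _)
  proj_idem v := by
    classical
    by_cases h : w = v <;> simp [h]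
  proj_orth v v' h := by
    classical
    by_cases h1 : w = v <;> by_cases h2 : w = v' <;> simp_all
  proj_sum := by simp

/-- `0 → E → G → F → 0` is an exact sequence of equivariant vector bundles, where `i : E ⟶ G`
and `q : G ⟶ F`. As all sheaves are quasi-coherent, exactness is exactness of the sections over
all affine opens. -/
structure IsShortExact (E G F : Bundle X W) (i : E.mod ⟶ G.mod) (q : G.mod ⟶ F.mod) : Prop where
  equivariant_left : IsEquivariant E G i
  equivariant_right : IsEquivariant G F q
  injective : ∀ U : X.Opens, IsAffineOpen U → Function.Injective (i.app U)
  exact : ∀ U : X.Opens, IsAffineOpen U → Function.Exact (i.app U) (q.app U)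
  surjective : ∀ U : X.Opens, IsAffineOpen U → Function.Surjective (q.app U)

/-- `i : E ⟶ G` and `j : F ⟶ G` exhibit `G` as the equivariant direct sum of `E` and `F`. -/
def IsDirectSum (E F G : Bundle X W) (i : E.mod ⟶ G.mod) (j : F.mod ⟶ G.mod) : Prop :=
  IsEquivariant E G i ∧ IsEquivariant F G j ∧
    ∃ (r : G.mod ⟶ E.mod) (s : G.mod ⟶ F.mod), IsEquivariant G E r ∧ IsEquivariant G F s ∧
      i ≫ r = 𝟙 _ ∧ j ≫ s = 𝟙 _ ∧ i ≫ s = 0 ∧ j ≫ r = 0 ∧ r ≫ i + s ≫ j = 𝟙 _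

/-- An `𝒪_X`-bilinear map `E × F → G`. -/
structure Pairing (E F G : X.Modules) where
  app (U : X.Opens) : Γ(E, U) →ₗ[Γ(X, U)] Γ(F, U) →ₗ[Γ(X, U)] Γ(G, U)
  map_app {U V : X.Opens} (h : V ⟶ U) (x : Γ(E, U)) (y : Γ(F, U)) :
    G.presheaf.map h.op (app U x y) = app V (E.presheaf.map h.op x) (F.presheaf.map h.op y)

/-- The bilinear map `b` exhibits `G` as the tensor product of the equivariant bundles `E` and
`F`; the weights are additive. -/
structure IsTensor (E F G : Bundle X W) (b : Pairing E.mod F.mod G.mod) : Prop where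
  isTensorProduct : ∀ U : X.Opens, IsAffineOpen U → IsTensorProduct (b.app U)
  hasWeight : ∀ (U : X.Opens) (v w : W) (x : Γ(E.mod, U)) (y : Γ(F.mod, U)),
    E.HasWeight v x → F.HasWeight w y → G.HasWeight (v + w) (b.app U x y)

/-- An `𝒪_X`-bilinear form `E × F → 𝒪_X`. -/
structure Form (E F : X.Modules) where
  app (U : X.Opens) : Γ(E, U) →ₗ[Γ(X, U)] Γ(F, U) →ₗ[Γ(X, U)] Γ(X, U)
  map_app {U V : X.Opens} (h : V ⟶ U) (x : Γ(E, U)) (y : Γ(F, U)) :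
    X.presheaf.map h.op (app U x y) = app V (E.presheaf.map h.op x) (F.presheaf.map h.op y)

/-- The form `c` is equivariant and non-degenerate, i.e. identifies `F` with the dual bundle of
`E`; here `𝒪_X` has weight `0`. -/
structure IsPerfect (E F : Bundle X W) (c : Form E.mod F.mod) : Prop where
  isPerfPair : ∀ U : X.Opens, IsAffineOpen U → (c.app U).IsPerfPair
  eq_zero : ∀ (U : X.Opens) (v w : W) (x : Γ(E.mod, U)) (y : Γ(F.mod, U)),
    E.HasWeight v x → F.HasWeight w y → v + w ≠ 0 → c.app U x y = 0

/-! Compatibility of these notions with a change of the weights. -/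

theorem Bundle.eq_of {E F : Bundle X W} (h : E.mod = F.mod) (h' : E.proj ≍ F.proj) : E = F := by
  cases E
  cases F
  cases h
  cases h'
  rfl

theorem Bundle.push_proj (f : W →+ W') (E : Bundle X W) (w : W') [DecidableEq W']
    {S : Finset W} (hS : E.proj.support ⊆ S) :
    (E.push f).proj w = ∑ v ∈ S, if f v = w then E.proj v else 0 := by
  refine (E.mapDomain_proj f w).trans (Finset.sum_subset hS fun v _ hv => ?_)
  rw [Finsupp.notMem_support_iff.mp hv, ite_self]

theorem IsEquivariant.push {E F : Bundle X W} {φ : E.mod ⟶ F.mod} (h : IsEquivariant E F φ)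
    (f : W →+ W') : IsEquivariant (E.push f) (F.push f) φ := by
  classical
  intro w
  rw [E.push_proj f w (Finset.subset_union_left (s₂ := F.proj.support)),
    F.push_proj f w (Finset.subset_union_right (s₁ := E.proj.support))]
  refine (Preadditive.sum_comp _ _ φ).trans (Eq.trans ?_ (Preadditive.comp_sum _ φ _).symm)
  refine Finset.sum_congr rfl fun v _ => ?_
  split_ifs
  · exact h v
  · exact Limits.zero_comp.trans Limits.comp_zero.symm

/-- Evaluation of a morphism at a section, as an additive map in the morphism. -/
def evalHom {M N : X.Modules} {U : X.Opens} (s : Γ(M, U)) : (M ⟶ N) →+ Γ(N, U) where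
  toFun φ := φ.app U s
  map_zero' := by simp
  map_add' _ _ := by simp

theorem evalHom_apply {M N : X.Modules} {U : X.Opens} (s : Γ(M, U)) (φ : M ⟶ N) :
    evalHom s φ = φ.app U s := rfl

theorem comp_app_apply {M N K : X.Modules} (φ : M ⟶ N) (ψ : N ⟶ K) {U : X.Opens}
    (s : Γ(M, U)) : (φ ≫ ψ).app U s = ψ.app U (φ.app U s) := by
  simp

theorem Bundle.HasWeight.push {E : Bundle X W} {U : X.Opens} {w : W} {s : Γ(E.mod, U)}
    (h : E.HasWeight w s) (f : W →+ W') : (E.push f).HasWeight (f w) s := by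
  classical
  have h1 := comp_app_apply (E.proj w) (E.proj.mapDomain f (f w)) s
  rw [E.proj_mapDomain, if_pos rfl, show (E.proj w).app U s = s from h] at h1
  exact h1.symm

theorem Bundle.exists_of_hasWeight_push {E : Bundle X W} {U : X.Opens} {f : W →+ W'} {w : W'}
    {s : Γ(E.mod, U)} (h : (E.push f).HasWeight w s) :
    ∃ (S : Finset W) (c : W → Γ(E.mod, U)),
      (∀ v ∈ S, f v = w ∧ E.HasWeight v (c v)) ∧ s = ∑ v ∈ S, c v := by
  classical
  refine ⟨E.proj.support.filter (f · = w), fun v => (E.proj v).app U s, fun v hv => ⟨?_, ?_⟩, ?_⟩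
  · exact (Finset.mem_filter.mp hv).2
  · have := comp_app_apply (E.proj v) (E.proj v) s
    rw [E.proj_idem] at this
    exact this.symm
  · have h1 : evalHom s (E.proj.mapDomain f w) = s := h
    rw [E.mapDomain_proj, ← Finset.sum_filter, map_sum] at h1
    exact h1.symm

theorem Bundle.HasWeight.sum {ι : Type*} {E : Bundle X W} {U : X.Opens} {w : W} {S : Finset ι}
    {c : ι → Γ(E.mod, U)} (h : ∀ i ∈ S, E.HasWeight w (c i)) :
    E.HasWeight w (∑ i ∈ S, c i) :=
  (map_sum ((E.proj w).app U).hom c S).trans (Finset.sum_congr rfl h)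

theorem push_lineBundle (f : W →+ W') (w : W) :
    (lineBundle X w).push f = lineBundle X (f w) :=
  Bundle.eq_of rfl (heq_of_eq Finsupp.mapDomain_single)

theorem Bundle.push_push {W'' : Type} [AddCommGroup W''] (f : W →+ W') (g : W' →+ W'')
    (E : Bundle X W) : (E.push f).push g = E.push (g.comp f) :=
  Bundle.eq_of rfl (heq_of_eq Finsupp.mapDomain_comp.symm)

theorem IsShortExact.push {E G F : Bundle X W} {i : E.mod ⟶ G.mod} {q : G.mod ⟶ F.mod}
    (h : IsShortExact E G F i q) (f : W →+ W') :
    IsShortExact (E.push f) (G.push f) (F.push f) i q :=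
  ⟨h.1.push f, h.2.push f, h.3, h.4, h.5⟩

theorem IsDirectSum.push {E F G : Bundle X W} {i : E.mod ⟶ G.mod} {j : F.mod ⟶ G.mod}
    (h : IsDirectSum E F G i j) (f : W →+ W') :
    IsDirectSum (E.push f) (F.push f) (G.push f) i j := by
  obtain ⟨hi, hj, r, s, hr, hs, h⟩ := h
  exact ⟨hi.push f, hj.push f, r, s, hr.push f, hs.push f, h⟩

theorem IsTensor.push {E F G : Bundle X W} {b : Pairing E.mod F.mod G.mod}
    (h : IsTensor E F G b) (f : W →+ W') : IsTensor (E.push f) (F.push f) (G.push f) b := by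
  refine ⟨h.1, fun U v w x y hx hy => ?_⟩
  obtain ⟨S, c, hc, rfl⟩ := Bundle.exists_of_hasWeight_push hx
  obtain ⟨S', c', hc', rfl⟩ := Bundle.exists_of_hasWeight_push hy
  have key : b.app U (∑ v ∈ S, c v) (∑ v ∈ S', c' v) =
      ∑ v ∈ S, ∑ w ∈ S', b.app U (c v) (c' w) := by
    simp only [map_sum, LinearMap.sum_apply]
    exact Finset.sum_comm
  refine (congrArg ((G.push f).HasWeight (v + w)) key).mpr ?_
  refine Bundle.HasWeight.sum fun v' hv' => Bundle.HasWeight.sum fun w' hw' => ?_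
  rw [← (hc _ hv').1, ← (hc' _ hw').1, ← map_add]
  exact (h.2 U _ _ _ _ (hc _ hv').2 (hc' _ hw').2).push f

theorem IsPerfect.push {E F : Bundle X W} {b : Form E.mod F.mod} (h : IsPerfect E F b)
    (f : W →+ W') : IsPerfect (E.push f) (F.push f) b := by
  refine ⟨h.1, fun U v w x y hx hy hvw => ?_⟩
  obtain ⟨S, c, hc, rfl⟩ := Bundle.exists_of_hasWeight_push hx
  obtain ⟨S', c', hc', rfl⟩ := Bundle.exists_of_hasWeight_push hy
  have key : b.app U (∑ v ∈ S, c v) (∑ v ∈ S', c' v) =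
      ∑ v ∈ S, ∑ w ∈ S', b.app U (c v) (c' w) := by
    simp only [map_sum, LinearMap.sum_apply]
    exact Finset.sum_comm
  refine key.trans (Finset.sum_eq_zero fun v' hv' => Finset.sum_eq_zero fun w' hw' => ?_)
  refine h.2 U _ _ _ _ (hc _ hv').2 (hc' _ hw').2 fun h0 => hvw ?_
  rw [← (hc _ hv').1, ← (hc' _ hw').1, ← map_add, h0, map_zero]

theorem IsDirectSum.isShortExact {E F G : Bundle X W} {i : E.mod ⟶ G.mod} {j : F.mod ⟶ G.mod}
    (h : IsDirectSum E F G i j) : ∃ s, IsShortExact E G F i s := by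
  obtain ⟨hi, hj, r, s, hr, hs, h1, h2, h3, h4, h5⟩ := h
  refine ⟨s, hi, hs, fun U _ => ?_, fun U _ => ?_, fun U _ => ?_⟩
  · refine Function.LeftInverse.injective (g := r.app U) fun a => ?_
    rw [← comp_app_apply, h1]
    simp
  · intro a
    constructor
    · intro ha
      refine ⟨r.app U a, ?_⟩
      have := congrArg (evalHom a) h5
      rw [map_add] at this
      have h6 : evalHom a (s ≫ j) = 0 := by
        refine (comp_app_apply s j a).trans ?_
        rw [ha, map_zero]
      rw [h6, add_zero] at this
      exact ((comp_app_apply r i a).symm.trans this).trans (by simp [evalHom_apply])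
    · rintro ⟨a, rfl⟩
      rw [← comp_app_apply, h3]
      simp
  · refine Function.RightInverse.surjective (g := j.app U) fun a => ?_
    rw [← comp_app_apply, h2]
    simp

/-- The multiplication of `𝒪_X`. -/
def mulForm (X : Scheme.{u}) : Form (structureSheaf X) (structureSheaf X) where
  app U := LinearMap.mul Γ(X, U) Γ(X, U)
  map_app {U _} h x y :=
    map_mul (X.presheaf.map h.op).hom (show Γ(X, U) from x) (show Γ(X, U) from y)

end Bundles

/-! ### The equivariant Grothendieck ring -/

section K0

variable {X : Scheme.{u}} {W W' : Type} [AddCommGroup W] [AddCommGroup W']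

/-- The defining relations of the Grothendieck ring of equivariant vector bundles. -/
inductive K0Rel (X : Scheme.{u}) (W : Type) [AddCommGroup W] :
    MvPolynomial (Bundle X W) ℤ → Prop
  | exact {E G F : Bundle X W} {i : E.mod ⟶ G.mod} {q : G.mod ⟶ F.mod}
      (h : IsShortExact E G F i q) : K0Rel X W (.X G - (.X E + .X F))
  | tensor {E F G : Bundle X W} {b : Pairing E.mod F.mod G.mod} (h : IsTensor E F G b) :
      K0Rel X W (.X G - .X E * .X F)
  | unit : K0Rel X W (.X (lineBundle X 0) - 1)

/-- The Grothendieck ring of vector bundles on `X` with a `W`-grading: the commutative ring with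
generators the classes `[E]` and relations `[G] = [E] + [F]` for exact sequences
`0 → E → G → F → 0`, `[E ⊗ F] = [E] [F]` and `[𝒪_X] = 1`. For `W = ℤ^t` this is `K_0^T(X)` for
the trivial action of a split torus `T` of rank `t`. -/
abbrev K0 (X : Scheme.{u}) (W : Type) [AddCommGroup W] : Type (u + 1) :=
  MvPolynomial (Bundle X W) ℤ ⧸ Ideal.span {r | K0Rel X W r}

/-- The class of an equivariant vector bundle. -/
def K0.cls (E : Bundle X W) : K0 X W := Ideal.Quotient.mk _ (.X E)

theorem K0.mk_eq_zero {r : MvPolynomial (Bundle X W) ℤ} (h : K0Rel X W r) :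
    (Ideal.Quotient.mk _ r : K0 X W) = 0 :=
  Ideal.Quotient.eq_zero_iff_mem.mpr (Ideal.subset_span h)

theorem K0.cls_exact {E G F : Bundle X W} {i : E.mod ⟶ G.mod} {q : G.mod ⟶ F.mod}
    (h : IsShortExact E G F i q) : K0.cls G = K0.cls E + K0.cls F := by
  have := K0.mk_eq_zero (.exact h)
  rw [map_sub, map_add, sub_eq_zero] at this
  exact this

theorem K0.cls_tensor {E F G : Bundle X W} {b : Pairing E.mod F.mod G.mod}
    (h : IsTensor E F G b) : K0.cls G = K0.cls E * K0.cls F := by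
  have := K0.mk_eq_zero (.tensor h)
  rw [map_sub, map_mul, sub_eq_zero] at this
  exact this

theorem K0.cls_unit : K0.cls (lineBundle X (0 : W)) = 1 := by
  have := K0.mk_eq_zero (.unit : K0Rel X W _)
  rw [map_sub, map_one, sub_eq_zero] at this
  exact this

theorem K0Rel.push (f : W →+ W') {r : MvPolynomial (Bundle X W) ℤ} (h : K0Rel X W r) :
    K0Rel X W' (MvPolynomial.rename (Bundle.push f) r) := by
  cases h with
  | exact h => simpa using K0Rel.exact (h.push f)
  | tensor h => simpa using K0Rel.tensor (h.push f)
  | unit => simpa [push_lineBundle] using K0Rel.unit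

/-- The ring homomorphism induced by a homomorphism of the groups of weights. -/
def K0.map (X : Scheme.{u}) (f : W →+ W') : K0 X W →+* K0 X W' :=
  Ideal.quotientMap _ (MvPolynomial.rename (Bundle.push f)).toRingHom <|
    Ideal.span_le.mpr fun _ h => Ideal.subset_span (h.push f)

theorem K0.map_cls (f : W →+ W') (E : Bundle X W) :
    K0.map X f (K0.cls E) = K0.cls (E.push f) := by
  simp [K0.map, K0.cls]

theorem K0.map_map {W'' : Type} [AddCommGroup W''] (f : W →+ W') (g : W' →+ W'')
    (a : K0 X W) : K0.map X g (K0.map X f a) = K0.map X (g.comp f) a := by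
  have : (K0.map X g).comp (K0.map X f) = K0.map X (g.comp f) :=
    Ideal.Quotient.ringHom_ext <| MvPolynomial.ringHom_ext (fun r => by simp) fun E => by
      change K0.map X g (K0.map X f (K0.cls E)) = K0.map X (g.comp f) (K0.cls E)
      simp only [K0.map_cls, Bundle.push_push]
  exact DFunLike.congr_fun this a

end K0

/-! ### The equivariant Grothendieck-Witt ring -/

section GW0

variable {X : Scheme.{u}} {W W' : Type} [AddCommGroup W] [AddCommGroup W']

/-- An equivariant vector bundle with an equivariant non-degenerate symmetric bilinear form. -/
structure SymBundle (X : Scheme.{u}) (W : Type) [AddCommGroup W] where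
  bundle : Bundle X W
  form : Form bundle.mod bundle.mod
  perfect : IsPerfect bundle bundle form
  symm : ∀ (U : X.Opens) (x y : Γ(bundle.mod, U)), form.app U x y = form.app U y x

theorem SymBundle.eq_of {M N : SymBundle X W} (h : M.bundle = N.bundle)
    (h' : M.form ≍ N.form) : M = N := by
  cases M
  cases N
  cases h
  cases h'
  rfl

/-- Restriction of the equivariant structure, see `Bundle.push`. -/
def SymBundle.push (f : W →+ W') (M : SymBundle X W) : SymBundle X W' where
  bundle := M.bundle.push f
  form := M.form
  perfect := M.perfect.push f
  symm := M.symm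

theorem isPerfPair_mul (A : Type*) [CommRing A] : (LinearMap.mul A A).IsPerfPair where
  bijective_left := by
    refine ⟨fun a b h => ?_, fun φ => ⟨φ 1, LinearMap.ext fun b => ?_⟩⟩
    · simpa using LinearMap.congr_fun h 1
    · rw [LinearMap.mul_apply', mul_comm, ← smul_eq_mul, ← map_smul, smul_eq_mul, mul_one]
  bijective_right := by
    refine ⟨fun a b h => ?_, fun φ => ⟨φ 1, LinearMap.ext fun b => ?_⟩⟩
    · simpa using LinearMap.congr_fun h 1
    · rw [LinearMap.flip_apply, LinearMap.mul_apply', ← smul_eq_mul, ← map_smul, smul_eq_mul,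
        mul_one]

theorem eq_zero_of_hasWeight_unit {v : W} {U : X.Opens} {x : Γ(structureSheaf X, U)}
    (h : (lineBundle X (0 : W)).HasWeight v x) : v = 0 ∨ x = 0 := by
  classical
  by_cases hv : v = 0
  · exact Or.inl hv
  · right
    have h0 : (lineBundle X (0 : W)).proj v = 0 := Finsupp.single_eq_of_ne hv
    have h1 : evalHom x ((lineBundle X (0 : W)).proj v) = x := h
    exact (h1.symm.trans (congrArg (evalHom x) h0)).trans (map_zero _)

/-- The structure sheaf in weight `0` with the form `(x, y) ↦ x y`. -/
def unitSym (X : Scheme.{u}) (W : Type) [AddCommGroup W] : SymBundle X W where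
  bundle := lineBundle X 0
  form := mulForm X
  perfect := by
    refine ⟨fun U _ => ?_, fun U v w x y hx hy h => ?_⟩
    · exact isPerfPair_mul Γ(X, U)
    · have hv : v = 0 ∨ x = 0 := eq_zero_of_hasWeight_unit hx
      have hw : w = 0 ∨ y = 0 := eq_zero_of_hasWeight_unit hy
      rcases hv with rfl | rfl
      · rcases hw with rfl | rfl
        · simp at h
        · exact map_zero _
      · exact LinearMap.map_zero₂ _ _
  symm U x y := mul_comm (show Γ(X, U) from x) (show Γ(X, U) from y)

/-- `M` is isometric to the orthogonal sum of `M₁` and `M₂`. -/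
def IsOrthogonalSum (M₁ M₂ M : SymBundle X W) : Prop :=
  ∃ i j, IsDirectSum M₁.bundle M₂.bundle M.bundle i j ∧ ∀ U : X.Opens,
    (∀ x y, M.form.app U (i.app U x) (i.app U y) = M₁.form.app U x y) ∧
    (∀ x y, M.form.app U (j.app U x) (j.app U y) = M₂.form.app U x y) ∧
    (∀ x y, M.form.app U (i.app U x) (j.app U y) = 0)

/-- `M` is metabolic with Lagrangian `L`: there is an exact sequence `0 → L → M → Q → 0` such that
`L` is totally isotropic and the pairing `c` of `L` and `Q` induced by the form of `M` is
perfect (so that `L = L^⊥` and `Q ≅ L^∨`). -/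
def IsMetabolic (L Q : Bundle X W) (c : Form L.mod Q.mod) (M : SymBundle X W) : Prop :=
  IsPerfect L Q c ∧ ∃ i q, IsShortExact L M.bundle Q i q ∧
    ∀ (U : X.Opens) x m, M.form.app U (i.app U x) m = c.app U x (q.app U m)

/-- `H` is isometric to the hyperbolic bundle `L ⊕ Q`, where `Q` is identified with the dual of `L`
through the perfect pairing `c`. -/
def IsHyperbolic (L Q : Bundle X W) (c : Form L.mod Q.mod) (H : SymBundle X W) : Prop :=
  IsPerfect L Q c ∧ ∃ i j, IsDirectSum L Q H.bundle i j ∧ ∀ U : X.Opens,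
    (∀ x x', H.form.app U (i.app U x) (i.app U x') = 0) ∧
    (∀ y y', H.form.app U (j.app U y) (j.app U y') = 0) ∧
    (∀ x y, H.form.app U (i.app U x) (j.app U y) = c.app U x y)

/-- `M` is isometric to the tensor product of `M₁` and `M₂`. -/
def IsSymTensor (M₁ M₂ M : SymBundle X W) : Prop :=
  ∃ b, IsTensor M₁.bundle M₂.bundle M.bundle b ∧ ∀ (U : X.Opens) x x' y y',
    M.form.app U (b.app U x y) (b.app U x' y') = M₁.form.app U x x' * M₂.form.app U y y'

/-- The defining relations of the Grothendieck-Witt ring of equivariant vector bundles. -/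
inductive GW0Rel (X : Scheme.{u}) (W : Type) [AddCommGroup W] :
    MvPolynomial (SymBundle X W) ℤ → Prop
  | sum {M₁ M₂ M : SymBundle X W} (h : IsOrthogonalSum M₁ M₂ M) :
      GW0Rel X W (.X M - (.X M₁ + .X M₂))
  | metabolic {L Q : Bundle X W} {c : Form L.mod Q.mod} {M H : SymBundle X W}
      (hM : IsMetabolic L Q c M) (hH : IsHyperbolic L Q c H) : GW0Rel X W (.X M - .X H)
  | tensor {M₁ M₂ M : SymBundle X W} (h : IsSymTensor M₁ M₂ M) :
      GW0Rel X W (.X M - .X M₁ * .X M₂)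
  | unit : GW0Rel X W (.X (unitSym X W) - 1)

/-- The Grothendieck-Witt ring of symmetric vector bundles on `X` with a `W`-grading: the
commutative ring with generators the (isometry) classes `[M]` and relations
`[M₁ ⊥ M₂] = [M₁] + [M₂]`, `[M] = [H(L)]` if `M` is metabolic with Lagrangian `L`,
`[M₁ ⊗ M₂] = [M₁] [M₂]` and `[𝒪_X] = 1`. For `W = ℤ^t` this is `GW_0^{T,[0]}(X)` for the trivial
action of a split torus `T` of rank `t` on a scheme `X` on which `2` is invertible. -/
abbrev GW0 (X : Scheme.{u}) (W : Type) [AddCommGroup W] : Type (u + 1) :=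
  MvPolynomial (SymBundle X W) ℤ ⧸ Ideal.span {r | GW0Rel X W r}

theorem GW0Rel.push (f : W →+ W') {r : MvPolynomial (SymBundle X W) ℤ} (h : GW0Rel X W r) :
    GW0Rel X W' (MvPolynomial.rename (SymBundle.push f) r) := by
  cases h with
  | sum h =>
    obtain ⟨i, j, h, h'⟩ := h
    simpa using GW0Rel.sum (M₁ := SymBundle.push f _) (M₂ := SymBundle.push f _)
      (M := SymBundle.push f _) ⟨i, j, h.push f, h'⟩
  | metabolic hM hH =>
    obtain ⟨hc, i, q, h, h'⟩ := hM
    obtain ⟨-, i', j', h₂, h₂'⟩ := hH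
    simpa using GW0Rel.metabolic (L := Bundle.push f _) (Q := Bundle.push f _)
      (M := SymBundle.push f _) (H := SymBundle.push f _)
      ⟨hc.push f, i, q, h.push f, h'⟩ ⟨hc.push f, i', j', h₂.push f, h₂'⟩
  | tensor h =>
    obtain ⟨b, h, h'⟩ := h
    simpa using GW0Rel.tensor (M₁ := SymBundle.push f _) (M₂ := SymBundle.push f _)
      (M := SymBundle.push f _) ⟨b, h.push f, h'⟩
  | unit =>
    have : SymBundle.push f (unitSym X W) = unitSym X W' :=
      SymBundle.eq_of ((push_lineBundle f 0).trans (by rw [map_zero]; rfl)) HEq.rfl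
    simpa [this] using GW0Rel.unit

/-- The ring homomorphism induced by a homomorphism of the groups of weights. -/
def GW0.map (X : Scheme.{u}) (f : W →+ W') : GW0 X W →+* GW0 X W' :=
  Ideal.quotientMap _ (MvPolynomial.rename (SymBundle.push f)).toRingHom <|
    Ideal.span_le.mpr fun _ h => Ideal.subset_span (h.push f)

/-- The forgetful homomorphism `[M] ↦ [M]` from the Grothendieck-Witt ring to the Grothendieck
ring. -/
def GW0.forget (X : Scheme.{u}) (W : Type) [AddCommGroup W] : GW0 X W →+* K0 X W :=
  Ideal.Quotient.lift _
    (MvPolynomial.aeval fun M : SymBundle X W => K0.cls M.bundle).toRingHom <| by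
    intro r hr
    have hle : Ideal.span {r | GW0Rel X W r} ≤ RingHom.ker
        (MvPolynomial.aeval fun M : SymBundle X W => K0.cls M.bundle).toRingHom := by
      refine Ideal.span_le.mpr fun r hr => ?_
      refine RingHom.mem_ker.mpr ?_
      cases hr with
      | sum h =>
        obtain ⟨i, j, h, -⟩ := h
        obtain ⟨s, h⟩ := h.isShortExact
        simp [K0.cls_exact h]
      | metabolic hM hH =>
        obtain ⟨-, i, q, h, -⟩ := hM
        obtain ⟨-, i', j', h', -⟩ := hH
        obtain ⟨s, h'⟩ := h'.isShortExact
        simp [K0.cls_exact h, K0.cls_exact h']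
      | tensor h =>
        obtain ⟨b, h, -⟩ := h
        simp [K0.cls_tensor h]
      | unit => simp [unitSym, K0.cls_unit]
    exact hle hr

end GW0

/-! ### The torus of rank `t` -/

section Torus

variable (X : Scheme.{u}) (t : ℕ)

/-- `K_0(X)`, the Grothendieck ring of vector bundles on `X`. -/
abbrev KX : Type (u + 1) := K0 X Unit

/-- `GW_0(X)`, the Grothendieck-Witt ring of symmetric vector bundles on `X`. -/
abbrev GWX : Type (u + 1) := GW0 X Unit

/-- `R = K_0^T(X)`. -/
abbrev KTX : Type (u + 1) := K0 X (Fin t → ℤ)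

/-- `RO = GW_0^T(X)`. -/
abbrev GWTX : Type (u + 1) := GW0 X (Fin t → ℤ)

/-- The map `K_0(X) → R` that gives a vector bundle the trivial equivariant structure. -/
def triv : KX X →+* KTX X t := K0.map X 0

/-- The augmentation `R → K_0(X)`, which forgets the equivariant structure. -/
def augmentation : KTX X t →+* KX X := K0.map X 0

/-- The augmentation ideal `I` of `R`. -/
def augIdeal : Ideal (KTX X t) := RingHom.ker (augmentation X t)

/-- The Hermitian augmentation `RO → GW_0(X)`, which forgets the equivariant structure. -/
def hermitianAugmentation : GWTX X t →+* GWX X := GW0.map X 0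

/-- The Hermitian augmentation ideal `IO` of `RO`. -/
def hermitianAugIdeal : Ideal (GWTX X t) := RingHom.ker (hermitianAugmentation X t)

variable {t} in
/-- `x_i = [𝒪_X(e_i)] - 1`. -/
def xCls (i : Fin t) : KTX X t := K0.cls (lineBundle X (Pi.single i 1)) - 1

variable {t} in
/-- `y_i = [𝒪_X(-e_i)] - 1`. -/
def yCls (i : Fin t) : KTX X t := K0.cls (lineBundle X (-Pi.single i 1)) - 1

/-- The map `K_0(X)[x_1, …, x_t, y_1, …, y_t] → R`. -/
def presentation : MvPolynomial (Fin t ⊕ Fin t) (KX X) →+* KTX X t :=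
  MvPolynomial.eval₂Hom (triv X t) (Sum.elim (xCls X) (yCls X))

/-- The involution `∨` of `R`, which fixes `K_0(X)` and interchanges `x_i` and `y_i`: it replaces
all weights by their negatives. -/
def vee : KTX X t →+* KTX X t := K0.map X (-AddMonoidHom.id _)

theorem vee_triv (a : KX X) : vee X t (triv X t a) = triv X t a := by
  rw [vee, triv, K0.map_map, AddMonoidHom.comp_zero]

variable {t} in
theorem vee_xCls (i : Fin t) : vee X t (xCls X i) = yCls X i := by
  simp [vee, xCls, yCls, K0.map_cls, push_lineBundle]

variable {t} in
theorem vee_yCls (i : Fin t) : vee X t (yCls X i) = xCls X i := by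
  simp [vee, xCls, yCls, K0.map_cls, push_lineBundle]

/-- `R_+`, the subring of `∨`-fixed elements of `R`. -/
def RPlus : Subring (KTX X t) := RingHom.eqLocus (vee X t) (RingHom.id _)

/-- `I_+`, the `∨`-fixed elements of `I`, as an ideal of `R_+`. -/
def IPlus : Ideal (RPlus X t) := (augIdeal X t).comap (RPlus X t).subtype

variable {t} in
/-- The element `x^γ + y^γ` of `R_+`, for `γ ∈ {0,1}^t`. -/
def gen (γ : Fin t → Fin 2) : RPlus X t :=
  ⟨∏ i, xCls X i ^ (γ i : ℕ) + ∏ i, yCls X i ^ (γ i : ℕ), by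
    simp [RPlus, vee_xCls, vee_yCls, add_comm]⟩

end Torus

end TorusGW

end

open TorusGW

/-! Everything rests on the weight decomposition. A graded bundle is the direct sum of its weight
parts `E_w`, and `E_w` placed in weight `w` is `E_w` in weight `0` times `z^w = [𝒪_X(w)]`. The
character `[E] ↦ ∑ [E_w] z^w` respects exact sequences and tensor products and is inverse to the
evident map from the group ring, so `R = K_0(X)[ℤ^t]` (`K0.characterEquiv`). As `z_i = 1 + x_i` and
`z_i⁻¹ = 1 + y_i`, the presentation of `R` is that of Laurent polynomials, the relation being `(1 +
x_i)(1 + y_i) = 1` (`ker_eq_relIdeal`).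

The involution sends `z^w` to `z^{-w}`, so its fixed elements are sums of constants and of `a (z^w +
z^{-w})`, and `I_+` is spanned over `K_0(X)` by `s_w = z^w + z^{-w} - 2`. The identity `s_{v+w} +
s_{v-w} = s_v s_w + 2 s_v + 2 s_w` reduces every coordinate of `w` to `0` or `1`; for such `w`,
expanding `z_i = 1 + x_i` writes `s_w` through the `x^γ + y^γ` (`inGenIdeal_sCls`, `span_gen`). If
`X` is nonempty, rank followed by evaluation in `ℚ` separates these generators (`gen_injOn`). A
perfect equivariant form pairs the part of weight `w` perfectly with the part of weight `-w`, and
this gives the statement on duality (`vee_cls`).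

For symmetric bundles, the parts of weights `w` and `-w` with `2w ≠ 0` form a hyperbolic orthogonal
summand (`SymBundle.exists_split`). Hence `[M]` is a class from `GW_0(X)` plus classes `H_w([M_w])`,
with `w` in a half `P` of the nonzero weights. That `H_w` is a well-defined additive map on `K_0(X)`
follows by finding one Lagrangian in two bundles (`cls_hypDual_eq_add`), together with an extension
principle for additive invariants, needed because `K0` is presented as a ring
(`K0.exists_addMonoidHom`). The projection formula `H_w(forget κ * a) = κ H_w(a)` and surjectivity
of `GW_0(X) → K_0(X)` show that these classes span all of `RO` additively (`mem_hypSubgroup`). Since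
`H_w(b)` is sent to `b (z^w + z^{-w})`, the hyperbolic terms of an element of `RO` are recovered
from its image in `R`. So an element with image zero comes from `GW_0(X)`, and is zero if its
augmentation vanishes. This gives `IO ≅ I_+`, and generators of `I_+` lift. -/

noncomputable section

namespace TorusGW

/-! ### Sections of modules on a scheme, and quasi-coherence as localization at basic opens. -/

section Sections

variable {X : Scheme.{u}}

/-- Restriction of sections of a module. -/
def res (M : X.Modules) {U V : X.Opens} (h : V ≤ U) : Γ(M, U) →+ Γ(M, V) :=
  (M.presheaf.map (homOfLE h).op).hom

/-- Restriction of functions. -/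
def fres {U V : X.Opens} (h : V ≤ U) : Γ(X, U) →+* Γ(X, V) :=
  (X.presheaf.map (homOfLE h).op).hom

variable {M N K : X.Modules} {U V W : X.Opens}

theorem res_smul (h : V ≤ U) (a : Γ(X, U)) (s : Γ(M, U)) :
    res M h (a • s) = fres h a • res M h s :=
  M.map_smul (homOfLE h) a s

theorem res_self (h : U ≤ U) (s : Γ(M, U)) : res M h s = s := by
  simp [res]

theorem res_res (h : V ≤ U) (h' : W ≤ V) (s : Γ(M, U)) :
    res M h' (res M h s) = res M (h'.trans h) s := by
  have : (homOfLE (h'.trans h)).op = (homOfLE h).op ≫ (homOfLE h').op := rfl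
  simp [res, this]

theorem fres_self (h : U ≤ U) (s : Γ(X, U)) : fres h s = s := by
  simp [fres]

theorem fres_fres (h : V ≤ U) (h' : W ≤ V) (s : Γ(X, U)) :
    fres h' (fres h s) = fres (h'.trans h) s := by
  have : (homOfLE (h'.trans h)).op = (homOfLE h).op ≫ (homOfLE h').op := rfl
  simp [fres, this]

theorem app_res (φ : M ⟶ N) (h : V ≤ U) (s : Γ(M, U)) :
    φ.app V (res M h s) = res N h (φ.app U s) :=
  (ConcreteCategory.congr_hom (φ.mapPresheaf.naturality (homOfLE h).op) s)

/-- Sections are determined locally. -/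
theorem eq_of_locally {s t : Γ(M, U)}
    (h : ∀ x ∈ U, ∃ (V : X.Opens) (hV : V ≤ U), x ∈ V ∧ res M hV s = res M hV t) : s = t := by
  choose V hV hx he using h
  refine TopCat.Sheaf.eq_of_locally_eq' ⟨M.presheaf, M.isSheaf⟩ (fun x : U => V x x.2) U
    (fun x => homOfLE (hV x x.2)) ?_ s t fun x => he x x.2
  intro x hxU
  exact TopologicalSpace.Opens.mem_iSup.mpr ⟨⟨x, hxU⟩, hx x hxU⟩

/-- Compatible sections glue. -/
theorem existsUnique_glue {ι : Type*} (D : ι → X.Opens) (hD : ∀ i, D i ≤ U)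
    (hcov : ∀ x ∈ U, ∃ i, x ∈ D i) (s : ∀ i, Γ(M, D i))
    (hs : ∀ i j, ∀ x ∈ D i, x ∈ D j → ∃ (V : X.Opens) (hi : V ≤ D i) (hj : V ≤ D j),
      x ∈ V ∧ res M hi (s i) = res M hj (s j)) :
    ∃! t : Γ(M, U), ∀ i, res M (hD i) t = s i := by
  refine TopCat.Sheaf.existsUnique_gluing' ⟨M.presheaf, M.isSheaf⟩ D U
    (fun i => homOfLE (hD i)) ?_ s ?_
  · intro x hx
    exact TopologicalSpace.Opens.mem_iSup.mpr (hcov x hx)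
  · intro i j
    change res M inf_le_left (s i) = res M inf_le_right (s j)
    refine eq_of_locally fun x hx => ?_
    obtain ⟨V, hi, hj, hxV, h⟩ := hs i j x hx.1 hx.2
    exact ⟨V, le_inf hi hj, hxV, by rw [res_res, res_res, h]⟩

theorem isUnit_fres_basicOpen (f : Γ(X, U)) : IsUnit (fres (X.basicOpen_le f) f) :=
  X.toRingedSpace.isUnit_res_basicOpen f

theorem exists_affine_le {x : X} (hx : x ∈ U) : ∃ V : X.Opens, IsAffineOpen V ∧ x ∈ V ∧ V ≤ U := by
  obtain ⟨V, hV, hxV, hVU⟩ := X.isBasis_affineOpens.exists_subset_of_mem_open hx U.2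
  obtain ⟨V, hV, rfl⟩ := hV
  exact ⟨V, hV, hxV, hVU⟩

theorem _root_.AlgebraicGeometry.IsAffineOpen.exists_basicOpen_mem_le (hU : IsAffineOpen U) {x : X}
    (hx : x ∈ V) (h : x ∈ U) : ∃ f : Γ(X, U), X.basicOpen f ≤ V ∧ x ∈ X.basicOpen f :=
  hU.exists_basicOpen_le ⟨x, hx⟩ h

/-! Quasi-coherence in terms of sections over affine opens. -/

variable (hM : M.IsQuasicoherent) (hU : IsAffineOpen U) (f : Γ(X, U))

theorem isLocalizing_restrict_fromSpec (hM : M.IsQuasicoherent) (hU : IsAffineOpen U) :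
    IsLocalizing (modulesSpecToSheaf.obj (M.restrict hU.fromSpec)) := by
  have : (M.restrict hU.fromSpec).IsQuasicoherent := inferInstance
  exact (isIso_fromTildeΓ_iff_isLocalizing _).mp inferInstance

/-- The basic open subset `D(f)` of `Spec R`. -/
def specBasicOpen {R : CommRingCat.{u}} (f : R) : (Spec R).Opens := PrimeSpectrum.basicOpen f

theorem fromSpec_image_basicOpen_aux (hU : IsAffineOpen U) (f : Γ(X, U)) :
    hU.fromSpec ''ᵁ specBasicOpen f = X.basicOpen f := by
  exact hU.fromSpec_image_basicOpen f

theorem fromSpec_image_top_aux (hU : IsAffineOpen U) :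
    hU.fromSpec ''ᵁ ⊤ = U := by
  simp

/-- Over `Spec Γ(X, U)` scalars act through global sections of the spectrum; transported to `X` this
action has to become restriction of functions from `U`. -/
theorem fromSpec_scalars (hU : IsAffineOpen U) (V : (Spec Γ(X, U)).Opens)
    (h : hU.fromSpec ''ᵁ V ≤ U) :
    (Scheme.ΓSpecIso Γ(X, U)).inv ≫ (Spec Γ(X, U)).presheaf.map V.leTop.op ≫
      (hU.fromSpec.appIso V).inv = X.presheaf.map (homOfLE h).op := by
  have h' : V ≤ hU.fromSpec ⁻¹ᵁ U := by rw [hU.fromSpec_preimage_self]; exact le_top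
  rw [← Category.assoc, Iso.comp_inv_eq, Scheme.Hom.appIso_hom', Scheme.Hom.map_appLE]
  rw [Scheme.Hom.appLE, hU.fromSpec_app_self, Category.assoc, ← Functor.map_comp]
  rfl

theorem smul_restrict_fromSpec (hU : IsAffineOpen U) (a : Γ(X, U)) (V : (Spec Γ(X, U)).Opens)
    (h : hU.fromSpec ''ᵁ V ≤ U) (s : Γ(M.restrict hU.fromSpec, V)) :
    (M.restrictAppIso hU.fromSpec V).hom (a • s) =
      fres h a • (M.restrictAppIso hU.fromSpec V).hom s := by
  rw [Scheme.Modules.smul_Spec_def, Scheme.Modules.smul_restrictAppIso_hom_apply]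
  congr 1
  exact ConcreteCategory.congr_hom (fromSpec_scalars hU V h) a

/-- Identification of the sections of the restriction to `Spec Γ(X, U)`. -/
def specSections (M : X.Modules) (hU : IsAffineOpen U) (V : (Spec Γ(X, U)).Opens)
    (h : hU.fromSpec ''ᵁ V = W) : Γ(M.restrict hU.fromSpec, V) ≃+ Γ(M, W) where
  toFun s := res M h.ge (U := hU.fromSpec ''ᵁ V) s
  invFun s := show Γ(M, hU.fromSpec ''ᵁ V) from res M h.le s
  left_inv _ := (res_res (M := M) (U := hU.fromSpec ''ᵁ V) _ _ _).trans (res_self _ _)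
  right_inv s := (res_res (M := M) _ _ s).trans (res_self _ _)
  map_add' _ _ := map_add (res M h.ge) _ _

theorem specSections_smul (hU : IsAffineOpen U) (V : (Spec Γ(X, U)).Opens)
    (h : hU.fromSpec ''ᵁ V = W) (h' : W ≤ U) (a : Γ(X, U)) (s : Γ(M.restrict hU.fromSpec, V)) :
    specSections M hU V h (a • s) = fres h' a • specSections M hU V h s := by
  subst h
  exact (congrArg (res M _) (smul_restrict_fromSpec hU a V h' s)).trans
    ((res_self _ _).trans (congrArg (_ • ·) (res_self _ _).symm))

theorem specSections_res (hU : IsAffineOpen U) {V V' : (Spec Γ(X, U)).Opens} {W W' : X.Opens}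
    (h : hU.fromSpec ''ᵁ V = W) (h' : hU.fromSpec ''ᵁ V' = W') (i : V' ≤ V) (j : W' ≤ W)
    (s : Γ(M.restrict hU.fromSpec, V)) :
    specSections M hU V' h' (res _ i s) = res M j (specSections M hU V h s) := by
  subst h h'
  exact (res_self (M := M) _ _).trans (congrArg (res M j) (res_self (M := M) _ _).symm)

/-- Two of the three axioms of a localized module remain to be checked: `f` acts invertibly on
sections over `D(f)` for any module. -/
theorem isLocalizing_iff {R : CommRingCat.{u}} (N : (Spec R).Modules) :
    IsLocalizing (modulesSpecToSheaf.obj N) ↔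
      (∀ (f : R) (s : Γ(N, specBasicOpen f)), ∃ (n : ℕ) (t : Γ(N, ⊤)),
        res N le_top t = f ^ n • s) ∧
      ∀ (f : R) (t : Γ(N, ⊤)), res N (le_top : specBasicOpen f ≤ ⊤) t = 0 →
        ∃ n : ℕ, f ^ n • t = 0 := by
  refine ⟨fun h => ⟨fun f s => ?_, fun f t ht => ?_⟩, fun h f => ?_⟩
  · have : IsLocalizedModule (.powers f)
      ((modulesSpecToSheaf.obj N).obj.map (specBasicOpen f).leTop.op).hom := h f
    obtain ⟨⟨t, _, n, rfl⟩, ht⟩ := IsLocalizedModule.surj (.powers f)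
      ((modulesSpecToSheaf.obj N).obj.map (specBasicOpen f).leTop.op).hom s
    exact ⟨n, t, ht.symm⟩
  · have : IsLocalizedModule (.powers f)
      ((modulesSpecToSheaf.obj N).obj.map (specBasicOpen f).leTop.op).hom := h f
    obtain ⟨⟨_, n, rfl⟩, hn⟩ := (IsLocalizedModule.eq_zero_iff (.powers f)
      ((modulesSpecToSheaf.obj N).obj.map (specBasicOpen f).leTop.op).hom).mp ht
    exact ⟨n, hn⟩
  · refine IsLocalizedModule.Away.mk_of_addCommGroup ?_ (fun s => ?_) (h.2 f)
    · exact Scheme.Modules.isUnit_algebraMap_end_of_le_basicOpen (M := N) f le_rfl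
    · obtain ⟨n, t, ht⟩ := h.1 f s
      exact ⟨n, t, ht.symm⟩

/-- Sections of a quasi-coherent module over a basic open subset of an affine open, existence. -/
theorem exists_res_basicOpen (hM : M.IsQuasicoherent) (hU : IsAffineOpen U) (f : Γ(X, U))
    (s : Γ(M, X.basicOpen f)) :
    ∃ (n : ℕ) (t : Γ(M, U)), res M (X.basicOpen_le f) t = fres (X.basicOpen_le f) f ^ n • s := by
  let e := specSections M hU _ (fromSpec_image_basicOpen_aux hU f)
  let e' := specSections M hU _ (fromSpec_image_top_aux hU)
  obtain ⟨n, t, ht⟩ := ((isLocalizing_iff _).mp (isLocalizing_restrict_fromSpec hM hU)).1 f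
    (e.symm s)
  refine ⟨n, e' t, ?_⟩
  have h1 := specSections_res (M := M) hU (fromSpec_image_top_aux hU)
    (fromSpec_image_basicOpen_aux hU f) le_top (X.basicOpen_le f) t
  rw [← h1, ht, specSections_smul hU _ _ (X.basicOpen_le f), map_pow]
  exact congrArg _ (e.apply_symm_apply s)

/-- Sections of a quasi-coherent module over a basic open subset of an affine open, uniqueness. -/
theorem exists_pow_smul_eq_zero (hM : M.IsQuasicoherent) (hU : IsAffineOpen U) (f : Γ(X, U))
    (t : Γ(M, U)) (ht : res M (X.basicOpen_le f) t = 0) : ∃ n : ℕ, f ^ n • t = 0 := by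
  let e := specSections M hU _ (fromSpec_image_basicOpen_aux hU f)
  let e' := specSections M hU _ (fromSpec_image_top_aux hU)
  have h1 := specSections_res (M := M) hU (fromSpec_image_top_aux hU)
    (fromSpec_image_basicOpen_aux hU f) le_top (X.basicOpen_le f) (e'.symm t)
  obtain ⟨n, hn⟩ := ((isLocalizing_iff _).mp (isLocalizing_restrict_fromSpec hM hU)).2 f
    (e'.symm t) (e.injective (h1.trans (by
      rw [map_zero, ← ht]
      exact congrArg _ (e'.apply_symm_apply t))))
  refine ⟨n, ?_⟩
  have h3 := congrArg e' hn
  have h4 := specSections_smul hU _ (fromSpec_image_top_aux hU) le_rfl (f ^ n) (e'.symm t)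
  rw [fres_self] at h4
  rw [map_zero] at h3
  rw [← h3]
  refine Eq.trans ?_ h4.symm
  exact congrArg _ (e'.apply_symm_apply t).symm

/-- A module is quasi-coherent if restriction of its sections to basic open subsets of affine
opens is localization. -/
theorem isQuasicoherent_of_localizing
    (h₁ : ∀ (U : X.Opens), IsAffineOpen U → ∀ (f : Γ(X, U)) (s : Γ(M, X.basicOpen f)),
      ∃ (n : ℕ) (t : Γ(M, U)), res M (X.basicOpen_le f) t = fres (X.basicOpen_le f) f ^ n • s)
    (h₂ : ∀ (U : X.Opens), IsAffineOpen U → ∀ (f : Γ(X, U)) (t : Γ(M, U)),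
      res M (X.basicOpen_le f) t = 0 → ∃ n : ℕ, f ^ n • t = 0) :
    M.IsQuasicoherent := by
  have hl (U : X.Opens) (hU : IsAffineOpen U) :
      IsLocalizing (modulesSpecToSheaf.obj (M.restrict hU.fromSpec)) := by
    let e' := specSections M hU _ (fromSpec_image_top_aux hU)
    have h3 (f : Γ(X, U)) (t) := specSections_res (M := M) hU (fromSpec_image_top_aux hU)
      (fromSpec_image_basicOpen_aux hU f) le_top (X.basicOpen_le f) t
    refine (isLocalizing_iff _).mpr ⟨fun f s => ?_, fun f t ht => ?_⟩
    · let e := specSections M hU _ (fromSpec_image_basicOpen_aux hU f)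
      obtain ⟨n, t, ht⟩ := h₁ U hU f (e s)
      refine ⟨n, e'.symm t, e.injective ?_⟩
      have h4 := specSections_smul hU _ (fromSpec_image_basicOpen_aux hU f) (X.basicOpen_le f)
        (f ^ n) s
      rw [map_pow] at h4
      refine (h3 f _).trans (Eq.trans ?_ (ht.trans h4.symm))
      exact congrArg _ (e'.apply_symm_apply t)
    · let e := specSections M hU _ (fromSpec_image_basicOpen_aux hU f)
      obtain ⟨n, hn⟩ := h₂ U hU f (e' t) ((h3 f t).symm.trans ((congrArg e ht).trans (map_zero e)))
      refine ⟨n, e'.injective ?_⟩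
      have h4 := specSections_smul hU _ (fromSpec_image_top_aux hU) le_rfl (f ^ n) t
      rw [fres_self] at h4
      exact h4.trans (hn.trans (map_zero e').symm)
  -- On the spectrum the module is the tilde of its global sections, which is presented by taking
  -- all elements as generators and all relations between them.
  have hp (U : X.Opens) (hU : IsAffineOpen U) :
      Nonempty (SheafOfModules.Presentation.{u} (M.restrict hU.fromSpec)) := by
    have h5 : IsIso (M.restrict hU.fromSpec).fromTildeΓ :=
      (isIso_fromTildeΓ_iff_isLocalizing _).mpr (hl U hU)
    exact ⟨@SheafOfModules.Presentation.ofIsIso.{u, u, u} _ _ _ _ _ _ _ _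
      (M.restrict hU.fromSpec).fromTildeΓ h5
      (presentationTilde.{u} _ .univ (by simp) _ (Submodule.span_eq _))⟩
  have hp' (U : X.Opens) (hU : IsAffineOpen U) :
      Nonempty (SheafOfModules.Presentation.{u} (M.restrict U.ι)) := by
    obtain ⟨p⟩ := hp U hU
    let i : (M.restrict hU.fromSpec).restrict hU.isoSpec.hom ≅ M.restrict U.ι :=
      ((Scheme.Modules.restrictFunctorComp hU.isoSpec.hom hU.fromSpec).symm ≪≫
        Scheme.Modules.restrictFunctorCongr (by rw [IsAffineOpen.fromSpec, Iso.hom_inv_id_assoc])).app M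
    exact ⟨@SheafOfModules.Presentation.ofIsIso.{u, u, u} _ _ _ _ _ _ _ _ i.hom i.isIso_hom
      (Scheme.Modules.presentationRestrict hU.isoSpec.hom p)⟩
  -- Quasi-coherence is formulated on the slice over `U`, so the presentation is carried there from
  -- the open subscheme `U`.
  have hp'' (U : X.Opens) (hU : IsAffineOpen U) :
      Nonempty (SheafOfModules.Presentation.{u} (SheafOfModules.over M U)) := by
    obtain ⟨p⟩ := hp' U hU
    let e : SheafOfModules.{u} (X.ringCatSheaf.over U) ≌
      SheafOfModules.{u} (U : Scheme.{u}).ringCatSheaf := Scheme.Modules.overEquiv U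
    let i : e.inverse.obj (M.restrict U.ι) ≅ SheafOfModules.over M U :=
      e.inverse.mapIso ((Scheme.Modules.overFunctorEquiv U).symm.app M) ≪≫
        (e.unitIso.app _).symm
    exact ⟨SheafOfModules.Presentation.ofIsIso.{u, u, u} i.hom
      (p.map e.inverse
        (TopologicalSpace.Opens.sheafOfModulesEquivOverInverseUnit U X.ringCatSheaf).symm)⟩
  refine (SheafOfModules.QuasicoherentData.isQuasicoherent (M := M)
    { I := X.affineOpens
      X := fun U => U.1
      coversTop := ?_
      presentation := fun U => (hp'' U.1 U.2).some })
  rw [Opens.coversTop_iff]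
  exact iSup_affineOpens_eq_top X

end Sections

/-! ### Extension of linear maps from affine opens, and the sheaf of homomorphisms. -/

section HomSections

variable {X : Scheme.{u}} {M N K : X.Modules} {U V W : X.Opens}

/-- A semilinear map on the sections over an affine open extends to a basic open subset. -/
theorem exists_extend_basicOpen (hM : M.IsQuasicoherent) (hU : IsAffineOpen U) (f : Γ(X, U))
    {P : Type*} [AddCommGroup P] [Module Γ(X, X.basicOpen f) P] (α : Γ(M, U) →+ P)
    (hα : ∀ (a : Γ(X, U)) s, α (a • s) = fres (X.basicOpen_le f) a • α s) :
    ∃ β : Γ(M, X.basicOpen f) →ₗ[Γ(X, X.basicOpen f)] P,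
      ∀ s, β (res M (X.basicOpen_le f) s) = α s := by
  have hu := isUnit_fres_basicOpen f
  set F := fres (X.basicOpen_le f) f with hF
  have cancel (n : ℕ) {y z : P} (h : F ^ n • y = F ^ n • z) : y = z :=
    (hu.pow n).smul_left_cancel.mp h
  -- The value at `s` is characterized by all ways of clearing its denominator at once; additivity
  -- and linearity then follow by choosing a common power of `f` and cancelling it.
  have key (s : Γ(M, X.basicOpen f)) : ∃ y : P, ∀ (n : ℕ) t,
      res M (X.basicOpen_le f) t = F ^ n • s → α t = F ^ n • y := by
    obtain ⟨n, t, ht⟩ := exists_res_basicOpen hM hU f s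
    obtain ⟨v, hv⟩ := hu.pow n
    refine ⟨(↑v⁻¹ : Γ(X, X.basicOpen f)) • α t, fun m t' ht' => ?_⟩
    -- Two choices of numerator agree on `D(f)` after cross-multiplication, hence agree on `U` up to
    -- a power of `f`.
    have h0 : res M (X.basicOpen_le f) (f ^ n • t' - f ^ m • t) = 0 := by
      rw [map_sub, res_smul, res_smul, map_pow, map_pow, ht', ht, smul_smul, smul_smul, mul_comm,
        sub_self]
    obtain ⟨k, hk⟩ := exists_pow_smul_eq_zero hM hU f _ h0
    have h1 := congrArg α hk
    rw [map_zero, hα, map_pow, map_sub, hα, hα, map_pow, map_pow, ← hF] at h1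
    have h2 := cancel k (h1.trans (smul_zero _).symm)
    apply cancel n
    rw [sub_eq_zero] at h2
    rw [h2, ← hv, smul_comm, smul_smul (v : Γ(X, X.basicOpen f)), Units.mul_inv, one_smul]
  choose β hβ using key
  refine ⟨{ toFun := β, map_add' := fun s s' => ?_, map_smul' := fun a s => ?_ }, fun s => ?_⟩
  · obtain ⟨n, t, ht⟩ := exists_res_basicOpen hM hU f s
    obtain ⟨m, t', ht'⟩ := exists_res_basicOpen hM hU f s'
    apply cancel (n + m)
    rw [← hβ (s + s') (n + m) (f ^ m • t + f ^ n • t'), map_add, hα, hα, hβ s n t ht,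
      hβ s' m t' ht', map_pow, map_pow, ← hF, smul_add, pow_add, mul_smul, mul_smul,
      smul_comm (F ^ m)]
    rw [map_add, res_smul, res_smul, ht, ht', map_pow, map_pow, ← hF, smul_add, pow_add, mul_smul,
      mul_smul, smul_comm (F ^ m)]
  · obtain ⟨n, t, ht⟩ := exists_res_basicOpen hM hU f s
    -- The scalar also has to be written as a fraction, so the same fact is applied to the structure
    -- sheaf.
    obtain ⟨m, b, hb⟩ := exists_res_basicOpen (isQuasicoherent_structureSheaf X) hU f a
    have hb' : fres (X.basicOpen_le f) b = F ^ m * a := hb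
    apply cancel (m + n)
    rw [← hβ (a • s) (m + n) ((show Γ(X, U) from b) • t), hα, hβ s n t ht, hb', RingHom.id_apply,
      smul_smul, smul_smul]
    · congr 1; ring
    · rw [res_smul, ht, hb', smul_smul, smul_smul]
      congr 1; ring
  · have := hβ (res M (X.basicOpen_le f) s) 0 s (by simp)
    simpa using this.symm

theorem ext_basicOpen (hM : M.IsQuasicoherent) (hU : IsAffineOpen U) (f : Γ(X, U))
    {P : Type*} [AddCommGroup P] [Module Γ(X, X.basicOpen f) P]
    {β β' : Γ(M, X.basicOpen f) →ₗ[Γ(X, X.basicOpen f)] P}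
    (h : ∀ s, β (res M (X.basicOpen_le f) s) = β' (res M (X.basicOpen_le f) s)) : β = β' := by
  ext s
  obtain ⟨n, t, ht⟩ := exists_res_basicOpen hM hU f s
  apply ((isUnit_fres_basicOpen f).pow n).smul_left_cancel.mp
  rw [← map_smul, ← map_smul, ← ht, h]

variable (M N U) in
/-- Morphisms `M|_U ⟶ N|_U`, as compatible families of linear maps. -/
@[ext]
structure HomSec where
  app (V : X.Opens) (h : V ≤ U) : Γ(M, V) →ₗ[Γ(X, V)] Γ(N, V)
  res_app {V V' : X.Opens} (h : V ≤ U) (h' : V' ≤ V) (s : Γ(M, V)) :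
    res N h' (app V h s) = app V' (h'.trans h) (res M h' s)

namespace HomSec

instance : Zero (HomSec M N U) := ⟨⟨fun _ _ => 0, fun _ _ _ => by simp⟩⟩
instance : Add (HomSec M N U) :=
  ⟨fun φ ψ => ⟨fun V h => φ.app V h + ψ.app V h, fun h h' s => by simp [φ.res_app, ψ.res_app]⟩⟩
instance : Neg (HomSec M N U) :=
  ⟨fun φ => ⟨fun V h => -φ.app V h, fun h h' s => by simp [φ.res_app]⟩⟩
instance : Sub (HomSec M N U) :=
  ⟨fun φ ψ => ⟨fun V h => φ.app V h - ψ.app V h, fun h h' s => by simp [φ.res_app, ψ.res_app]⟩⟩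
instance : SMul ℕ (HomSec M N U) :=
  ⟨fun n φ => ⟨fun V h => n • φ.app V h, fun h h' s => by simp [φ.res_app]⟩⟩
instance : SMul ℤ (HomSec M N U) :=
  ⟨fun n φ => ⟨fun V h => n • φ.app V h, fun h h' s => by simp [φ.res_app]⟩⟩
instance : SMul Γ(X, U) (HomSec M N U) :=
  ⟨fun a φ => ⟨fun V h => fres h a • φ.app V h, fun h h' s => by
    simp [φ.res_app, res_smul, fres_fres]⟩⟩

/-- The family of linear maps, indexed by a subtype. -/
def toFamily (φ : HomSec M N U) (V : {V : X.Opens // V ≤ U}) :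
    Γ(M, V.1) →ₗ[Γ(X, V.1)] Γ(N, V.1) := φ.app V.1 V.2

theorem toFamily_injective : Function.Injective (toFamily : HomSec M N U → _) := fun _ _ h =>
  HomSec.ext (funext fun V => funext fun hV => congrFun h ⟨V, hV⟩)

instance : AddCommGroup (HomSec M N U) :=
  toFamily_injective.addCommGroup _ rfl (fun _ _ => rfl) (fun _ => rfl) (fun _ _ => rfl)
    (fun _ _ => rfl) (fun _ _ => rfl)

@[simp] theorem zero_app (h : V ≤ U) : (0 : HomSec M N U).app V h = 0 := rfl
@[simp] theorem add_app (φ ψ : HomSec M N U) (h : V ≤ U) :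
    (φ + ψ).app V h = φ.app V h + ψ.app V h := rfl
@[simp] theorem smul_app (a : Γ(X, U)) (φ : HomSec M N U) (h : V ≤ U) :
    (a • φ).app V h = fres h a • φ.app V h := rfl

instance : Module Γ(X, U) (HomSec M N U) where
  one_smul φ := by ext; simp
  mul_smul a b φ := by ext; simp [mul_smul]
  smul_zero a := by ext; simp
  smul_add a φ ψ := by ext; simp
  add_smul a b φ := by ext; simp [add_smul]
  zero_smul φ := by ext; simp

/-- Restriction to a smaller open subset. -/
def restrict (h : V ≤ U) : HomSec M N U →+ HomSec M N V where
  toFun φ := ⟨fun W hW => φ.app W (hW.trans h), fun _ h' s => φ.res_app _ h' s⟩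
  map_zero' := rfl
  map_add' _ _ := rfl

@[simp] theorem restrict_app (h : V ≤ U) (φ : HomSec M N U) (h' : W ≤ V) :
    (restrict h φ).app W h' = φ.app W (h'.trans h) := rfl

/-- A family of linear maps over the members of a basis extends. -/
theorem exists_of_basis {ι : Type*} (B : ι → X.Opens) (hB : ∀ i, B i ≤ U)
    (hbasis : ∀ V ≤ U, ∀ x ∈ V, ∃ i, x ∈ B i ∧ B i ≤ V)
    (α : ∀ i, Γ(M, B i) →ₗ[Γ(X, B i)] Γ(N, B i))
    (hα : ∀ i j (h : B j ≤ B i) s, res N h (α i s) = α j (res M h s)) :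
    ∃ φ : HomSec M N U, ∀ i, φ.app (B i) (hB i) = α i := by
  -- The image of `s` is glued from its images on the basic sets inside `V`. Uniqueness of the glued
  -- section yields linearity and compatibility with restriction.
  have key (V : X.Opens) (hV : V ≤ U) (s : Γ(M, V)) : ∃! t : Γ(N, V), ∀ i : {i // B i ≤ V},
      res N i.2 t = α i (res M i.2 s) := by
    refine existsUnique_glue (fun i : {i // B i ≤ V} => B i) _ (fun x hx => ?_) _
      fun i j x hi hj => ?_
    · obtain ⟨i, hi, hi'⟩ := hbasis V hV x hx
      exact ⟨⟨i, hi'⟩, hi⟩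
    · obtain ⟨k, hk, hk'⟩ := hbasis (B i ⊓ B j) (inf_le_left.trans (hB i)) x ⟨hi, hj⟩
      refine ⟨B k, hk'.trans inf_le_left, hk'.trans inf_le_right, hk, ?_⟩
      rw [hα, hα, res_res, res_res]
  choose β hβ huniq using key
  simp only [Subtype.forall] at hβ huniq
  refine ⟨⟨fun V h => { toFun := β V h, map_add' := fun s s' => ?_, map_smul' := fun a s => ?_ },
    fun {V V'} h h' s => ?_⟩, fun i => ?_⟩
  · symm
    refine huniq V h _ _ fun i hi => ?_
    rw [map_add, map_add, map_add, hβ, hβ]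
  · symm
    refine huniq V h _ _ fun i hi => ?_
    rw [RingHom.id_apply, res_smul, res_smul, map_smul, hβ]
  · refine huniq V' _ _ _ fun i hi => ?_
    exact ((res_res _ _ _).trans (hβ V h s i (hi.trans h'))).trans
      (congrArg _ (res_res _ _ _).symm)
  · ext s
    symm
    refine huniq _ _ _ _ fun j hj => hα i j hj s

/-- A linear map between the sections over an affine open extends. -/
theorem exists_of_affine (hM : M.IsQuasicoherent) (hU : IsAffineOpen U)
    (α : Γ(M, U) →ₗ[Γ(X, U)] Γ(N, U)) : ∃ φ : HomSec M N U, φ.app U le_rfl = α := by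
  have key (f : Γ(X, U)) : ∃ β : Γ(M, X.basicOpen f) →ₗ[Γ(X, X.basicOpen f)]
      Γ(N, X.basicOpen f), ∀ s, β (res M (X.basicOpen_le f) s) = res N (X.basicOpen_le f) (α s) :=
    exists_extend_basicOpen hM hU f ((res N (X.basicOpen_le f)).comp α.toAddMonoidHom) fun a s => by
      simp [res_smul]
  choose β hβ using key
  have hcomp (f g : Γ(X, U)) (h : X.basicOpen g ≤ X.basicOpen f) (s) :
      res N h (β f s) = β g (res M h s) := by
    obtain ⟨n, t, ht⟩ := exists_res_basicOpen hM hU f s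
    have hu : IsUnit (fres h (fres (X.basicOpen_le f) f)) := (isUnit_fres_basicOpen f).map _
    apply (hu.pow n).smul_left_cancel.mp
    rw [← map_pow, ← LinearMap.map_smul, ← res_smul, ← res_smul, ← LinearMap.map_smul, ← ht, hβ,
      res_res, res_res, hβ]
  obtain ⟨φ, hφ⟩ := exists_of_basis (fun f : Γ(X, U) => X.basicOpen f)
    (fun f => X.basicOpen_le f) (fun V hV x hx => by
      obtain ⟨f, hf, hxf⟩ := hU.exists_basicOpen_mem_le hx (hV hx)
      exact ⟨f, hxf, hf⟩) β hcomp
  refine ⟨φ, LinearMap.ext fun s => eq_of_locally fun x hx => ?_⟩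
  obtain ⟨f, -, hf⟩ := hU.exists_basicOpen_mem_le hx hx
  exact ⟨_, X.basicOpen_le f, hf, by rw [φ.res_app, hφ, hβ]⟩

/-- Basic opens of `U` form a basis, and over each of them the map is determined by its values on
restrictions of sections from `U`. -/
theorem ext_affine (hM : M.IsQuasicoherent) (hU : IsAffineOpen U) {φ ψ : HomSec M N U}
    (h : φ.app U le_rfl = ψ.app U le_rfl) : φ = ψ := by
  ext V hV s
  refine eq_of_locally fun x hx => ?_
  obtain ⟨f, hf, hxf⟩ := hU.exists_basicOpen_mem_le hx (hV hx)
  refine ⟨_, hf, hxf, ?_⟩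
  rw [φ.res_app, ψ.res_app]
  refine LinearMap.congr_fun (ext_basicOpen hM hU f fun s => ?_) _
  rw [← φ.res_app le_rfl, ← ψ.res_app le_rfl, h]

end HomSec

variable (M N) in
/-- The abelian presheaf underlying the sheaf of homomorphisms. -/
def homPresheaf : TopCat.Presheaf Ab.{u} X where
  obj U := AddCommGrpCat.of (HomSec M N U.unop)
  map i := AddCommGrpCat.ofHom (HomSec.restrict i.unop.le)

/-- The open sets contained in some member of the cover form a basis of the union, so gluing is an
instance of `HomSec.exists_of_basis`. -/
theorem isSheaf_homPresheaf : (homPresheaf M N).IsSheaf := by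
  refine (TopCat.Presheaf.isSheaf_iff_isSheafUniqueGluing _).mpr ?_
  intro ι U sf' hsf
  let sf (i : ι) : HomSec M N (U i) := sf' i
  have hsf' (i j : ι) (V : X.Opens) (hi : V ≤ U i) (hj : V ≤ U j) :
      (sf i).app V hi = (sf j).app V hj :=
    congrArg (fun φ : HomSec M N (U i ⊓ U j) => φ.app V (le_inf hi hj)) (hsf i j)
  obtain ⟨φ, hφ⟩ := HomSec.exists_of_basis (U := iSup U)
    (fun p : {p : ι × X.Opens // p.2 ≤ U p.1} => p.1.2) (fun p => p.2.trans (le_iSup U p.1.1))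
    (fun V hV x hx => by
      obtain ⟨i, hi⟩ := TopologicalSpace.Opens.mem_iSup.mp (hV hx)
      exact ⟨⟨⟨i, U i ⊓ V⟩, inf_le_left⟩, ⟨hi, hx⟩, inf_le_right⟩)
    (fun p => (sf p.1.1).app p.1.2 p.2) (fun p q h s => by
      rw [HomSec.res_app, hsf' p.1.1 q.1.1])
  refine ⟨φ, fun i => ?_, fun ψ hψ => ?_⟩
  · exact HomSec.ext (funext fun V => funext fun hV => hφ ⟨⟨i, V⟩, hV⟩)
  · change HomSec M N (iSup U) at ψ
    refine HomSec.ext (funext fun V => funext fun hV => LinearMap.ext fun s =>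
      eq_of_locally fun x hx => ?_)
    obtain ⟨i, hi⟩ := TopologicalSpace.Opens.mem_iSup.mp (hV hx)
    refine ⟨U i ⊓ V, inf_le_right, ⟨hi, hx⟩, ?_⟩
    rw [ψ.res_app, φ.res_app, hφ ⟨⟨i, U i ⊓ V⟩, inf_le_left⟩]
    exact congrArg (fun φ : HomSec M N (U i) => φ.app (U i ⊓ V) inf_le_left _) (hψ i)

variable (M N) in
instance (U : (TopologicalSpace.Opens X)ᵒᵖ) :
    Module (X.ringCatSheaf.obj.obj U) ((homPresheaf M N).obj U) :=
  inferInstanceAs (Module Γ(X, U.unop) (HomSec M N U.unop))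

variable (M N) in
/-- The sheaf of homomorphisms. -/
def homSheaf : X.Modules where
  val := PresheafOfModules.ofPresheaf (homPresheaf M N) fun U V i a φ => by
    refine HomSec.ext (funext fun W => funext fun hW => ?_)
    change fres _ a • _ = fres _ (fres i.unop.le a) • _
    exact congrArg (· • HomSec.app (M := M) (N := N) φ W _)
      (fres_fres i.unop.le hW (show Γ(X, U.unop) from a)).symm
  isSheaf := isSheaf_homPresheaf

/-- Sections of the sheaf of homomorphisms. -/
def homSheafEquiv (M N : X.Modules) (U : X.Opens) :
    Γ(homSheaf M N, U) ≃ₗ[Γ(X, U)] HomSec M N U :=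
  LinearEquiv.refl Γ(X, U) (HomSec M N U)

end HomSections

/-! ### Commutative algebra of projective modules, tensor products and perfect pairings. -/

section ModuleLemmas

open TensorProduct

variable {A : Type*} [CommRing A] {E F G L P Q R E' F' G' L' M N : Type*}
  [AddCommGroup E] [AddCommGroup F] [AddCommGroup G] [AddCommGroup L] [AddCommGroup P]
  [AddCommGroup Q] [AddCommGroup R] [AddCommGroup E'] [AddCommGroup F'] [AddCommGroup G']
  [AddCommGroup L'] [AddCommGroup M] [AddCommGroup N]
  [Module A E] [Module A F] [Module A G] [Module A L] [Module A P] [Module A Q] [Module A R]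
  [Module A E'] [Module A F'] [Module A G'] [Module A L'] [Module A M] [Module A N]

theorem exists_dualBasis (A P : Type*) [CommRing A] [AddCommGroup P] [Module A P]
    [Module.Finite A P] [Module.Projective A P] :
    ∃ (n : ℕ) (e : Fin n → P) (ε : Fin n → P →ₗ[A] A), ∀ x, ∑ i, ε i x • e i = x := by
  obtain ⟨n, f, g, -, -, h⟩ := Module.Finite.exists_comp_eq_id_of_projective A P
  refine ⟨n, fun i => f (Pi.single i 1), fun i => LinearMap.proj i ∘ₗ g, fun x => ?_⟩
  have h1 : f (g x) = x := LinearMap.congr_fun h x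
  conv_rhs => rw [← h1, LinearMap.pi_apply_eq_sum_univ f (g x)]
  refine Finset.sum_congr rfl fun i _ => ?_
  have h2 : (Pi.single i 1 : Fin n → A) = fun j => if i = j then 1 else 0 :=
    funext fun j => by simp [Pi.single_apply, eq_comm]
  exact congrArg (fun v => g x i • f v) h2

theorem finite_of_retract [Module.Finite A E] (r : E →ₗ[A] E') (i : E' →ₗ[A] E)
    (h : ∀ x, r (i x) = x) : Module.Finite A E' :=
  Module.Finite.of_surjective r fun x => ⟨i x, h x⟩

theorem projective_of_retract [Module.Projective A E] (r : E →ₗ[A] E') (i : E' →ₗ[A] E)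
    (h : ∀ x, r (i x) = x) : Module.Projective A E' :=
  Module.Projective.of_split i r (LinearMap.ext h)

/-- For a dual basis `(e_i, ε_i)` of `P`, evaluation at the `e_i` embeds `Hom(P, Q)` into `Q^n`, and
`(q_i) ↦ ∑ ε_i q_i` is a retraction. Finiteness and projectivity of `Hom(P, Q)` follow. -/
theorem exists_hom_retract (A P Q : Type*) [CommRing A] [AddCommGroup P] [Module A P]
    [AddCommGroup Q] [Module A Q] [Module.Finite A P] [Module.Projective A P] :
    ∃ (n : ℕ) (r : (Fin n → Q) →ₗ[A] (P →ₗ[A] Q)) (i : (P →ₗ[A] Q) →ₗ[A] (Fin n → Q)),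
      ∀ x, r (i x) = x := by
  obtain ⟨n, e, ε, h⟩ := exists_dualBasis A P
  refine ⟨n, ∑ i, LinearMap.smulRightₗ (ε i) ∘ₗ LinearMap.proj i,
    LinearMap.pi fun i => LinearMap.applyₗ (e i), fun x => ?_⟩
  ext y
  conv_rhs => rw [← h y]
  simp

theorem finite_linearMap [Module.Finite A P] [Module.Projective A P] [Module.Finite A Q] :
    Module.Finite A (P →ₗ[A] Q) := by
  obtain ⟨n, r, i, h⟩ := exists_hom_retract A P Q
  exact finite_of_retract r i h

theorem projective_linearMap [Module.Finite A P] [Module.Projective A P] [Module.Projective A Q] :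
    Module.Projective A (P →ₗ[A] Q) := by
  obtain ⟨n, r, i, h⟩ := exists_hom_retract A P Q
  have : Module.Projective A (Fin n → Q) :=
    have : Module.Projective A (Π₀ _ : Fin n, Q) := inferInstance
    Module.Projective.of_equiv DFinsupp.linearEquivFunOnFintype
  exact projective_of_retract r i h

theorem IsTensorProduct.flip {b : E →ₗ[A] F →ₗ[A] G} (h : IsTensorProduct b) :
    IsTensorProduct b.flip := by
  have : TensorProduct.lift b.flip = TensorProduct.lift b ∘ₗ (TensorProduct.comm A F E) := by
    ext; simp
  rw [IsTensorProduct, this]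
  exact (h.comp (TensorProduct.comm A F E).bijective :)

theorem isTensorProduct_smul : IsTensorProduct (LinearMap.lsmul A F) := by
  have : TensorProduct.lift (LinearMap.lsmul A F) = (TensorProduct.lid A F).toLinearMap := by
    ext; simp
  rw [IsTensorProduct, this]
  exact (TensorProduct.lid A F).bijective

/-- For a perfect pairing of `E` and `D`, `Hom(D, F)` is the tensor product of `E` and `F`. -/
theorem isTensorProduct_of_isPerfPair [Module.Finite A P] [Module.Projective A P]
    (p : E →ₗ[A] P →ₗ[A] A) (hp : p.IsPerfPair) (b : E →ₗ[A] F →ₗ[A] (P →ₗ[A] F))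
    (hb : ∀ e f d, b e f d = p e d • f) : IsTensorProduct b := by
  have key : TensorProduct.lift b = dualTensorHom A P F ∘ₗ LinearMap.rTensor F p := by
    ext; simp [hb]
  have h1 : Function.Bijective (LinearMap.rTensor F p) :=
    (LinearEquiv.rTensor F (LinearEquiv.ofBijective p hp.bijective_left)).bijective
  rw [IsTensorProduct, key]
  exact (dualTensorHom_bijective (R := A) (M := P) (N := F)).comp h1

/-- The form `d` identifies `L'` with `Hom(M ⊗ E, A) = Hom(M, Hom(E, A))`, and `c` identifies `E'`
with `Hom(E, A)`. Under these identifications `τ'` becomes the isomorphism `M ⊗ E' ≅ Hom(M, E')`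
given by the form `b` on `M`. -/
theorem IsTensorProduct.of_isPerfPair [Module.Finite A M] [Module.Projective A M]
    {b : M →ₗ[A] M →ₗ[A] A} (hb : b.IsPerfPair) {c : E →ₗ[A] E' →ₗ[A] A} (hc : c.IsPerfPair)
    {d : L →ₗ[A] L' →ₗ[A] A} (hd : d.IsPerfPair) {τ : M →ₗ[A] E →ₗ[A] L}
    (hτ : IsTensorProduct τ) {τ' : M →ₗ[A] E' →ₗ[A] L'}
    (h : ∀ m m' e e', d (τ m e) (τ' m' e') = b m m' * c e e') : IsTensorProduct τ' := by
  let κ : L' →ₗ[A] M →ₗ[A] E →ₗ[A] A :=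
    (TensorProduct.lift.equiv (.id A) M E A).symm.toLinearMap ∘ₗ
      LinearMap.lcomp A A (TensorProduct.lift τ) ∘ₗ d.flip
  have hκ (l m e) : κ l m e = d (τ m e) l := by simp [κ]
  have hκb : Function.Bijective κ := by
    have h1 : Function.Bijective (LinearMap.lcomp A A (TensorProduct.lift τ)) :=
      ((LinearEquiv.ofBijective _ hτ).congrLeft A A).symm.bijective
    have h2 : Function.Bijective (TensorProduct.lift.equiv (.id A) M E A).symm :=
      (TensorProduct.lift.equiv (.id A) M E A).symm.bijective
    exact h2.comp (h1.comp hd.bijective_right)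
  let σ : (M →ₗ[A] E') →ₗ[A] M →ₗ[A] E →ₗ[A] A := c.flip.compRight A
  have hσ : Function.Bijective σ :=
    ((LinearEquiv.ofBijective c.flip hc.bijective_right).congrRight (M := M)).bijective
  let β : M →ₗ[A] E' →ₗ[A] M →ₗ[A] E' := LinearMap.mk₂ A (fun m e => (b.flip m).smulRight e)
    (fun m m' e => by ext; simp [add_smul]) (fun a m e => by ext; simp [mul_smul])
    (fun m e e' => by ext; simp) (fun a m e => by ext; simp [smul_comm a])
  have hβ : IsTensorProduct β := isTensorProduct_of_isPerfPair b.flip hb.flip β fun m e m' => by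
    simp [β]
  have key : κ ∘ₗ TensorProduct.lift τ' = σ ∘ₗ TensorProduct.lift β := by
    ext m e m' e'
    simp [σ, β, hκ, h]
  refine (Function.Bijective.of_comp_iff' hκb _).mp ?_
  have := congrArg DFunLike.coe key
  rw [LinearMap.coe_comp] at this
  rw [this]
  exact hσ.comp hβ

/-- By `hq` the idempotent of `G` is the tensor product of the idempotents of `E` and `F`, so its
image is the tensor product of their images. This is how weight parts of tensor products are
identified. -/
theorem IsTensorProduct.of_retract {τ : E →ₗ[A] F →ₗ[A] G} (h : IsTensorProduct τ)
    (i : E' →ₗ[A] E) (r : E →ₗ[A] E') (hi : ∀ x, r (i x) = x)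
    (j : F' →ₗ[A] F) (s : F →ₗ[A] F') (hj : ∀ x, s (j x) = x)
    (k : G' →ₗ[A] G) (π : G →ₗ[A] G') (hk : ∀ x, π (k x) = x)
    (hq : ∀ e f, k (π (τ e f)) = τ (i (r e)) (j (s f)))
    {τ' : E' →ₗ[A] F' →ₗ[A] G'} (hτ' : ∀ e f, τ' e f = π (τ (i e) (j f))) :
    IsTensorProduct τ' := by
  let e := LinearEquiv.ofBijective (TensorProduct.lift τ) h
  have he (x y) : e.symm (τ x y) = x ⊗ₜ y := e.symm_apply_eq.mpr (TensorProduct.lift.tmul x y).symm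
  have h1 (x) : TensorProduct.lift τ' (TensorProduct.map r s (e.symm x)) = π x := by
    obtain ⟨t, rfl⟩ := e.surjective x
    rw [e.symm_apply_apply]
    induction t with
    | zero => simp
    | add x y hx hy => simp only [map_add, hx, hy]
    | tmul x y =>
      rw [show e (x ⊗ₜ y) = τ x y from TensorProduct.lift.tmul x y, TensorProduct.map_tmul,
        TensorProduct.lift.tmul, hτ', ← hq, hk]
  refine Function.bijective_iff_has_inverse.mpr
    ⟨fun x => TensorProduct.map r s (e.symm (k x)), fun t => ?_, fun x => (h1 _).trans (hk x)⟩
  induction t with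
  | zero => simp
  | add x y hx hy => simpa only [map_add] using congrArg₂ (· + ·) hx hy
  | tmul x y => simp [hτ', hq, hi, hj, he]

/-- By `h` the idempotents `i ∘ r` and `j ∘ s` are adjoint, so functionals on one image are
represented by the other image. -/
theorem isPerfPair_of_retract {b : E →ₗ[A] F →ₗ[A] A} (hb : b.IsPerfPair)
    (i : E' →ₗ[A] E) (r : E →ₗ[A] E') (hi : ∀ x, r (i x) = x)
    (j : F' →ₗ[A] F) (s : F →ₗ[A] F') (hj : ∀ x, s (j x) = x)
    (h : ∀ x y, b (i (r x)) y = b x (j (s y)))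
    {b' : E' →ₗ[A] F' →ₗ[A] A} (hb' : ∀ x y, b' x y = b (i x) (j y)) : b'.IsPerfPair where
  bijective_left := by
    refine ⟨fun x y hxy => ?_, fun φ => ?_⟩
    · have : i x = i y := hb.bijective_left.1 (LinearMap.ext fun z => by
        have h1 := LinearMap.congr_fun hxy (s z)
        rwa [hb', hb', ← h, ← h, hi, hi] at h1)
      rw [← hi x, this, hi]
    · obtain ⟨x, hx⟩ := hb.bijective_left.2 (φ ∘ₗ s)
      refine ⟨r x, LinearMap.ext fun y => ?_⟩
      rw [hb', h, hj, hx, LinearMap.comp_apply, hj]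
  bijective_right := by
    refine ⟨fun x y hxy => ?_, fun φ => ?_⟩
    · have : j x = j y := hb.bijective_right.1 (LinearMap.ext fun z => by
        have h1 := LinearMap.congr_fun hxy (r z)
        simp only [LinearMap.flip_apply] at h1 ⊢
        rwa [hb', hb', h, h, hj, hj] at h1)
      rw [← hj x, this, hj]
    · obtain ⟨x, hx⟩ := hb.bijective_right.2 (φ ∘ₗ r)
      refine ⟨s x, LinearMap.ext fun y => ?_⟩
      have h1 := LinearMap.congr_fun hx (i y)
      simp only [LinearMap.flip_apply] at h1 ⊢
      rw [hb', ← h, hi, h1, LinearMap.comp_apply, hi]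

/-- The hyperbolic form on `L ⊕ Q` is perfect. -/
theorem isPerfPair_hyperbolic {c : L →ₗ[A] Q →ₗ[A] A} (hc : c.IsPerfPair)
    (i : L →ₗ[A] E) (j : Q →ₗ[A] E) (r : E →ₗ[A] L) (s : E →ₗ[A] Q)
    (hir : ∀ x, r (i x) = x) (hjs : ∀ x, s (j x) = x) (his : ∀ x, s (i x) = 0)
    (hjr : ∀ x, r (j x) = 0) (hsum : ∀ x, i (r x) + j (s x) = x)
    {b : E →ₗ[A] E →ₗ[A] A} (hb : ∀ x y, b x y = c (r x) (s y) + c (r y) (s x)) :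
    b.IsPerfPair := by
  have hsymm : b.flip = b := by
    ext x y
    rw [LinearMap.flip_apply, hb, hb, add_comm]
  have hbij : Function.Bijective b := by
    refine ⟨fun x y hxy => ?_, fun φ => ?_⟩
    · have h1 : r x = r y := hc.bijective_left.1 (LinearMap.ext fun z => by
        have := LinearMap.congr_fun hxy (j z)
        simpa [hb, hjr, hjs] using this)
      have h2 : s x = s y := hc.bijective_right.1 (LinearMap.ext fun z => by
        have := LinearMap.congr_fun hxy (i z)
        simpa [hb, hir, his] using this)
      rw [← hsum x, ← hsum y, h1, h2]
    · obtain ⟨x, hx⟩ := hc.bijective_left.2 (φ ∘ₗ j)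
      obtain ⟨y, hy⟩ := hc.bijective_right.2 (φ ∘ₗ i)
      refine ⟨i x + j y, LinearMap.ext fun z => ?_⟩
      conv_rhs => rw [← hsum z, map_add]
      have h1 := LinearMap.congr_fun hx (s z)
      have h2 := LinearMap.congr_fun hy (r z)
      simp only [LinearMap.flip_apply, LinearMap.comp_apply] at h1 h2
      rw [hb, map_add r, map_add s, hir, hjs, his, hjr, add_zero, zero_add, h1, h2]
      exact add_comm _ _
  exact ⟨hbij, by rwa [hsymm]⟩

/-- Distributivity of the tensor product over direct sums; the inverse is assembled from the
inverses for the two summands. -/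
theorem IsTensorProduct.directSum {τ₁ : M →ₗ[A] E →ₗ[A] L} {τ₂ : M →ₗ[A] F →ₗ[A] Q}
    (h₁ : IsTensorProduct τ₁) (h₂ : IsTensorProduct τ₂)
    (i : E →ₗ[A] P) (j : F →ₗ[A] P) (r : P →ₗ[A] E) (s : P →ₗ[A] F)
    (hir : ∀ x, r (i x) = x) (hjs : ∀ x, s (j x) = x) (his : ∀ x, s (i x) = 0)
    (hjr : ∀ x, r (j x) = 0) (hsum : ∀ x, i (r x) + j (s x) = x)
    (i' : L →ₗ[A] R) (j' : Q →ₗ[A] R) (r' : R →ₗ[A] L) (s' : R →ₗ[A] Q)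
    (hir' : ∀ x, r' (i' x) = x) (hjs' : ∀ x, s' (j' x) = x) (his' : ∀ x, s' (i' x) = 0)
    (hjr' : ∀ x, r' (j' x) = 0) (hsum' : ∀ x, i' (r' x) + j' (s' x) = x)
    {τ : M →ₗ[A] P →ₗ[A] R} (h : ∀ m x, τ m x = i' (τ₁ m (r x)) + j' (τ₂ m (s x))) :
    IsTensorProduct τ := by
  let e₁ := LinearEquiv.ofBijective (TensorProduct.lift τ₁) h₁
  let e₂ := LinearEquiv.ofBijective (TensorProduct.lift τ₂) h₂
  have h1 (m e) : e₁.symm (τ₁ m e) = m ⊗ₜ e := e₁.symm_apply_eq.mpr (TensorProduct.lift.tmul m e).symm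
  have h2 (m e) : e₂.symm (τ₂ m e) = m ⊗ₜ e := e₂.symm_apply_eq.mpr (TensorProduct.lift.tmul m e).symm
  have h3 (x) : TensorProduct.lift τ (LinearMap.lTensor M i (e₁.symm x)) = i' x := by
    obtain ⟨t, rfl⟩ := e₁.surjective x
    rw [e₁.symm_apply_apply]
    induction t with
    | zero => simp
    | add x y hx hy => simp only [map_add, hx, hy]
    | tmul x y =>
      rw [show e₁ (x ⊗ₜ y) = τ₁ x y from TensorProduct.lift.tmul x y]
      simp [h, hir, his]
  have h4 (x) : TensorProduct.lift τ (LinearMap.lTensor M j (e₂.symm x)) = j' x := by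
    obtain ⟨t, rfl⟩ := e₂.surjective x
    rw [e₂.symm_apply_apply]
    induction t with
    | zero => simp
    | add x y hx hy => simp only [map_add, hx, hy]
    | tmul x y =>
      rw [show e₂ (x ⊗ₜ y) = τ₂ x y from TensorProduct.lift.tmul x y]
      simp [h, hjs, hjr]
  refine Function.bijective_iff_has_inverse.mpr
    ⟨fun x => LinearMap.lTensor M i (e₁.symm (r' x)) + LinearMap.lTensor M j (e₂.symm (s' x)),
      fun t => ?_, fun x => ?_⟩
  · induction t with
    | zero => simp
    | add x y hx hy =>
      simp only [map_add] at hx hy ⊢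
      rw [← hx, ← hy, hx, hy]
      nth_rewrite 3 [← hx]
      nth_rewrite 3 [← hy]
      abel
    | tmul m x =>
      simp [h, hir', hjs', his', hjr', h1, h2, ← TensorProduct.tmul_add, hsum]
  · rw [map_add, h3, h4, hsum']

end ModuleLemmas

/-! ### Vector bundles, their duals and their tensor products. -/

section VectorBundles

variable {X : Scheme.{u}} {M N K M' N' : X.Modules} {U V W : X.Opens}

/-- The linear map on sections induced by a morphism of modules. -/
def lapp (φ : M ⟶ N) (U : X.Opens) : Γ(M, U) →ₗ[Γ(X, U)] Γ(N, U) where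
  toFun := φ.app U
  map_add' := map_add _
  map_smul' r x := φ.app_smul r x

@[simp] theorem lapp_apply (φ : M ⟶ N) (s : Γ(M, U)) : lapp φ U s = φ.app U s := rfl

theorem id_app_apply (s : Γ(M, U)) : (𝟙 M : M ⟶ M).app U s = s := by simp

theorem zero_app_apply (s : Γ(M, U)) : (0 : M ⟶ N).app U s = 0 := by simp

theorem add_app_apply (φ ψ : M ⟶ N) (s : Γ(M, U)) :
    (φ + ψ).app U s = φ.app U s + ψ.app U s := by simp

/-- The morphism given by a compatible family of linear maps on sections. -/
def homOfSec (φ : HomSec M N ⊤) : M ⟶ N :=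
  ⟨PresheafOfModules.homMk
    { app := fun U => AddCommGrpCat.ofHom (φ.app U.unop le_top).toAddMonoidHom
      naturality := fun U V i => by
        ext s
        exact (φ.res_app le_top i.unop.le s).symm }
    fun U r m => (φ.app U.unop le_top).map_smul r m⟩

theorem hom_ext_affine {φ ψ : M ⟶ N} (h : ∀ U, IsAffineOpen U → ∀ s, φ.app U s = ψ.app U s) :
    φ = ψ := by
  refine Scheme.Modules.hom_ext _ _ fun U => ?_
  ext s
  refine eq_of_locally fun x hx => ?_
  obtain ⟨V, hV, hxV, hVU⟩ := exists_affine_le hx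
  exact ⟨V, hVU, hxV, by rw [← app_res, ← app_res, h V hV]⟩

/-- Morphisms of modules can be defined on the affine opens. -/
theorem exists_hom_of_affine (α : ∀ U, IsAffineOpen U → (Γ(M, U) →ₗ[Γ(X, U)] Γ(N, U)))
    (hα : ∀ U V (hU : IsAffineOpen U) (hV : IsAffineOpen V) (h : V ≤ U) s,
      res N h (α U hU s) = α V hV (res M h s)) :
    ∃ φ : M ⟶ N, ∀ U (hU : IsAffineOpen U) s, φ.app U s = α U hU s := by
  obtain ⟨φ, hφ⟩ := HomSec.exists_of_basis (U := (⊤ : X.Opens))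
    (fun p : {U : X.Opens // IsAffineOpen U} => p.1) (fun _ => le_top)
    (fun V _ x hx => by
      obtain ⟨V', hV', hxV, hVU⟩ := exists_affine_le hx
      exact ⟨⟨V', hV'⟩, hxV, hVU⟩)
    (fun p => α p.1 p.2) (fun p q h s => hα _ _ _ _ _ _)
  exact ⟨homOfSec φ, fun U hU s => LinearMap.congr_fun (hφ ⟨U, hU⟩) s⟩

theorem exists_iso_of_affine (α : ∀ U, IsAffineOpen U → (Γ(M, U) ≃ₗ[Γ(X, U)] Γ(N, U)))
    (hα : ∀ U V (hU : IsAffineOpen U) (hV : IsAffineOpen V) (h : V ≤ U) s,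
      res N h (α U hU s) = α V hV (res M h s)) :
    ∃ e : M ≅ N, ∀ U (hU : IsAffineOpen U) s, e.hom.app U s = α U hU s := by
  obtain ⟨φ, hφ⟩ := exists_hom_of_affine (fun U hU => (α U hU).toLinearMap) hα
  obtain ⟨ψ, hψ⟩ := exists_hom_of_affine (fun U hU => (α U hU).symm.toLinearMap)
    (fun U V hU hV h s => by
      apply (α V hV).injective
      simp only [LinearEquiv.coe_coe]
      rw [← hα U V hU hV, LinearEquiv.apply_symm_apply, LinearEquiv.apply_symm_apply])
  refine ⟨⟨φ, ψ, hom_ext_affine fun U hU s => ?_, hom_ext_affine fun U hU s => ?_⟩, hφ⟩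
  · rw [comp_app_apply, hφ U hU, hψ U hU, id_app_apply]
    simp
  · rw [comp_app_apply, hψ U hU, hφ U hU, id_app_apply]
    simp

theorem exists_iso_of_bijective (φ : M ⟶ N)
    (h : ∀ U, IsAffineOpen U → Function.Bijective (φ.app U)) : ∃ e : M ≅ N, e.hom = φ := by
  obtain ⟨e, he⟩ := exists_iso_of_affine
    (fun U hU => LinearEquiv.ofBijective (lapp φ U) (h U hU))
    (fun U V hU hV h s => (app_res φ h s).symm)
  exact ⟨e, hom_ext_affine he⟩

/-- Finite locally free modules. -/
structure IsVB (M : X.Modules) : Prop where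
  quasicoherent : M.IsQuasicoherent
  finite : ∀ U : X.Opens, IsAffineOpen U → Module.Finite Γ(X, U) Γ(M, U)
  projective : ∀ U : X.Opens, IsAffineOpen U → Module.Projective Γ(X, U) Γ(M, U)

theorem isVB_structureSheaf (X : Scheme.{u}) : IsVB (structureSheaf X) where
  quasicoherent := isQuasicoherent_structureSheaf X
  finite U _ := inferInstanceAs (Module.Finite Γ(X, U) Γ(X, U))
  projective U _ := inferInstanceAs (Module.Projective Γ(X, U) Γ(X, U))

theorem Bundle.isVB {Λ : Type} [AddCommGroup Λ] (E : Bundle X Λ) : IsVB E.mod :=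
  ⟨E.quasicoherent, E.finite, E.projective⟩

theorem IsVB.of_retract (hN : IsVB N) (i : M ⟶ N) (r : N ⟶ M) (h : i ≫ r = 𝟙 M) : IsVB M := by
  have hri (U : X.Opens) (x : Γ(M, U)) : r.app U (i.app U x) = x := by
    rw [← comp_app_apply, h, id_app_apply]
  refine ⟨isQuasicoherent_of_localizing (fun U hU f s => ?_) (fun U hU f t ht => ?_),
    fun U hU => ?_, fun U hU => ?_⟩
  · obtain ⟨n, t, ht⟩ := exists_res_basicOpen hN.1 hU f (i.app _ s)
    refine ⟨n, r.app U t, ?_⟩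
    rw [← app_res, ht, r.app_smul, hri]
  · obtain ⟨n, hn⟩ := exists_pow_smul_eq_zero hN.1 hU f (i.app U t) (by rw [← app_res, ht, map_zero])
    exact ⟨n, by rw [← hri U (f ^ n • t), i.app_smul, hn, map_zero]⟩
  · have := hN.2 U hU
    exact finite_of_retract (lapp r U) (lapp i U) (hri U)
  · have := hN.3 U hU
    exact projective_of_retract (lapp r U) (lapp i U) (hri U)

/-- The hypothesis makes `K` a retract of the sum of `M` and `N`; powers of `f` needed for the two
components are combined into one. -/
theorem IsVB.of_sum (hM : IsVB M) (hN : IsVB N) (i : M ⟶ K) (j : N ⟶ K) (r : K ⟶ M) (s : K ⟶ N)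
    (h : r ≫ i + s ≫ j = 𝟙 K) : IsVB K := by
  have hsum (U : X.Opens) (x : Γ(K, U)) : i.app U (r.app U x) + j.app U (s.app U x) = x := by
    rw [← comp_app_apply, ← comp_app_apply, ← add_app_apply, h, id_app_apply]
  refine ⟨isQuasicoherent_of_localizing (fun U hU f x => ?_) (fun U hU f t ht => ?_),
    fun U hU => ?_, fun U hU => ?_⟩
  · obtain ⟨n, t, ht⟩ := exists_res_basicOpen hM.1 hU f (r.app _ x)
    obtain ⟨m, t', ht'⟩ := exists_res_basicOpen hN.1 hU f (s.app _ x)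
    refine ⟨n + m, f ^ m • i.app U t + f ^ n • j.app U t', ?_⟩
    rw [map_add, res_smul, res_smul, ← app_res, ← app_res, ht, ht', i.app_smul, j.app_smul,
      smul_smul, smul_smul, map_pow, map_pow, ← pow_add, ← pow_add, add_comm m, ← smul_add, hsum]
  · obtain ⟨n, hn⟩ := exists_pow_smul_eq_zero hM.1 hU f (r.app U t) (by rw [← app_res, ht, map_zero])
    obtain ⟨m, hm⟩ := exists_pow_smul_eq_zero hN.1 hU f (s.app U t) (by rw [← app_res, ht, map_zero])
    refine ⟨n + m, ?_⟩
    rw [← hsum U t, smul_add, ← i.app_smul, ← j.app_smul]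
    rw [pow_add, mul_smul, smul_comm, hn, smul_zero, map_zero, mul_smul, hm, smul_zero, map_zero,
      add_zero]
  · have := hM.2 U hU
    have := hN.2 U hU
    exact finite_of_retract ((lapp i U).coprod (lapp j U)) ((lapp r U).prod (lapp s U)) (hsum U)
  · have := hM.3 U hU
    have := hN.3 U hU
    exact projective_of_retract ((lapp i U).coprod (lapp j U)) ((lapp r U).prod (lapp s U)) (hsum U)

/-- Sections of the sheaf of homomorphisms over an affine open. -/
def homAffineEquiv (hM : M.IsQuasicoherent) (N : X.Modules) (hU : IsAffineOpen U) :
    Γ(homSheaf M N, U) ≃ₗ[Γ(X, U)] (Γ(M, U) →ₗ[Γ(X, U)] Γ(N, U)) :=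
  (homSheafEquiv M N U).trans <| LinearEquiv.ofBijective
    ({ toFun := fun φ => φ.app U le_rfl
       map_add' := fun _ _ => rfl
       map_smul' := fun a φ => by simp [fres_self] } :
      HomSec M N U →ₗ[Γ(X, U)] (Γ(M, U) →ₗ[Γ(X, U)] Γ(N, U)))
    ⟨fun _ _ h => HomSec.ext_affine hM hU h, HomSec.exists_of_affine hM hU⟩

/-- A homomorphism over `D(f)` is determined by the images of finitely many dual basis vectors, so a
single power of `f` clears all denominators. -/
theorem exists_res_homSheaf (hM : IsVB M) (hN : N.IsQuasicoherent) (hU : IsAffineOpen U)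
    (f : Γ(X, U)) (φ : HomSec M N (X.basicOpen f)) :
    ∃ (n : ℕ) (ψ : HomSec M N U),
      ψ.restrict (X.basicOpen_le f) = fres (X.basicOpen_le f) f ^ n • φ := by
  have := hM.2 U hU
  have := hM.3 U hU
  obtain ⟨k, e, ε, he⟩ := exists_dualBasis Γ(X, U) Γ(M, U)
  have h1 := fun i => exists_res_basicOpen hN hU f (φ.app _ le_rfl (res M (X.basicOpen_le f) (e i)))
  choose n t ht using h1
  -- The image of `e i` already carries `f ^ n i`; the remaining exponents are added so that every
  -- summand carries the same power `∑ n i`.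
  obtain ⟨ψ, hψ⟩ := HomSec.exists_of_affine (N := N) hM.1 hU
    (∑ i, (ε i).smulRight (f ^ (∑ j ∈ Finset.univ.erase i, n j) • t i))
  refine ⟨∑ i, n i, ψ, HomSec.ext_affine hM.1 (hU.basicOpen f) (ext_basicOpen hM.1 hU f fun s => ?_)⟩
  rw [HomSec.restrict_app, ← ψ.res_app le_rfl, hψ, HomSec.smul_app, fres_self, LinearMap.smul_apply]
  conv_rhs => rw [← he s]
  simp only [LinearMap.sum_apply, LinearMap.smulRight_apply, map_sum, Finset.smul_sum, res_smul,
    map_smul]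
  refine Finset.sum_congr rfl fun i _ => ?_
  rw [ht, map_pow, smul_smul (fres (X.basicOpen_le f) f ^ _), ← pow_add, Finset.sum_erase_add _ _ (Finset.mem_univ i), smul_comm]

theorem exists_pow_smul_homSheaf (hM : IsVB M) (hN : N.IsQuasicoherent) (hU : IsAffineOpen U)
    (f : Γ(X, U)) (φ : HomSec M N U) (h : φ.restrict (X.basicOpen_le f) = 0) :
    ∃ n : ℕ, f ^ n • φ = 0 := by
  have := hM.2 U hU
  have := hM.3 U hU
  obtain ⟨k, e, ε, he⟩ := exists_dualBasis Γ(X, U) Γ(M, U)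
  have h1 := fun i => exists_pow_smul_eq_zero hN hU f (φ.app U le_rfl (e i)) (by
    rw [φ.res_app]
    exact congrArg (fun ψ : HomSec M N (X.basicOpen f) => ψ.app _ le_rfl _) h)
  choose n hn using h1
  refine ⟨∑ i, n i, HomSec.ext_affine hM.1 hU (LinearMap.ext fun s => ?_)⟩
  rw [HomSec.smul_app, fres_self, LinearMap.smul_apply, ← he s]
  simp only [map_sum, map_smul, Finset.smul_sum, HomSec.zero_app, LinearMap.zero_apply]
  refine Finset.sum_congr rfl fun i _ => ?_
  rw [smul_comm, ← Finset.sum_erase_add _ _ (Finset.mem_univ i), pow_add, mul_smul, hn, smul_zero]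

theorem IsVB.homSheaf (hM : IsVB M) (hN : IsVB N) : IsVB (homSheaf M N) := by
  refine ⟨isQuasicoherent_of_localizing (fun U hU f s => ?_) (fun U hU f t ht => ?_),
    fun U hU => ?_, fun U hU => ?_⟩
  · exact exists_res_homSheaf hM hN.1 hU f (homSheafEquiv M N _ s)
  · exact exists_pow_smul_homSheaf hM hN.1 hU f (homSheafEquiv M N _ t) ht
  · have := hM.2 U hU
    have := hM.3 U hU
    have := hN.2 U hU
    have := finite_linearMap (A := Γ(X, U)) (P := Γ(M, U)) (Q := Γ(N, U))
    exact Module.Finite.equiv (homAffineEquiv hM.1 N hU).symm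
  · have := hM.2 U hU
    have := hM.3 U hU
    have := hN.3 U hU
    have := projective_linearMap (A := Γ(X, U)) (P := Γ(M, U)) (Q := Γ(N, U))
    exact Module.Projective.of_equiv (homAffineEquiv hM.1 N hU).symm

/-- Composition with a morphism, on sheaves of homomorphisms. -/
def homSheafMap (M : X.Modules) (φ : N ⟶ K) : homSheaf M N ⟶ homSheaf M K :=
  homOfSec
    { app := fun U _ => (homSheafEquiv M K U).symm.toLinearMap ∘ₗ
        { toFun := fun ψ : HomSec M N U =>
            ⟨fun V h => lapp φ V ∘ₗ ψ.app V h, fun h h' s => by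
              simp [← app_res, ψ.res_app]⟩
          map_add' := fun _ _ => by ext; simp
          map_smul' := fun _ _ => by ext; simp } ∘ₗ (homSheafEquiv M N U).toLinearMap
      res_app := fun _ _ _ => rfl }

/-- Precomposition with a morphism, on sheaves of homomorphisms. -/
def homSheafComap (φ : M ⟶ N) (K : X.Modules) : homSheaf N K ⟶ homSheaf M K :=
  homOfSec
    { app := fun U _ => (homSheafEquiv M K U).symm.toLinearMap ∘ₗ
        { toFun := fun ψ : HomSec N K U =>
            ⟨fun V h => ψ.app V h ∘ₗ lapp φ V, fun h h' s => by
              simp [app_res, ψ.res_app]⟩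
          map_add' := fun _ _ => by ext; simp
          map_smul' := fun _ _ => by ext; simp } ∘ₗ (homSheafEquiv N K U).toLinearMap
      res_app := fun _ _ _ => rfl }

/-- The dual module. -/
def dual (M : X.Modules) : X.Modules := homSheaf M (structureSheaf X)

theorem IsVB.dual (hM : IsVB M) : IsVB (dual M) := hM.homSheaf (isVB_structureSheaf X)

/-- The evaluation pairing of a module with its dual. -/
def evalForm (M : X.Modules) : Form M (dual M) where
  app U := LinearMap.mk₂ Γ(X, U)
    (fun x φ => show Γ(X, U) from (homSheafEquiv M (structureSheaf X) U φ).app U le_rfl x)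
    (fun x y φ => ((homSheafEquiv M (structureSheaf X) U φ).app U le_rfl).map_add x y)
    (fun a x φ => ((homSheafEquiv M (structureSheaf X) U φ).app U le_rfl).map_smul a x)
    (fun x φ ψ => rfl)
    (fun a x φ => by
      change fres le_rfl a • (homSheafEquiv M (structureSheaf X) U φ).app U le_rfl x = _
      rw [fres_self]
      rfl)
  map_app {U V} h x φ := (homSheafEquiv M (structureSheaf X) U φ).res_app le_rfl h.le x

/-- Over an affine open the sections of the dual bundle are the dual module. One half of perfectness
is this identification, the other is reflexivity of finite projective modules. -/
theorem isPerfPair_evalForm (hM : IsVB M) (hU : IsAffineOpen U) :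
    ((evalForm M).app U).IsPerfPair := by
  have := hM.2 U hU
  have := hM.3 U hU
  let e : Γ(dual M, U) ≃ₗ[Γ(X, U)] Module.Dual Γ(X, U) Γ(M, U) :=
    homAffineEquiv hM.1 (structureSheaf X) hU
  have h1 : Function.Bijective ((evalForm M).app U).flip := e.bijective
  have h2 : (evalForm M).app U = e.toLinearMap.dualMap ∘ₗ Module.Dual.eval Γ(X, U) Γ(M, U) := rfl
  refine ⟨?_, h1⟩
  have h3 : Function.Bijective e.toLinearMap.dualMap := e.dualMap.bijective
  rw [h2, LinearMap.coe_comp]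
  exact h3.comp (Module.bijective_dual_eval Γ(X, U) Γ(M, U))

theorem Form.res_app (c : Form M N) (h : V ≤ U) (x : Γ(M, U)) (y : Γ(N, U)) :
    fres h (c.app U x y) = c.app V (res M h x) (res N h y) := c.map_app (homOfLE h) x y

theorem Pairing.res_app (b : Pairing M N K) (h : V ≤ U) (x : Γ(M, U)) (y : Γ(N, U)) :
    res K h (b.app U x y) = b.app V (res M h x) (res N h y) := b.map_app (homOfLE h) x y

/-- The tensor product of a finite locally free module with a module. -/
def tensor (M N : X.Modules) : X.Modules := homSheaf (dual M) N

theorem IsVB.tensor (hM : IsVB M) (hN : IsVB N) : IsVB (tensor M N) := hM.dual.homSheaf hN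

/-- The universal bilinear map. -/
def tensorPairing (M N : X.Modules) : Pairing M N (tensor M N) where
  app U := LinearMap.mk₂ Γ(X, U)
    (fun x y => (homSheafEquiv (dual M) N U).symm
      { app := fun V h => ((evalForm M).app V (res M h x)).smulRight (res N h y)
        res_app := fun {V V'} h h' φ => by
          simp only [LinearMap.smulRight_apply, res_smul, res_res]
          rw [Form.res_app, res_res] })
    (fun x x' y => HomSec.ext (funext fun V => funext fun h => LinearMap.ext fun φ => by
      change (evalForm M).app V (res M h (x + x')) φ • res N h y = _
      rw [map_add, map_add, LinearMap.add_apply, add_smul]; rfl))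
    (fun a x y => HomSec.ext (funext fun V => funext fun h => LinearMap.ext fun φ => by
      change (evalForm M).app V (res M h (a • x)) φ • res N h y =
        fres h a • ((evalForm M).app V (res M h x) φ • res N h y)
      rw [res_smul, map_smul, LinearMap.smul_apply, smul_assoc]))
    (fun x y y' => HomSec.ext (funext fun V => funext fun h => LinearMap.ext fun φ => by
      change (evalForm M).app V (res M h x) φ • res N h (y + y') = _
      rw [map_add, smul_add]; rfl))
    (fun a x y => HomSec.ext (funext fun V => funext fun h => LinearMap.ext fun φ => by
      change (evalForm M).app V (res M h x) φ • res N h (a • y) =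
        fres h a • ((evalForm M).app V (res M h x) φ • res N h y)
      rw [res_smul, smul_comm]))
  map_app {U V} i x y := HomSec.ext (funext fun W => funext fun h => LinearMap.ext fun φ => by
    change (evalForm M).app W (res M (h.trans i.le) x) φ • res N (h.trans i.le) y =
      (evalForm M).app W (res M h (res M i.le x)) φ • res N h (res N i.le y)
    rw [res_res, res_res])

theorem tensorPairing_app (x : Γ(M, U)) (y : Γ(N, U)) (h : V ≤ U) (φ : Γ(dual M, V)) :
    (homSheafEquiv (dual M) N U ((tensorPairing M N).app U x y)).app V h φ =
      (evalForm M).app V (res M h x) φ • res N h y := rfl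

theorem _root_.IsTensorProduct.of_compr₂ {A : Type*} [CommRing A] {E F G G' : Type*}
    [AddCommGroup E] [AddCommGroup F] [AddCommGroup G] [AddCommGroup G'] [Module A E] [Module A F]
    [Module A G] [Module A G'] {b : E →ₗ[A] F →ₗ[A] G} (e : G ≃ₗ[A] G')
    (h : IsTensorProduct (b.compr₂ e.toLinearMap)) : IsTensorProduct b := by
  have : TensorProduct.lift (b.compr₂ e.toLinearMap) = e.toLinearMap ∘ₗ TensorProduct.lift b := by
    ext; simp
  rw [IsTensorProduct, this, LinearMap.coe_comp] at h
  exact (Function.Bijective.of_comp_iff' e.bijective _).mp h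

/-- This justifies `Hom(M^∨, N)` as a model of `M ⊗ N`. It is a sheaf by construction, and over
affine opens reflexivity of `M` gives the universal property. -/
theorem isTensorProduct_tensorPairing (hM : IsVB M) (N : X.Modules) (hU : IsAffineOpen U) :
    IsTensorProduct ((tensorPairing M N).app U) := by
  have := hM.dual.2 U hU
  have := hM.dual.3 U hU
  refine IsTensorProduct.of_compr₂ (homAffineEquiv hM.dual.1 N hU)
    (isTensorProduct_of_isPerfPair _ (isPerfPair_evalForm hM hU) _ fun e f d => ?_)
  refine (tensorPairing_app e f le_rfl d).trans ?_
  rw [res_self, res_self]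

/-- A bilinear form, as a morphism to the dual. -/
def formHom (c : Form M N) : N ⟶ dual M :=
  homOfSec
    { app := fun U _ => (homSheafEquiv M (structureSheaf X) U).symm.toLinearMap ∘ₗ
        { toFun := fun y : Γ(N, U) =>
            { app := fun V h => (c.app V).flip (res N h y)
              res_app := fun {V V'} h h' s => by
                refine (c.res_app h' s _).trans ?_
                rw [res_res]
                rfl }
          map_add' := fun y y' => HomSec.ext (funext fun V => funext fun h => by
            change (c.app V).flip (res N h (y + y')) = _
            rw [map_add, map_add]; rfl)
          map_smul' := fun a y => HomSec.ext (funext fun V => funext fun h => by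
            change (c.app V).flip (res N h (a • y)) = fres h a • (c.app V).flip (res N h y)
            rw [res_smul, map_smul]) }
      res_app := fun {U V} _ h y => HomSec.ext (funext fun W => funext fun h' => by
        change (c.app W).flip (res N (h'.trans h) y) = (c.app W).flip (res N h' (res N h y))
        rw [res_res]) }

theorem evalForm_formHom (c : Form M N) (x : Γ(M, U)) (y : Γ(N, U)) :
    (evalForm M).app U x ((formHom c).app U y) = c.app U x y := by
  change c.app U x (res N le_rfl y) = _
  rw [res_self]

end VectorBundles

/-! ### Exact sequences of modules and splittings. -/

section ExactModules

variable {A : Type*} [CommRing A] {M N K P : Type*} [AddCommGroup M] [AddCommGroup N]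
  [AddCommGroup K] [AddCommGroup P] [Module A M] [Module A N] [Module A K] [Module A P]
  {i : M →ₗ[A] N} {q : N →ₗ[A] K}

theorem exists_lift_of_exact (hi : Function.Injective i) (he : Function.Exact i q)
    (φ : P →ₗ[A] N) (h : ∀ x, q (φ x) = 0) : ∃ ψ : P →ₗ[A] M, ∀ x, i (ψ x) = φ x := by
  refine ⟨(LinearEquiv.ofInjective i hi).symm.toLinearMap ∘ₗ φ.codRestrict (LinearMap.range i)
    fun x => (he _).mp (h x), fun x => ?_⟩
  have := (LinearEquiv.ofInjective i hi).apply_symm_apply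
    (φ.codRestrict (LinearMap.range i) (fun x => (he _).mp (h x)) x)
  exact congrArg Subtype.val this

theorem exists_retract_of_exact [Module.Projective A K] (hi : Function.Injective i)
    (he : Function.Exact i q) (hq : Function.Surjective q) :
    ∃ (σ : K →ₗ[A] N) (ρ : N →ₗ[A] M), (∀ x, q (σ x) = x) ∧ ∀ x, i (ρ x) = x - σ (q x) := by
  obtain ⟨σ, hσ⟩ := Module.projective_lifting_property q LinearMap.id hq
  have hσ' (x) : q (σ x) = x := LinearMap.congr_fun hσ x
  obtain ⟨ρ, hρ⟩ := exists_lift_of_exact hi he (LinearMap.id - σ ∘ₗ q) fun x => by simp [hσ']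
  exact ⟨σ, ρ, hσ', hρ⟩

end ExactModules

/-- Additive maps are allowed because restriction of sections is only semilinear. -/
theorem _root_.IsTensorProduct.addHom_ext {A : Type*} [CommRing A] {E F G : Type*}
    [AddCommGroup E] [AddCommGroup F] [AddCommGroup G] [Module A E] [Module A F] [Module A G]
    {H : Type*} [AddCommGroup H] {b : E →ₗ[A] F →ₗ[A] G} (hb : IsTensorProduct b) {f g : G →+ H}
    (h : ∀ x y, f (b x y) = g (b x y)) (z : G) : f z = g z := by
  obtain ⟨t, rfl⟩ := hb.2 z
  induction t with
  | zero => simp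
  | add x y hx hy => simp only [map_add, hx, hy]
  | tmul x y => simpa using h x y

/-! ### Tensor products and exact sequences of vector bundles. -/

section TensorSheaves

variable {X : Scheme.{u}} {M N K M' N' K' : X.Modules} {U V W : X.Opens}

/-- Tensor products are functorial. -/
theorem exists_map_of_isTensorProduct (b : Pairing M N K)
    (hb : ∀ U, IsAffineOpen U → IsTensorProduct (b.app U)) (b' : Pairing M' N' K')
    (φ : M ⟶ M') (ψ : N ⟶ N') :
    ∃ θ : K ⟶ K', ∀ U x y, θ.app U (b.app U x y) = b'.app U (φ.app U x) (ψ.app U y) := by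
  have key (U) (hU : IsAffineOpen U) : ∃ α : Γ(K, U) →ₗ[Γ(X, U)] Γ(K', U), ∀ x y,
      α (b.app U x y) = b'.app U (φ.app U x) (ψ.app U y) :=
    ⟨(hb U hU).lift ((b'.app U).compl₁₂ (lapp φ U) (lapp ψ U)), fun x y =>
      (hb U hU).lift_eq _ x y⟩
  choose α hα using key
  obtain ⟨θ, hθ⟩ := exists_hom_of_affine α fun U V hU hV h s => by
    refine (hb U hU).addHom_ext (f := (res K' h).comp (α U hU).toAddMonoidHom)
      (g := (α V hV).toAddMonoidHom.comp (res K h)) (fun x y => ?_) s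
    change res K' h (α U hU _) = α V hV (res K h _)
    rw [hα, b.res_app, b'.res_app, hα, app_res, app_res]
  refine ⟨θ, fun U x y => eq_of_locally fun z hz => ?_⟩
  obtain ⟨V, hV, hzV, hVU⟩ := exists_affine_le hz
  refine ⟨V, hVU, hzV, ?_⟩
  rw [← app_res, b.res_app, b'.res_app, hθ V hV, hα, app_res, app_res]

theorem tensor_hom_ext (b : Pairing M N K)
    (hb : ∀ U, IsAffineOpen U → IsTensorProduct (b.app U)) {θ θ' : K ⟶ K'}
    (h : ∀ U, IsAffineOpen U → ∀ x y, θ.app U (b.app U x y) = θ'.app U (b.app U x y)) : θ = θ' :=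
  hom_ext_affine fun U hU s => (hb U hU).addHom_ext (f := (θ.app U).hom) (g := (θ'.app U).hom)
    (h U hU) s

/-- Tensor products are unique up to isomorphism. -/
theorem exists_iso_of_isTensorProduct (b : Pairing M N K)
    (hb : ∀ U, IsAffineOpen U → IsTensorProduct (b.app U)) (b' : Pairing M' N' K')
    (hb' : ∀ U, IsAffineOpen U → IsTensorProduct (b'.app U)) (e : M ≅ M') (f : N ≅ N') :
    Nonempty (K ≅ K') := by
  obtain ⟨θ, hθ⟩ := exists_map_of_isTensorProduct b hb b' e.hom f.hom
  obtain ⟨θ', hθ'⟩ := exists_map_of_isTensorProduct b' hb' b e.inv f.inv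
  refine ⟨⟨θ, θ', tensor_hom_ext b hb fun U _ x y => ?_, tensor_hom_ext b' hb' fun U _ x y => ?_⟩⟩
  · rw [comp_app_apply, hθ, hθ', id_app_apply, ← comp_app_apply, ← comp_app_apply, e.hom_inv_id,
      f.hom_inv_id, id_app_apply, id_app_apply]
  · rw [comp_app_apply, hθ', hθ, id_app_apply, ← comp_app_apply, ← comp_app_apply, e.inv_hom_id,
      f.inv_hom_id, id_app_apply, id_app_apply]

/-- The flipped bilinear map. -/
def Pairing.flip (b : Pairing M N K) : Pairing N M K where
  app U := (b.app U).flip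
  map_app h x y := b.map_app h y x

/-- Scalar multiplication as a bilinear map. -/
def smulPairing (M : X.Modules) : Pairing (structureSheaf X) M M where
  app U := LinearMap.lsmul Γ(X, U) Γ(M, U)
  map_app h _ _ := M.map_smul h _ _

theorem isTensorProduct_smulPairing (M : X.Modules) (U : X.Opens) :
    IsTensorProduct ((smulPairing M).app U) := isTensorProduct_smul

theorem tensor_congr (hM : IsVB M) (hM' : IsVB M') (e : M ≅ M') (f : N ≅ N') :
    Nonempty (tensor M N ≅ tensor M' N') :=
  exists_iso_of_isTensorProduct _ (fun _ hU => isTensorProduct_tensorPairing hM N hU) _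
    (fun _ hU => isTensorProduct_tensorPairing hM' N' hU) e f

theorem tensor_comm (hM : IsVB M) (hN : IsVB N) : Nonempty (tensor M N ≅ tensor N M) :=
  exists_iso_of_isTensorProduct _ (fun _ hU => isTensorProduct_tensorPairing hM N hU)
    (tensorPairing N M).flip (fun _ hU => (isTensorProduct_tensorPairing hN M hU).flip)
    (Iso.refl _) (Iso.refl _)

theorem tensor_one (M : X.Modules) : Nonempty (tensor (structureSheaf X) M ≅ M) :=
  exists_iso_of_isTensorProduct _
    (fun _ hU => isTensorProduct_tensorPairing (isVB_structureSheaf X) M hU)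
    (smulPairing M) (fun U _ => isTensorProduct_smulPairing M U) (Iso.refl _) (Iso.refl _)

theorem _root_.IsTensorProduct.exists_assoc {A : Type*} [CommRing A] {E F G P Q R S : Type*}
    [AddCommGroup E] [AddCommGroup F] [AddCommGroup G] [AddCommGroup P] [AddCommGroup Q]
    [AddCommGroup R] [AddCommGroup S] [Module A E] [Module A F] [Module A G] [Module A P]
    [Module A Q] [Module A R] [Module A S] {b₁ : E →ₗ[A] F →ₗ[A] P} {b₂ : P →ₗ[A] G →ₗ[A] R}
    {b₃ : F →ₗ[A] G →ₗ[A] Q} {b₄ : E →ₗ[A] Q →ₗ[A] S} (h₁ : IsTensorProduct b₁)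
    (h₂ : IsTensorProduct b₂) (h₃ : IsTensorProduct b₃) (h₄ : IsTensorProduct b₄) :
    ∃ e : R ≃ₗ[A] S, ∀ x y z, e (b₂ (b₁ x y) z) = b₄ x (b₃ y z) := by
  let e : R ≃ₗ[A] S := (h₂.equiv.symm.trans
    ((h₁.equiv.symm.rTensor G).trans ((TensorProduct.assoc A E F G).trans
      (h₃.equiv.lTensor E)))).trans h₄.equiv
  refine ⟨e, fun x y z => ?_⟩
  simp [e]

/-- The associativity isomorphisms over affine opens are determined on pure tensors, where
compatibility with restriction is visible; hence they glue. -/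
theorem tensor_assoc (hM : IsVB M) (hN : IsVB N) :
    Nonempty (tensor (tensor M N) K ≅ tensor M (tensor N K)) := by
  have key := fun (U : X.Opens) (hU : IsAffineOpen U) => IsTensorProduct.exists_assoc
    (isTensorProduct_tensorPairing hM N hU) (isTensorProduct_tensorPairing (hM.tensor hN) K hU)
    (isTensorProduct_tensorPairing hN K hU) (isTensorProduct_tensorPairing hM (tensor N K) hU)
  choose α hα using key
  obtain ⟨e, -⟩ := exists_iso_of_affine α fun U V hU hV h s => by
    refine (isTensorProduct_tensorPairing (hM.tensor hN) K hU).addHom_ext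
      (f := (res _ h).comp (α U hU).toLinearMap.toAddMonoidHom)
      (g := (α V hV).toLinearMap.toAddMonoidHom.comp (res _ h)) (fun x z => ?_) s
    refine (isTensorProduct_tensorPairing hM N hU).addHom_ext
      (f := ((res _ h).comp (α U hU).toLinearMap.toAddMonoidHom).comp
        (((tensorPairing (tensor M N) K).app U).flip z).toAddMonoidHom)
      (g := ((α V hV).toLinearMap.toAddMonoidHom.comp (res _ h)).comp
        (((tensorPairing (tensor M N) K).app U).flip z).toAddMonoidHom) (fun x y => ?_) x
    change res _ h (α U hU ((tensorPairing (tensor M N) K).app U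
      ((tensorPairing M N).app U x y) z)) = α V hV (res _ h ((tensorPairing (tensor M N) K).app U
      ((tensorPairing M N).app U x y) z))
    rw [hα, Pairing.res_app, Pairing.res_app, Pairing.res_app, Pairing.res_app, hα]
  exact ⟨e⟩

/-- Exactness of `0 → M → N → K → 0`, for quasi-coherent modules. -/
structure IsExactSeq (i : M ⟶ N) (q : N ⟶ K) : Prop where
  injective : ∀ U : X.Opens, IsAffineOpen U → Function.Injective (i.app U)
  exact : ∀ U : X.Opens, IsAffineOpen U → Function.Exact (i.app U) (q.app U)
  surjective : ∀ U : X.Opens, IsAffineOpen U → Function.Surjective (q.app U)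

/-- Over an affine open this is exactness of `Hom` out of a projective module. As `tensor` is a
sheaf of homomorphisms out of a dual, it also shows that tensoring with a vector bundle is exact. -/
theorem IsExactSeq.homSheafMap {P : X.Modules} (hP : IsVB P) {i : M ⟶ N} {q : N ⟶ K}
    (h : IsExactSeq i q) : IsExactSeq (homSheafMap P i) (homSheafMap P q) := by
  have hf {M N : X.Modules} (φ : M ⟶ N) (U) (hU : IsAffineOpen U) (ψ s) :
    homAffineEquiv hP.1 N hU ((TorusGW.homSheafMap P φ).app U ψ) s =
      φ.app U (homAffineEquiv hP.1 M hU ψ s) := rfl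
  refine ⟨fun U hU ψ ψ' hψ => ?_, fun U hU ψ => ⟨fun hψ => ?_, ?_⟩, fun U hU ψ => ?_⟩
  · refine (homAffineEquiv hP.1 M hU).injective (LinearMap.ext fun s => h.1 U hU ?_)
    rw [← hf, ← hf, hψ]
  · obtain ⟨θ, hθ⟩ := exists_lift_of_exact (i := lapp i U) (q := lapp q U) (h.1 U hU) (h.2 U hU)
      (homAffineEquiv hP.1 N hU ψ) (fun s => (hf q U hU ψ s).symm.trans (by
        rw [hψ, map_zero, LinearMap.zero_apply]))
    refine ⟨(homAffineEquiv hP.1 M hU).symm θ, (homAffineEquiv hP.1 N hU).injective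
      (LinearMap.ext fun s => ?_)⟩
    rw [hf, LinearEquiv.apply_symm_apply]
    exact hθ s
  · rintro ⟨θ, rfl⟩
    refine (homAffineEquiv hP.1 K hU).injective (LinearMap.ext fun s => ?_)
    rw [hf, hf, map_zero, LinearMap.zero_apply]
    exact (h.2 U hU _).mpr ⟨_, rfl⟩
  · have := hP.3 U hU
    obtain ⟨θ, hθ⟩ := Module.projective_lifting_property (lapp q U) (homAffineEquiv hP.1 K hU ψ)
      (h.3 U hU)
    refine ⟨(homAffineEquiv hP.1 N hU).symm θ, (homAffineEquiv hP.1 K hU).injective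
      (LinearMap.ext fun s => ?_)⟩
    rw [hf, LinearEquiv.apply_symm_apply]
    exact LinearMap.congr_fun hθ s

/-- Over an affine open the sequence splits because `K` is projective there, and splittings survive
dualization. -/
theorem IsExactSeq.dual {i : M ⟶ N} {q : N ⟶ K} (h : IsExactSeq i q) (hM : IsVB M) (hN : IsVB N)
    (hK : IsVB K) : IsExactSeq (homSheafComap q (structureSheaf X))
      (homSheafComap i (structureSheaf X)) := by
  have hf {M N : X.Modules} (hM : IsVB M) (hN : IsVB N) (φ : M ⟶ N) (U) (hU : IsAffineOpen U)
      (ψ s) : homAffineEquiv hM.1 _ hU ((homSheafComap φ (structureSheaf X)).app U ψ) s =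
      homAffineEquiv hN.1 _ hU ψ (φ.app U s) := rfl
  refine ⟨fun U hU ψ ψ' hψ => ?_, fun U hU ψ => ⟨fun hψ => ?_, ?_⟩, fun U hU ψ => ?_⟩
  · refine (homAffineEquiv hK.1 _ hU).injective (LinearMap.ext fun s => ?_)
    obtain ⟨s, rfl⟩ := h.3 U hU s
    rw [← hf hN hK, ← hf hN hK, hψ]
  · have := hK.3 U hU
    obtain ⟨σ, ρ, hσ, hρ⟩ := exists_retract_of_exact (i := lapp i U) (q := lapp q U) (h.1 U hU)
      (h.2 U hU) (h.3 U hU)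
    refine ⟨(homAffineEquiv hK.1 _ hU).symm (homAffineEquiv hN.1 _ hU ψ ∘ₗ σ),
      (homAffineEquiv hN.1 _ hU).injective (LinearMap.ext fun s => ?_)⟩
    rw [hf hN hK, LinearEquiv.apply_symm_apply, LinearMap.comp_apply]
    have h1 := hf hM hN i U hU ψ (ρ s)
    have h2 := hρ s
    rw [lapp_apply] at h2
    rw [hψ, map_zero, LinearMap.zero_apply, h2, map_sub] at h1
    exact (sub_eq_zero.mp h1.symm).symm
  · rintro ⟨θ, rfl⟩
    refine (homAffineEquiv hM.1 _ hU).injective (LinearMap.ext fun s => ?_)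
    rw [hf hM hN, hf hN hK, map_zero, LinearMap.zero_apply, (h.2 U hU _).mpr ⟨s, rfl⟩, map_zero]
  · have := hK.3 U hU
    obtain ⟨σ, ρ, hσ, hρ⟩ := exists_retract_of_exact (i := lapp i U) (q := lapp q U) (h.1 U hU)
      (h.2 U hU) (h.3 U hU)
    refine ⟨(homAffineEquiv hN.1 _ hU).symm (homAffineEquiv hM.1 _ hU ψ ∘ₗ ρ),
      (homAffineEquiv hM.1 _ hU).injective (LinearMap.ext fun s => ?_)⟩
    rw [hf hM hN, LinearEquiv.apply_symm_apply, LinearMap.comp_apply]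
    congr 1
    refine h.1 U hU ?_
    have h2 := hρ (i.app U s)
    rw [lapp_apply, lapp_apply, (h.2 U hU _).mpr ⟨s, rfl⟩, map_zero, sub_zero] at h2
    exact h2

/-- A perfect form identifies the second module with the dual of the first. -/
theorem exists_iso_of_isPerfPair (hM : IsVB M) (c : Form M N) (c' : Form M N')
    (hc : ∀ U, IsAffineOpen U → (c.app U).IsPerfPair)
    (hc' : ∀ U, IsAffineOpen U → (c'.app U).IsPerfPair) :
    ∃ e : N ≅ N', ∀ U x y, c'.app U x (e.hom.app U y) = c.app U x y := by
  have key {N : X.Modules} (c : Form M N) (hc : ∀ U, IsAffineOpen U → (c.app U).IsPerfPair) :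
      ∃ e : N ≅ dual M, e.hom = formHom c := by
    refine exists_iso_of_bijective _ fun U hU => ?_
    have h1 := (isPerfPair_evalForm hM hU).bijective_right
    have h2 := (hc U hU).bijective_right
    have h3 : ((evalForm M).app U).flip ∘ (formHom c).app U = (c.app U).flip := by
      ext y x
      exact evalForm_formHom c x y
    rw [← h3] at h2
    exact (Function.Bijective.of_comp_iff' h1 _).mp h2
  obtain ⟨e, he⟩ := key c hc
  obtain ⟨e', he'⟩ := key c' hc'
  refine ⟨e ≪≫ e'.symm, fun U x y => ?_⟩
  rw [← evalForm_formHom c', ← evalForm_formHom c, ← he', ← he, ← comp_app_apply]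
  simp

end TensorSheaves

/-! ### Bundles in a single weight and the decomposition into weight parts. -/

section PlacedBundles

variable {X : Scheme.{u}} {Λ Λ' : Type} [AddCommGroup Λ] [AddCommGroup Λ']
  {M N K M' N' K' : X.Modules} {U V : X.Opens}

/-- The vector bundle `M`, placed in weight `w`. -/
def place (w : Λ) (M : X.Modules) (hM : IsVB M) : Bundle X Λ where
  mod := M
  quasicoherent := hM.1
  finite := hM.2
  projective := hM.3
  proj := Finsupp.single w (𝟙 _)
  proj_idem v := by
    classical
    by_cases h : w = v <;> simp [h]
  proj_orth v v' h := by
    classical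
    by_cases h1 : w = v <;> by_cases h2 : w = v' <;> simp_all
  proj_sum := by simp

theorem place_proj_self (w : Λ) (hM : IsVB M) : (place w M hM).proj w = 𝟙 M :=
  Finsupp.single_eq_same

theorem place_proj_of_ne {v w : Λ} (h : v ≠ w) (hM : IsVB M) : (place w M hM).proj v = 0 :=
  Finsupp.single_eq_of_ne h

theorem hasWeight_place {v w : Λ} {hM : IsVB M} {s : Γ(M, U)} :
    (place w M hM).HasWeight v s ↔ v = w ∨ s = 0 := by
  by_cases h : v = w
  · subst h
    have : ((place v M hM).proj v).app U s = s := by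
      rw [place_proj_self]
      exact id_app_apply s
    exact ⟨fun _ => Or.inl rfl, fun _ => this⟩
  · have : ((place w M hM).proj v).app U s = 0 := by
      rw [place_proj_of_ne h]
      exact zero_app_apply s
    refine ⟨fun hs => Or.inr (hs.symm.trans this), fun hs => ?_⟩
    rcases hs with hs | hs
    · exact absurd hs h
    · exact this.trans hs.symm

theorem isEquivariant_place (w : Λ) (hM : IsVB M) (hN : IsVB N) (φ : M ⟶ N) :
    IsEquivariant (place w M hM) (place w N hN) φ := by
  intro v
  by_cases h : v = w
  · subst h
    rw [place_proj_self, place_proj_self]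
    exact (Category.id_comp φ).trans (Category.comp_id φ).symm
  · rw [place_proj_of_ne h, place_proj_of_ne h]
    exact Limits.zero_comp.trans Limits.comp_zero.symm

theorem isEquivariant_place_left {w : Λ} {hM : IsVB M} {E : Bundle X Λ} {φ : M ⟶ E.mod}
    (h : φ ≫ E.proj w = φ) : IsEquivariant (place w M hM) E φ := by
  intro v
  by_cases hv : v = w
  · subst hv
    rw [place_proj_self]
    exact (Category.id_comp φ).trans h.symm
  · rw [place_proj_of_ne hv]
    have h1 : (φ ≫ E.proj w) ≫ E.proj v = 0 := by
      rw [Category.assoc, E.proj_orth w v (Ne.symm hv), Limits.comp_zero]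
    rw [h] at h1
    exact Limits.zero_comp.trans h1.symm

theorem isEquivariant_place_right {w : Λ} {hM : IsVB M} {E : Bundle X Λ} {φ : E.mod ⟶ M}
    (h : E.proj w ≫ φ = φ) : IsEquivariant E (place w M hM) φ := by
  intro v
  by_cases hv : v = w
  · subst hv
    rw [place_proj_self]
    exact h.trans (Category.comp_id φ).symm
  · rw [place_proj_of_ne hv]
    have h1 : E.proj v ≫ E.proj w ≫ φ = 0 := by
      rw [← Category.assoc, E.proj_orth v w hv, Limits.zero_comp]
    rw [h] at h1
    exact h1.trans Limits.comp_zero.symm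

theorem Bundle.proj_unit (E : Bundle X Unit) : E.proj () = 𝟙 E.mod := by
  have := E.proj_sum
  rwa [Finsupp.unique_single E.proj, Finsupp.sum_single_index rfl] at this

theorem Bundle.eq_place (E : Bundle X Unit) : E = place () E.mod E.isVB := by
  refine Bundle.eq_of rfl (heq_of_eq ?_)
  refine (Finsupp.unique_single E.proj).trans ?_
  exact congrArg (Finsupp.single ()) E.proj_unit

theorem push_place (f : Λ →+ Λ') (w : Λ) (hM : IsVB M) :
    (place w M hM).push f = place (f w) M hM :=
  Bundle.eq_of rfl (heq_of_eq Finsupp.mapDomain_single)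

theorem lineBundle_eq_place (w : Λ) :
    lineBundle X w = place w (structureSheaf X) (isVB_structureSheaf X) := rfl

theorem K0.cls_of_isDirectSum {E F G : Bundle X Λ} {i : E.mod ⟶ G.mod} {j : F.mod ⟶ G.mod}
    (h : IsDirectSum E F G i j) : K0.cls G = K0.cls E + K0.cls F := by
  obtain ⟨s, hs⟩ := h.isShortExact
  exact K0.cls_exact hs

theorem isEquivariant_zero (E F : Bundle X Λ) : IsEquivariant E F 0 := fun w => by simp

theorem IsEquivariant.comp {E F G : Bundle X Λ} {φ : E.mod ⟶ F.mod} {ψ : F.mod ⟶ G.mod}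
    (h : IsEquivariant E F φ) (h' : IsEquivariant F G ψ) : IsEquivariant E G (φ ≫ ψ) := fun w => by
  rw [← Category.assoc, h w, Category.assoc, h' w, Category.assoc]

/-- A zero bundle is the direct sum of two copies of itself. -/
theorem K0.cls_eq_zero {E : Bundle X Λ} (h : 𝟙 E.mod = 0) : K0.cls E = 0 := by
  have : IsDirectSum E E E 0 0 :=
    ⟨isEquivariant_zero _ _, isEquivariant_zero _ _, 0, 0, isEquivariant_zero _ _,
      isEquivariant_zero _ _, by simp [h], by simp [h], by simp, by simp, by simp [h]⟩
  simpa using K0.cls_of_isDirectSum this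

/-- The image of an idempotent. -/
def splitObj (p : M ⟶ M) (hp : p ≫ p = p) : X.Modules :=
  (IsIdempotentComplete.idempotents_split M p hp).choose

/-- The inclusion of the image of an idempotent. -/
def splitι (p : M ⟶ M) (hp : p ≫ p = p) : splitObj p hp ⟶ M :=
  (IsIdempotentComplete.idempotents_split M p hp).choose_spec.choose

/-- The projection to the image of an idempotent. -/
def splitπ (p : M ⟶ M) (hp : p ≫ p = p) : M ⟶ splitObj p hp :=
  (IsIdempotentComplete.idempotents_split M p hp).choose_spec.choose_spec.choose

theorem splitι_π (p : M ⟶ M) (hp : p ≫ p = p) : splitι p hp ≫ splitπ p hp = 𝟙 _ :=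
  (IsIdempotentComplete.idempotents_split M p hp).choose_spec.choose_spec.choose_spec.1

theorem splitπ_ι (p : M ⟶ M) (hp : p ≫ p = p) : splitπ p hp ≫ splitι p hp = p :=
  (IsIdempotentComplete.idempotents_split M p hp).choose_spec.choose_spec.choose_spec.2

theorem splitι_comp (p : M ⟶ M) (hp : p ≫ p = p) : splitι p hp ≫ p = splitι p hp := by
  refine (congrArg (splitι p hp ≫ ·) (splitπ_ι p hp)).symm.trans ?_
  rw [← Category.assoc, splitι_π, Category.id_comp]

theorem comp_splitπ (p : M ⟶ M) (hp : p ≫ p = p) : p ≫ splitπ p hp = splitπ p hp := by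
  refine (congrArg (· ≫ splitπ p hp) (splitπ_ι p hp)).symm.trans ?_
  rw [Category.assoc, splitι_π, Category.comp_id]

theorem splitπ_ι_apply (p : M ⟶ M) (hp : p ≫ p = p) (s : Γ(M, U)) :
    (splitι p hp).app U ((splitπ p hp).app U s) = p.app U s := by
  rw [← comp_app_apply, splitπ_ι]

theorem splitι_π_apply (p : M ⟶ M) (hp : p ≫ p = p) (s : Γ(splitObj p hp, U)) :
    (splitπ p hp).app U ((splitι p hp).app U s) = s := by
  rw [← comp_app_apply, splitι_π, id_app_apply]

theorem IsVB.split (hM : IsVB M) (p : M ⟶ M) (hp : p ≫ p = p) : IsVB (splitObj p hp) :=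
  hM.of_retract _ _ (splitι_π p hp)

theorem splitObj_zero (h : (0 : M ⟶ M) ≫ 0 = 0) : 𝟙 (splitObj (0 : M ⟶ M) h) = 0 := by
  have := splitι_comp (0 : M ⟶ M) h
  rw [← splitι_π, ← this, Limits.comp_zero, Limits.zero_comp]

/-- Isomorphism is not among the defining relations; it is recovered by viewing `F` as the sum of
`E` and a zero bundle, the image of the zero idempotent. -/
theorem K0.cls_eq_of_iso {E F : Bundle X Λ} (e : E.mod ≅ F.mod) (h : IsEquivariant E F e.hom) :
    K0.cls E = K0.cls F := by
  have h' : IsEquivariant F E e.inv := fun w => by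
    rw [Iso.comp_inv_eq, Category.assoc, h w, Iso.inv_hom_id_assoc]
  have hz : (0 : E.mod ⟶ E.mod) ≫ (0 : E.mod ⟶ E.mod) = 0 := by simp
  have h0 := splitObj_zero hz
  have : IsDirectSum E (place 0 _ (E.isVB.split 0 hz)) F e.hom 0 :=
    ⟨h, isEquivariant_zero _ _, e.inv, 0, h', isEquivariant_zero _ _, e.hom_inv_id,
      Limits.zero_comp.trans h0.symm, Limits.comp_zero, Limits.zero_comp, by
        rw [Limits.comp_zero, add_zero, e.inv_hom_id]⟩
  rw [K0.cls_of_isDirectSum this, K0.cls_eq_zero (E := place 0 _ (E.isVB.split 0 hz)) h0, add_zero]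

/-- A direct summand of an equivariant vector bundle. -/
def Bundle.retract (E : Bundle X Λ) (ι : M ⟶ E.mod) (π : E.mod ⟶ M) (h : ι ≫ π = 𝟙 M)
    (hc : ∀ w, E.proj w ≫ π ≫ ι = π ≫ ι ≫ E.proj w) : Bundle X Λ where
  mod := M
  quasicoherent := (E.isVB.of_retract ι π h).1
  finite := (E.isVB.of_retract ι π h).2
  projective := (E.isVB.of_retract ι π h).3
  proj := E.proj.mapRange (fun p => ι ≫ p ≫ π) (by simp)
  proj_idem w := by
    have h1 : E.proj w ≫ π = π ≫ ι ≫ E.proj w ≫ π := by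
      have := congrArg (· ≫ π) (hc w)
      simpa only [Category.assoc, h, Category.comp_id] using this
    simp only [Finsupp.mapRange_apply, Category.assoc]
    rw [← h1, ← Category.assoc (E.proj w), E.proj_idem]
  proj_orth v w hvw := by
    have h1 : E.proj w ≫ π = π ≫ ι ≫ E.proj w ≫ π := by
      have := congrArg (· ≫ π) (hc w)
      simpa only [Category.assoc, h, Category.comp_id] using this
    simp only [Finsupp.mapRange_apply, Category.assoc]
    rw [← h1, ← Category.assoc (E.proj v), E.proj_orth v w hvw, Limits.zero_comp,
      Limits.comp_zero]
  proj_sum := by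
    rw [Finsupp.sum_mapRange_index (fun _ => rfl), Finsupp.sum, ← Preadditive.comp_sum,
      ← Preadditive.sum_comp, ← h]
    congr 1
    exact (congrArg (· ≫ π) E.proj_sum).trans (Category.id_comp π)

theorem Bundle.retract_proj (E : Bundle X Λ) (ι : M ⟶ E.mod) (π : E.mod ⟶ M) (h : ι ≫ π = 𝟙 M)
    (hc : ∀ w, E.proj w ≫ π ≫ ι = π ≫ ι ≫ E.proj w) (w : Λ) :
    (E.retract ι π h hc).proj w = ι ≫ E.proj w ≫ π :=
  Finsupp.mapRange_apply (hf := by rw [Limits.zero_comp, Limits.comp_zero]; rfl)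

theorem Bundle.retract_equivariant_ι (E : Bundle X Λ) (ι : M ⟶ E.mod) (π : E.mod ⟶ M)
    (h : ι ≫ π = 𝟙 M) (hc : ∀ w, E.proj w ≫ π ≫ ι = π ≫ ι ≫ E.proj w) :
    IsEquivariant (E.retract ι π h hc) E ι := by
  intro w
  rw [E.retract_proj]
  have : (ι ≫ E.proj w ≫ π) ≫ ι = ι ≫ E.proj w := by
    rw [Category.assoc, Category.assoc, hc w, ← Category.assoc ι π, h, Category.id_comp]
  exact this

theorem Bundle.retract_equivariant_π (E : Bundle X Λ) (ι : M ⟶ E.mod) (π : E.mod ⟶ M)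
    (h : ι ≫ π = 𝟙 M) (hc : ∀ w, E.proj w ≫ π ≫ ι = π ≫ ι ≫ E.proj w) :
    IsEquivariant E (E.retract ι π h hc) π := by
  intro w
  rw [E.retract_proj]
  have := congrArg (· ≫ π) (hc w)
  simp only [Category.assoc, h, Category.comp_id] at this
  exact this

/-- The class of a finite direct sum. -/
theorem K0.cls_eq_sum {I : Type*} (S : Finset I) (E : Bundle X Λ) (F : I → Bundle X Λ)
    (a : ∀ i, (F i).mod ⟶ E.mod) (b : ∀ i, E.mod ⟶ (F i).mod)
    (ha : ∀ i, IsEquivariant (F i) E (a i)) (hb : ∀ i, IsEquivariant E (F i) (b i))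
    (hab : ∀ i ∈ S, a i ≫ b i = 𝟙 _) (hab' : ∀ i ∈ S, ∀ j ∈ S, i ≠ j → a i ≫ b j = 0)
    (hsum : ∑ i ∈ S, b i ≫ a i = 𝟙 E.mod) : K0.cls E = ∑ i ∈ S, K0.cls (F i) := by
  classical
  induction S using Finset.induction_on generalizing E with
  | empty => rw [Finset.sum_empty] at hsum ⊢; exact K0.cls_eq_zero hsum.symm
  | insert k S hk ih =>
    have hk1 : a k ≫ b k = 𝟙 _ := hab k (Finset.mem_insert_self k S)
    have hk2 (T : X.Modules) (f : (F k).mod ⟶ T) : a k ≫ b k ≫ f = f := by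
      rw [← Category.assoc, hk1, Category.id_comp]
    -- The image of `q` is the complement of the `k`-th summand; it is the direct sum of the
    -- remaining ones, to which the induction applies.
    let q : E.mod ⟶ E.mod := 𝟙 _ - b k ≫ a k
    have hq : q ≫ q = q := by simp [q, hk2]
    have hqe (w) : E.proj w ≫ q = q ≫ E.proj w := by
      have h1 := hb k w
      have h2 := ha k w
      simp only [q, Preadditive.comp_sub, Preadditive.sub_comp, Category.comp_id, Category.id_comp,
        Category.assoc]
      rw [← h2, ← Category.assoc, h1, Category.assoc]
    let E' : Bundle X Λ := E.retract (splitι q hq) (splitπ q hq) (splitι_π q hq) fun w => by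
      rw [splitπ_ι, ← Category.assoc (splitπ q hq), splitπ_ι, hqe]
    have hι : IsEquivariant E' E (splitι q hq) := E.retract_equivariant_ι _ _ _ _
    have hπ : IsEquivariant E E' (splitπ q hq) := E.retract_equivariant_π _ _ _ _
    have h1 : a k ≫ splitπ q hq = 0 := by
      rw [← comp_splitπ, ← Category.assoc]
      simp [q, hk2]
    have h2 : splitι q hq ≫ b k = 0 := by
      rw [← splitι_comp, Category.assoc]
      simp [q, hk1]
    have h3 : IsDirectSum (F k) E' E (a k) (splitι q hq) :=
      ⟨ha k, hι, b k, splitπ q hq, hb k, hπ, hk1, splitι_π q hq, h1, h2, by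
        refine (congrArg (b k ≫ a k + ·) (splitπ_ι q hq)).trans ?_
        simp [q]⟩
    rw [K0.cls_of_isDirectSum h3, Finset.sum_insert hk]
    congr 1
    have key (i j) (hi : i ∈ S) : (a i ≫ splitπ q hq) ≫ splitι q hq ≫ b j = a i ≫ b j := by
      have h4 := hab' i (Finset.mem_insert_of_mem hi) k (Finset.mem_insert_self k S)
        (fun h => hk (h ▸ hi))
      rw [Category.assoc, ← Category.assoc (splitπ q hq), splitπ_ι]
      simp only [q, Preadditive.comp_sub, Preadditive.sub_comp, Category.id_comp, Category.assoc]
      rw [← Category.assoc (a i) (b k), h4, Limits.zero_comp, sub_zero]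
    refine ih E' (fun i => a i ≫ splitπ q hq) (fun i => splitι q hq ≫ b i)
      (fun i => (ha i).comp hπ) (fun i => hι.comp (hb i))
      (fun i hi => (key i i hi).trans (hab i (Finset.mem_insert_of_mem hi)))
      (fun i hi j hj hij => (key i j hi).trans
        (hab' i (Finset.mem_insert_of_mem hi) j (Finset.mem_insert_of_mem hj) hij)) ?_
    rw [Finset.sum_insert hk] at hsum
    have h5 : ∑ i ∈ S, b i ≫ a i = q := eq_sub_of_add_eq' hsum
    calc ∑ i ∈ S, (splitι q hq ≫ b i) ≫ a i ≫ splitπ q hq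
        = splitι q hq ≫ (∑ i ∈ S, b i ≫ a i) ≫ splitπ q hq := by
          rw [Preadditive.sum_comp, Preadditive.comp_sum]
          simp only [Category.assoc]
      _ = 𝟙 _ := by rw [h5, comp_splitπ, splitι_π]

/-- The image of a sum of orthogonal idempotents. -/
theorem K0.cls_split_sum {I : Type*} (w : Λ) (hM : IsVB M) (S : Finset I) (p : I → (M ⟶ M))
    (hp : ∀ i, p i ≫ p i = p i) (horth : ∀ i ∈ S, ∀ j ∈ S, i ≠ j → p i ≫ p j = 0)
    (q : M ⟶ M) (hq : q ≫ q = q) (hsum : ∑ i ∈ S, p i = q) :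
    K0.cls (place w (splitObj q hq) (hM.split q hq)) =
      ∑ i ∈ S, K0.cls (place w (splitObj (p i) (hp i)) (hM.split _ (hp i))) := by
  classical
  have h1 (i) (hi : i ∈ S) : p i ≫ q = p i := by
    rw [← hsum, Preadditive.comp_sum, Finset.sum_eq_single i, hp]
    · exact fun j hj hij => horth i hi j hj (Ne.symm hij)
    · exact fun h => absurd hi h
  have key (i j) (hi : i ∈ S) : (splitι (p i) (hp i) ≫ splitπ q hq) ≫
      splitι q hq ≫ splitπ (p j) (hp j) = splitι (p i) (hp i) ≫ splitπ (p j) (hp j) := by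
    rw [Category.assoc, ← Category.assoc (splitπ q hq), splitπ_ι, ← splitι_comp (p i) (hp i),
      Category.assoc, ← Category.assoc (p i) q, h1 i hi, Category.assoc]
  refine K0.cls_eq_sum S _ _ (fun i => splitι (p i) (hp i) ≫ splitπ q hq)
    (fun i => splitι q hq ≫ splitπ (p i) (hp i)) (fun i => isEquivariant_place _ _ _ _)
    (fun i => isEquivariant_place _ _ _ _) (fun i hi => (key i i hi).trans (splitι_π _ _))
    (fun i hi j hj hij => (key i j hi).trans ?_) ?_
  · rw [← splitι_comp (p i) (hp i), ← comp_splitπ (p j) (hp j), Category.assoc,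
      ← Category.assoc (p i), horth i hi j hj hij, Limits.zero_comp, Limits.comp_zero]
    rfl
  · calc ∑ i ∈ S, (splitι q hq ≫ splitπ (p i) (hp i)) ≫ splitι (p i) (hp i) ≫ splitπ q hq
        = ∑ i ∈ S, splitι q hq ≫ p i ≫ splitπ q hq := Finset.sum_congr rfl fun i _ => by
          rw [Category.assoc, ← Category.assoc (splitπ (p i) (hp i)), splitπ_ι]
      _ = 𝟙 _ := by
        rw [← Preadditive.comp_sum, ← Preadditive.sum_comp, hsum, comp_splitπ, splitι_π]

/-- The part of weight `w`, as a vector bundle. -/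
def Bundle.part (E : Bundle X Λ) (w : Λ) : X.Modules := splitObj (E.proj w) (E.proj_idem w)

theorem Bundle.isVB_part (E : Bundle X Λ) (w : Λ) : IsVB (E.part w) := E.isVB.split _ _

theorem Bundle.sum_proj (E : Bundle X Λ) {S : Finset Λ} (hS : E.proj.support ⊆ S) :
    ∑ w ∈ S, E.proj w = 𝟙 E.mod := by
  rw [← E.proj_sum]
  exact (Finsupp.sum_of_support_subset _ hS (fun _ p => p) fun _ _ => rfl).symm

theorem K0.cls_eq_sum_part (E : Bundle X Λ) {S : Finset Λ} (hS : E.proj.support ⊆ S) :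
    K0.cls E = ∑ w ∈ S, K0.cls (place w (E.part w) (E.isVB_part w)) := by
  refine K0.cls_eq_sum S E _ (fun w => splitι (E.proj w) (E.proj_idem w))
    (fun w => splitπ (E.proj w) (E.proj_idem w))
    (fun w => isEquivariant_place_left (splitι_comp _ _))
    (fun w => isEquivariant_place_right (comp_splitπ _ _)) (fun w _ => splitι_π _ _)
    (fun v _ w _ h => ?_) ?_
  · have : splitι (E.proj v) (E.proj_idem v) ≫ splitπ (E.proj w) (E.proj_idem w) = 0 := by
      rw [← splitι_comp, ← comp_splitπ, Category.assoc, ← Category.assoc (E.proj v),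
        E.proj_orth v w h, Limits.zero_comp, Limits.comp_zero]
    exact this
  · exact (Finset.sum_congr rfl fun w _ => splitπ_ι _ _).trans (E.sum_proj hS)

/-- Exact sequences induce exact sequences of images of idempotents. -/
theorem IsExactSeq.split {i : M ⟶ N} {q : N ⟶ K} (h : IsExactSeq i q) {p₁ : M ⟶ M} {p₂ : N ⟶ N}
    {p₃ : K ⟶ K} (h₁ : p₁ ≫ p₁ = p₁) (h₂ : p₂ ≫ p₂ = p₂) (h₃ : p₃ ≫ p₃ = p₃)
    (hi : p₁ ≫ i = i ≫ p₂) (hq : p₂ ≫ q = q ≫ p₃) :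
    IsExactSeq (splitι p₁ h₁ ≫ i ≫ splitπ p₂ h₂) (splitι p₂ h₂ ≫ q ≫ splitπ p₃ h₃) := by
  have a {M N : X.Modules} {i : M ⟶ N} {p₁ : M ⟶ M} {p₂ : N ⟶ N} (h₁ : p₁ ≫ p₁ = p₁)
      (h₂ : p₂ ≫ p₂ = p₂) (hi : p₁ ≫ i = i ≫ p₂) (U : X.Opens) (s) : (splitι p₂ h₂).app U
        ((splitι p₁ h₁ ≫ i ≫ splitπ p₂ h₂).app U s) = i.app U ((splitι p₁ h₁).app U s) := by
    rw [← comp_app_apply, ← comp_app_apply, Category.assoc, Category.assoc, splitπ_ι, ← hi,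
      ← Category.assoc, splitι_comp]
  have b {M N : X.Modules} {i : M ⟶ N} {p₁ : M ⟶ M} {p₂ : N ⟶ N} (h₁ : p₁ ≫ p₁ = p₁)
      (h₂ : p₂ ≫ p₂ = p₂) (hi : p₁ ≫ i = i ≫ p₂) (U : X.Opens) (s) :
      (splitι p₁ h₁ ≫ i ≫ splitπ p₂ h₂).app U ((splitπ p₁ h₁).app U s) =
        (splitπ p₂ h₂).app U (i.app U s) := by
    rw [← comp_app_apply, ← comp_app_apply, ← Category.assoc, splitπ_ι, ← Category.assoc, hi,
      Category.assoc, comp_splitπ]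
  refine ⟨fun U hU x y hxy => ?_, fun U hU y => ⟨fun hy => ?_, ?_⟩, fun U hU z => ?_⟩
  · have h4 := congrArg ((splitι p₂ h₂).app U) hxy
    rw [a h₁ h₂ hi, a h₁ h₂ hi] at h4
    rw [← splitι_π_apply p₁ h₁ x, h.1 U hU h4, splitι_π_apply]
  · have h4 := congrArg ((splitι p₃ h₃).app U) hy
    rw [a h₂ h₃ hq, map_zero] at h4
    obtain ⟨x, hx⟩ := (h.2 U hU _).mp h4
    exact ⟨(splitπ p₁ h₁).app U x, by rw [b h₁ h₂ hi, hx, splitι_π_apply]⟩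
  · rintro ⟨x, rfl⟩
    rw [← splitι_π_apply p₃ h₃ ((splitι p₂ h₂ ≫ q ≫ splitπ p₃ h₃).app U _), a h₂ h₃ hq,
      a h₁ h₂ hi, (h.2 U hU _).mpr ⟨_, rfl⟩, map_zero]
  · obtain ⟨y, hy⟩ := h.3 U hU ((splitι p₃ h₃).app U z)
    exact ⟨(splitπ p₂ h₂).app U y, by rw [b h₂ h₃ hq, hy, splitι_π_apply]⟩

theorem IsExactSeq.isShortExact_place {i : M ⟶ N} {q : N ⟶ K} (h : IsExactSeq i q) (w : Λ)
    (hM : IsVB M) (hN : IsVB N) (hK : IsVB K) :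
    IsShortExact (place w M hM) (place w N hN) (place w K hK) i q :=
  ⟨isEquivariant_place _ _ _ _, isEquivariant_place _ _ _ _, h.1, h.2, h.3⟩

theorem IsShortExact.isExactSeq {E F G : Bundle X Λ} {i : E.mod ⟶ G.mod} {q : G.mod ⟶ F.mod}
    (h : IsShortExact E G F i q) : IsExactSeq i q := ⟨h.3, h.4, h.5⟩

/-- Composition of a bilinear map with linear maps. -/
def Pairing.comp (b : Pairing M N K) (φ : M' ⟶ M) (ψ : N' ⟶ N) (χ : K ⟶ K') :
    Pairing M' N' K' where
  app U := ((b.app U).compl₁₂ (lapp φ U) (lapp ψ U)).compr₂ (lapp χ U)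
  map_app {U V} h x y := by
    change res K' h.le (χ.app U (b.app U (φ.app U x) (ψ.app U y))) =
      χ.app V (b.app V (φ.app V (res M' h.le x)) (ψ.app V (res N' h.le y)))
    rw [app_res, app_res, ← b.res_app, app_res]

theorem Pairing.comp_app (b : Pairing M N K) (φ : M' ⟶ M) (ψ : N' ⟶ N) (χ : K ⟶ K')
    (x : Γ(M', U)) (y : Γ(N', U)) :
    (b.comp φ ψ χ).app U x y = χ.app U (b.app U (φ.app U x) (ψ.app U y)) := rfl

theorem isTensor_place {b : Pairing M N K} (hM : IsVB M) (hN : IsVB N) (hK : IsVB K)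
    (hb : ∀ U, IsAffineOpen U → IsTensorProduct (b.app U)) (v w : Λ) :
    IsTensor (place v M hM) (place w N hN) (place (v + w) K hK) b := by
  refine ⟨hb, fun U v' w' x y hx hy => hasWeight_place.mpr ?_⟩
  rcases hasWeight_place.mp hx with rfl | rfl
  · rcases hasWeight_place.mp hy with rfl | rfl
    · exact Or.inl rfl
    · exact Or.inr (map_zero (b.app U x))
  · exact Or.inr (LinearMap.map_zero₂ (b.app U) y)

theorem isTensorProduct_split {b : Pairing M N K} {p₁ : M ⟶ M} {p₂ : N ⟶ N}
    {p₃ : K ⟶ K} (h₁ : p₁ ≫ p₁ = p₁) (h₂ : p₂ ≫ p₂ = p₂) (h₃ : p₃ ≫ p₃ = p₃)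
    (hb : IsTensorProduct (b.app U))
    (h : ∀ x y, p₃.app U (b.app U x y) = b.app U (p₁.app U x) (p₂.app U y)) :
    IsTensorProduct ((b.comp (splitι p₁ h₁) (splitι p₂ h₂) (splitπ p₃ h₃)).app U) := by
  refine hb.of_retract (lapp (splitι p₁ h₁) U) (lapp (splitπ p₁ h₁) U) (splitι_π_apply p₁ h₁)
    (lapp (splitι p₂ h₂) U) (lapp (splitπ p₂ h₂) U) (splitι_π_apply p₂ h₂)
    (lapp (splitι p₃ h₃) U) (lapp (splitπ p₃ h₃) U) (splitι_π_apply p₃ h₃) (fun x y => ?_)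
    fun x y => rfl
  simp only [lapp_apply]
  rw [splitπ_ι_apply, splitπ_ι_apply, splitπ_ι_apply, h]

/-- Scalar multiplication exhibits `M` in weight `w` as the tensor product of `𝒪_X(w)` and `M` in
weight `0`. -/
theorem K0.cls_place (w : Λ) (hM : IsVB M) :
    K0.cls (place w M hM) =
      K0.map X (0 : Unit →+ Λ) (K0.cls (place () M hM)) * K0.cls (lineBundle X w) := by
  have h1 := isTensor_place (isVB_structureSheaf X) hM hM
    (fun U _ => isTensorProduct_smulPairing M U) w 0
  rw [add_zero] at h1
  rw [K0.cls_tensor h1, mul_comm, K0.map_cls, push_place]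
  rfl

end PlacedBundles

/-! ### The character isomorphism from the equivariant Grothendieck ring to the group ring. -/

section Character

variable {X : Scheme.{u}} {Λ Λ' : Type} [AddCommGroup Λ] [AddCommGroup Λ']
  {M N K M' N' K' : X.Modules} {U V : X.Opens}

theorem K0.cls_split_of_eq_id (w : Λ) {p : M ⟶ M} (hp : p ≫ p = p) (hM : IsVB M) (h : p = 𝟙 M) :
    K0.cls (place w (splitObj p hp) (hM.split p hp)) = K0.cls (place w M hM) :=
  K0.cls_eq_of_iso (E := place w _ (hM.split p hp)) (F := place w M hM)
    ⟨splitι p hp, splitπ p hp, splitι_π p hp, (splitπ_ι p hp).trans h⟩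
    (isEquivariant_place _ _ _ _)

theorem K0.cls_split_of_eq_zero (w : Λ) {p : M ⟶ M} (hp : p ≫ p = p) (hM : IsVB M) (h : p = 0) :
    K0.cls (place w (splitObj p hp) (hM.split p hp)) = 0 := by
  refine K0.cls_eq_zero (E := place w _ (hM.split p hp)) ?_
  have h1 : splitι p hp = 0 := by
    rw [← splitι_comp]
    exact (congrArg (splitι p hp ≫ ·) h).trans Limits.comp_zero
  have h2 : 𝟙 (splitObj p hp) = 0 := by rw [← splitι_π, h1, Limits.zero_comp]
  exact h2

/-- The class of the part of weight `w`. -/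
def Bundle.partCls (E : Bundle X Λ) (w : Λ) : KX X := K0.cls (place () (E.part w) (E.isVB_part w))

theorem Bundle.partCls_eq_zero {E : Bundle X Λ} {w : Λ} (h : E.proj w = 0) : E.partCls w = 0 :=
  K0.cls_split_of_eq_zero _ _ E.isVB h

/-- The character of an equivariant bundle, with coefficients in `K_0(X)`. -/
def Bundle.character (E : Bundle X Λ) : AddMonoidAlgebra (KX X) Λ :=
  ∑ w ∈ E.proj.support, .single w (E.partCls w)

theorem Bundle.character_eq_sum (E : Bundle X Λ) {S : Finset Λ} (hS : E.proj.support ⊆ S) :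
    E.character = ∑ w ∈ S, .single w (E.partCls w) :=
  Finset.sum_subset hS fun w _ hw => by
    rw [Bundle.partCls_eq_zero (Finsupp.notMem_support_iff.mp hw), AddMonoidAlgebra.single_zero]

theorem character_place (w : Λ) (hM : IsVB M) :
    (place w M hM).character = .single w (K0.cls (place () M hM)) := by
  rw [Bundle.character_eq_sum (S := {w}) _ Finsupp.support_single_subset, Finset.sum_singleton]
  congr 1
  exact K0.cls_split_of_eq_id () _ hM (place_proj_self w hM)

/-- Equivariant maps commute with the weight projections, so the sequence restricts to an exact
sequence of parts in each weight. -/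
theorem Bundle.character_exact {E G F : Bundle X Λ} {i : E.mod ⟶ G.mod} {q : G.mod ⟶ F.mod}
    (h : IsShortExact E G F i q) : G.character = E.character + F.character := by
  classical
  rw [E.character_eq_sum (S := E.proj.support ∪ F.proj.support ∪ G.proj.support) (by grind),
    F.character_eq_sum (S := E.proj.support ∪ F.proj.support ∪ G.proj.support) (by grind),
    G.character_eq_sum (S := E.proj.support ∪ F.proj.support ∪ G.proj.support) (by grind),
    ← Finset.sum_add_distrib]
  refine Finset.sum_congr rfl fun w _ => ?_
  rw [← AddMonoidAlgebra.single_add]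
  congr 1
  exact K0.cls_exact ((h.isExactSeq.split (E.proj_idem w) (G.proj_idem w) (F.proj_idem w)
    (h.1 w) (h.2 w)).isShortExact_place () _ _ _)

theorem Bundle.hasWeight_proj (E : Bundle X Λ) (w : Λ) (s : Γ(E.mod, U)) :
    E.HasWeight w ((E.proj w).app U s) := by
  rw [Bundle.HasWeight, ← comp_app_apply, E.proj_idem]

theorem Bundle.sum_proj_apply (E : Bundle X Λ) {S : Finset Λ} (hS : E.proj.support ⊆ S)
    (s : Γ(E.mod, U)) : ∑ w ∈ S, (E.proj w).app U s = s := by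
  have := congrArg (evalHom s) (E.sum_proj hS)
  rw [map_sum] at this
  exact this.trans (id_app_apply s)

theorem Bundle.HasWeight.proj_apply {E : Bundle X Λ} {v : Λ} {s : Γ(E.mod, U)}
    (h : E.HasWeight v s) (w : Λ) [DecidableEq Λ] :
    (E.proj w).app U s = if v = w then s else 0 := by
  split_ifs with hvw
  · subst hvw; exact h
  · rw [← (show (E.proj v).app U s = s from h), ← comp_app_apply, E.proj_orth v w hvw,
      zero_app_apply]

/-- The tensor products of weight projections of `E` and `F` are orthogonal idempotents of `G` with
images `E_u ⊗ F_v`. Those with `u + v = w` add up to the projection of `G` to weight `w`. -/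
theorem Bundle.character_tensor {E F G : Bundle X Λ} {b : Pairing E.mod F.mod G.mod}
    (h : IsTensor E F G b) : G.character = E.character * F.character := by
  classical
  have key (p : Λ × Λ) := exists_map_of_isTensorProduct b h.1 b (E.proj p.1) (F.proj p.2)
  choose q hq using key
  have hqq (p p' : Λ × Λ) : q p ≫ q p' = if p = p' then q p else 0 := by
    refine tensor_hom_ext b h.1 fun U _ x y => ?_
    rw [comp_app_apply, hq, hq, ← comp_app_apply, ← comp_app_apply, E.proj_comp, F.proj_comp]
    by_cases h1 : p.1 = p'.1
    · by_cases h2 : p.2 = p'.2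
      · rw [if_pos h1, if_pos h2, if_pos (Prod.ext h1 h2), hq]
      · rw [if_pos h1, if_neg h2, if_neg fun h => h2 (congrArg Prod.snd h), zero_app_apply,
          map_zero, zero_app_apply]
    · rw [if_neg h1, if_neg fun h => h1 (congrArg Prod.fst h), zero_app_apply, zero_app_apply]
      exact LinearMap.map_zero₂ _ _
  have hqi (p) : q p ≫ q p = q p := by rw [hqq, if_pos rfl]
  let S := E.proj.support ×ˢ F.proj.support
  -- The set `T` contains both the weights of `G` and all sums of weights, so that the product of
  -- characters can be regrouped along `u + v = w`.
  let T := G.proj.support ∪ S.image fun p => p.1 + p.2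
  -- Tested on pure tensors: expand both factors into homogeneous parts and keep those whose weights
  -- sum to `w`.
  have hG (w) : ∑ p ∈ S with p.1 + p.2 = w, q p = G.proj w := by
    refine tensor_hom_ext b h.1 fun U _ x y => ?_
    have h1 : evalHom (b.app U x y) (∑ p ∈ S with p.1 + p.2 = w, q p) =
        ∑ p ∈ S with p.1 + p.2 = w, b.app U ((E.proj p.1).app U x) ((F.proj p.2).app U y) := by
      rw [map_sum]
      exact Finset.sum_congr rfl fun p _ => hq p U x y
    have h2 : b.app U x y =
        ∑ p ∈ S, b.app U ((E.proj p.1).app U x) ((F.proj p.2).app U y) := by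
      rw [Finset.sum_product]
      conv_lhs => rw [← E.sum_proj_apply subset_rfl x, ← F.sum_proj_apply subset_rfl y]
      simp only [map_sum, LinearMap.sum_apply]
      exact Finset.sum_comm
    refine h1.trans ?_
    conv_rhs => rw [h2]
    rw [Finset.sum_filter]
    refine Eq.trans ?_ (map_sum ((G.proj w).app U).hom _ S).symm
    refine Finset.sum_congr rfl fun p _ => ?_
    exact ((h.2 U _ _ _ _ (E.hasWeight_proj p.1 x) (F.hasWeight_proj p.2 y)).proj_apply w).symm
  have hpart (w) : G.partCls w = ∑ p ∈ S with p.1 + p.2 = w, E.partCls p.1 * F.partCls p.2 := by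
    refine (K0.cls_split_sum () G.isVB _ q hqi (fun p _ p' _ hpp => ?_) _ (G.proj_idem w)
      (hG w)).trans (Finset.sum_congr rfl fun p _ => ?_)
    · rw [hqq, if_neg hpp]
    · exact K0.cls_tensor (isTensor_place (E.isVB.split _ (E.proj_idem p.1))
        (F.isVB.split _ (F.proj_idem p.2)) (G.isVB.split _ (hqi p)) (fun U hU =>
        isTensorProduct_split (E.proj_idem p.1) (F.proj_idem p.2) (hqi p) (h.1 U hU)
          (hq p U)) () ())
  rw [G.character_eq_sum (S := T) Finset.subset_union_left, Bundle.character, Bundle.character,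
    Finset.sum_mul_sum, ← Finset.sum_product', ← Finset.sum_fiberwise_of_maps_to
      (s := E.proj.support ×ˢ F.proj.support) (t := T) (g := fun p => p.1 + p.2)
      fun p hp => Finset.mem_union_right _ (Finset.mem_image_of_mem _ hp)]
  refine Finset.sum_congr rfl fun w _ => ?_
  rw [hpart w]
  refine (map_sum (AddMonoidAlgebra.singleAddHom w) _ _).trans ?_
  refine Finset.sum_congr rfl fun p hp => ?_
  rw [AddMonoidAlgebra.single_mul_single, (Finset.mem_filter.mp hp).2]
  rfl

variable (X Λ) in
/-- The character as a ring homomorphism. -/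
def K0.character : K0 X Λ →+* AddMonoidAlgebra (KX X) Λ :=
  Ideal.Quotient.lift _ (MvPolynomial.aeval fun E : Bundle X Λ => E.character).toRingHom <| by
    have hle : Ideal.span {r | K0Rel X Λ r} ≤ RingHom.ker
        (MvPolynomial.aeval fun E : Bundle X Λ => E.character).toRingHom := by
      refine Ideal.span_le.mpr fun r hr => ?_
      refine RingHom.mem_ker.mpr ?_
      cases hr with
      | exact h => simp [Bundle.character_exact h]
      | tensor h => simp [Bundle.character_tensor h]
      | unit =>
        have : (lineBundle X (0 : Λ)).character = 1 := by
          rw [lineBundle_eq_place, character_place, ← lineBundle_eq_place]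
          exact congrArg _ K0.cls_unit
        simp [this]
    exact fun r hr => hle hr

theorem K0.character_cls (E : Bundle X Λ) : K0.character X Λ (K0.cls E) = E.character := by
  simp [K0.character, K0.cls]

theorem K0.induction_on {P : K0 X Λ → Prop} (a : K0 X Λ) (cls : ∀ E, P (K0.cls E))
    (int : ∀ n : ℤ, P n) (add : ∀ a b, P a → P b → P (a + b)) (mul : ∀ a b, P a → P b → P (a * b)) :
    P a := by
  obtain ⟨p, rfl⟩ := Ideal.Quotient.mk_surjective a
  induction p using MvPolynomial.induction_on with
  | C n => simpa using int n
  | add p q hp hq => rw [map_add]; exact add _ _ hp hq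
  | mul_X p E hp => rw [map_mul]; exact mul _ _ hp (cls E)

theorem K0.ringHom_ext {R : Type*} [CommRing R] {f g : K0 X Λ →+* R}
    (h : ∀ E, f (K0.cls E) = g (K0.cls E)) : f = g := by
  refine RingHom.ext fun a => ?_
  induction a using K0.induction_on with
  | cls E => exact h E
  | int n => simp
  | add a b ha hb => rw [map_add, map_add, ha, hb]
  | mul a b ha hb => rw [map_mul, map_mul, ha, hb]

variable (Λ) in
/-- A vector bundle with the trivial equivariant structure. -/
abbrev K0.triv : KX X →+* K0 X Λ := K0.map X 0

theorem K0.character_triv (a : KX X) :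
    K0.character X Λ (K0.triv Λ a) = AddMonoidAlgebra.single 0 a := by
  have : (K0.character X Λ).comp (K0.triv Λ) = AddMonoidAlgebra.singleZeroRingHom := by
    refine K0.ringHom_ext (R := AddMonoidAlgebra (KX X) Λ) fun E => ?_
    have h : K0.character X Λ (K0.map X (0 : Unit →+ Λ) (K0.cls E)) =
        AddMonoidAlgebra.single 0 (K0.cls E) := by
      rw [K0.map_cls, K0.character_cls, E.eq_place, push_place, character_place]
      rfl
    exact h
  exact RingHom.congr_fun this a

theorem K0.character_lineBundle (w : Λ) :
    K0.character X Λ (K0.cls (lineBundle X w)) = AddMonoidAlgebra.single w 1 := by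
  rw [K0.character_cls, lineBundle_eq_place, character_place]
  exact congrArg _ K0.cls_unit

theorem K0.cls_lineBundle_add (v w : Λ) :
    K0.cls (lineBundle X (v + w)) = K0.cls (lineBundle X v) * K0.cls (lineBundle X w) :=
  K0.cls_tensor (isTensor_place (isVB_structureSheaf X) (isVB_structureSheaf X)
    (isVB_structureSheaf X) (fun U _ => isTensorProduct_smulPairing (structureSheaf X) U) v w)

variable (X Λ) in
/-- The classes of the line bundles `𝒪_X(w)`. -/
def K0.line : Multiplicative Λ →* K0 X Λ where
  toFun w := K0.cls (lineBundle X w.toAdd)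
  map_one' := K0.cls_unit
  map_mul' v w := K0.cls_lineBundle_add v.toAdd w.toAdd

variable (X Λ) in
/-- The inverse of the character. -/
def K0.ofAlgebra : AddMonoidAlgebra (KX X) Λ →+* K0 X Λ :=
  AddMonoidAlgebra.liftNCRingHom (K0.triv Λ) (K0.line X Λ) fun _ _ => Commute.all _ _

theorem K0.ofAlgebra_single (w : Λ) (a : KX X) :
    K0.ofAlgebra X Λ (.single w a) = K0.triv Λ a * K0.cls (lineBundle X w) :=
  AddMonoidAlgebra.liftNC_single _ _ _ _

/-- On the class of a bundle this is its decomposition into weight parts. -/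
theorem K0.ofAlgebra_character (a : K0 X Λ) : K0.ofAlgebra X Λ (K0.character X Λ a) = a := by
  have : (K0.ofAlgebra X Λ).comp (K0.character X Λ) = RingHom.id _ :=
    K0.ringHom_ext fun E => by
      change K0.ofAlgebra X Λ (K0.character X Λ (K0.cls E)) = K0.cls E
      rw [K0.character_cls, Bundle.character, map_sum, K0.cls_eq_sum_part E subset_rfl]
      refine Finset.sum_congr rfl fun w _ => ?_
      rw [K0.ofAlgebra_single, K0.cls_place w]
      rfl
  exact RingHom.congr_fun this a

theorem K0.character_ofAlgebra (a : AddMonoidAlgebra (KX X) Λ) :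
    K0.character X Λ (K0.ofAlgebra X Λ a) = a := by
  have : (K0.character X Λ).comp (K0.ofAlgebra X Λ) = RingHom.id _ :=
    AddMonoidAlgebra.ringHom_ext (fun a => by
      change K0.character X Λ (K0.ofAlgebra X Λ _) = _
      rw [K0.ofAlgebra_single, map_mul, K0.character_triv, K0.character_lineBundle]
      simp) (fun w => by
      change K0.character X Λ (K0.ofAlgebra X Λ _) = _
      rw [K0.ofAlgebra_single, map_mul, K0.character_triv, K0.character_lineBundle]
      simp)
  exact RingHom.congr_fun this a

variable (X Λ) in
/-- The equivariant Grothendieck ring is the group ring of the group of weights. -/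
def K0.characterEquiv : K0 X Λ ≃+* AddMonoidAlgebra (KX X) Λ :=
  { K0.character X Λ with
    invFun := K0.ofAlgebra X Λ
    left_inv := K0.ofAlgebra_character
    right_inv := K0.character_ofAlgebra }

/-- The coefficient of the character at the weight `w`. -/
def K0.coeff (w : Λ) : K0 X Λ →+ KX X where
  toFun a := (K0.character X Λ a).coeff w
  map_zero' := by simp
  map_add' a b := by simp

theorem K0.coeff_triv_mul (a : KX X) (v w : Λ) [DecidableEq Λ] :
    K0.coeff w (K0.triv Λ a * K0.cls (lineBundle X v)) = if v = w then a else 0 := by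
  change (K0.character X Λ _).coeff w = _
  rw [map_mul, K0.character_triv, K0.character_lineBundle, AddMonoidAlgebra.single_mul_single,
    zero_add, mul_one, AddMonoidAlgebra.coeff_single, Finsupp.single_apply]

theorem K0.eq_sum_coeff (a : K0 X Λ) : ∃ S : Finset Λ, (∀ w ∉ S, K0.coeff w a = 0) ∧
    a = ∑ w ∈ S, K0.triv Λ (K0.coeff w a) * K0.cls (lineBundle X w) := by
  refine ⟨(K0.character X Λ a).coeff.support, fun w hw => Finsupp.notMem_support_iff.mp hw, ?_⟩
  conv_lhs => rw [← K0.ofAlgebra_character a]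
  have : K0.character X Λ a = ∑ w ∈ (K0.character X Λ a).coeff.support,
      AddMonoidAlgebra.single w ((K0.character X Λ a).coeff w) := by
    refine AddMonoidAlgebra.coeff_injective ?_
    rw [AddMonoidAlgebra.coeff_sum]
    exact ((K0.character X Λ a).coeff.sum_single).symm
  rw [this, map_sum]
  simp only [K0.ofAlgebra_single]
  rw [← this]
  rfl

theorem K0.coeff_ext {a b : K0 X Λ} (h : ∀ w, K0.coeff w a = K0.coeff w b) : a = b := by
  refine (K0.characterEquiv X Λ).injective (AddMonoidAlgebra.coeff_injective ?_)
  exact Finsupp.ext h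

end Character

/-! ### Coefficients of the character, and perfect pairings between opposite weights. -/

section Coefficients

variable {X : Scheme.{u}} {Λ Λ' : Type} [AddCommGroup Λ] [AddCommGroup Λ']
  {M N K M' N' K' : X.Modules} {U V : X.Opens}

theorem K0.coeff_cls (E : Bundle X Λ) (w : Λ) : K0.coeff w (K0.cls E) = E.partCls w := by
  classical
  change (K0.character X Λ (K0.cls E)).coeff w = _
  rw [K0.character_cls, E.character_eq_sum (S := insert w E.proj.support) (Finset.subset_insert _ _),
    AddMonoidAlgebra.coeff_sum, Finsupp.finsetSum_apply, Finset.sum_eq_single w]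
  · simp
  · intro v _ hv
    rw [AddMonoidAlgebra.coeff_single, Finsupp.single_eq_of_ne (Ne.symm hv)]
  · exact fun h => absurd (Finset.mem_insert_self _ _) h

theorem K0.map_lineBundle (f : Λ →+ Λ') (w : Λ) :
    K0.map X f (K0.cls (lineBundle X w)) = K0.cls (lineBundle X (f w)) := by
  rw [K0.map_cls, push_lineBundle]

theorem K0.map_unit (f : Unit →+ Unit) (a : KX X) : K0.map X f a = a := by
  have : K0.map X f = RingHom.id _ := K0.ringHom_ext fun E => by
    rw [K0.map_cls, E.eq_place, push_place]
    rfl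
  exact RingHom.congr_fun this a

/-- Induction over the elements of the equivariant Grothendieck ring. -/
theorem K0.induction_weights {P : K0 X Λ → Prop} (a : K0 X Λ)
    (mul : ∀ c w, P (K0.triv Λ c * K0.cls (lineBundle X w)))
    (add : ∀ a b, P a → P b → P (a + b)) : P a := by
  obtain ⟨S, -, h⟩ := K0.eq_sum_coeff a
  rw [h]
  refine Finset.sum_induction _ P add ?_ fun w _ => mul _ _
  simpa using mul 0 0

/-- The composition of a bilinear form with two morphisms. -/
def Form.comp (c : Form M N) (φ : M' ⟶ M) (ψ : N' ⟶ N) : Form M' N' where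
  app U := (c.app U).compl₁₂ (lapp φ U) (lapp ψ U)
  map_app {U V} h x y := by
    change fres h.le (c.app U (φ.app U x) (ψ.app U y)) =
      c.app V (φ.app V (res M' h.le x)) (ψ.app V (res N' h.le y))
    rw [app_res, app_res, ← c.res_app]

theorem Form.comp_app (c : Form M N) (φ : M' ⟶ M) (ψ : N' ⟶ N) (x : Γ(M', U)) (y : Γ(N', U)) :
    (c.comp φ ψ).app U x y = c.app U (φ.app U x) (ψ.app U y) := rfl

/-- An equivariant form pairs weight `w` nontrivially with weight `-w` only. -/
theorem IsPerfect.proj_left {E F : Bundle X Λ} {c : Form E.mod F.mod} (hc : IsPerfect E F c)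
    (w : Λ) (x : Γ(E.mod, U)) (y : Γ(F.mod, U)) :
    c.app U ((E.proj w).app U x) y = c.app U ((E.proj w).app U x) ((F.proj (-w)).app U y) := by
  classical
  conv_lhs => rw [← F.sum_proj_apply (S := insert (-w) F.proj.support) (Finset.subset_insert _ _) y]
  rw [map_sum, Finset.sum_eq_single (-w)]
  · intro v _ hv
    refine hc.2 U w v _ _ (E.hasWeight_proj w x) (F.hasWeight_proj v y) fun h => hv ?_
    exact (neg_eq_of_add_eq_zero_right h).symm
  · exact fun h => absurd (Finset.mem_insert_self _ _) h

/-- The flipped bilinear form. -/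
def Form.flip (c : Form M N) : Form N M where
  app U := (c.app U).flip
  map_app h x y := c.map_app h y x

theorem IsPerfect.flip {E F : Bundle X Λ} {c : Form E.mod F.mod} (hc : IsPerfect E F c) :
    IsPerfect F E c.flip :=
  ⟨fun U hU => (hc.1 U hU).flip, fun U v w x y hx hy h => hc.2 U w v y x hy hx
    (by rwa [add_comm])⟩

/-- Adjointness of the projections to opposite weights is what makes the form between the two parts
perfect. -/
theorem IsPerfect.proj_comm {E F : Bundle X Λ} {c : Form E.mod F.mod} (hc : IsPerfect E F c)
    (w : Λ) (x : Γ(E.mod, U)) (y : Γ(F.mod, U)) :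
    c.app U ((E.proj w).app U x) y = c.app U x ((F.proj (-w)).app U y) := by
  rw [hc.proj_left]
  have := hc.flip.proj_left (-w) y x
  rw [neg_neg] at this
  exact this.symm

theorem isPerfPair_split {c : Form M N} {p : M ⟶ M} {q : N ⟶ N} (hp : p ≫ p = p) (hq : q ≫ q = q)
    (hc : (c.app U).IsPerfPair) (h : ∀ x y, c.app U (p.app U x) y = c.app U x (q.app U y)) :
    ((c.comp (splitι p hp) (splitι q hq)).app U).IsPerfPair := by
  refine isPerfPair_of_retract hc (lapp (splitι p hp) U) (lapp (splitπ p hp) U)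
    (splitι_π_apply p hp) (lapp (splitι q hq) U) (lapp (splitπ q hq) U) (splitι_π_apply q hq)
    (fun x y => ?_) fun x y => rfl
  simp only [lapp_apply]
  rw [splitπ_ι_apply, splitπ_ι_apply, h]

theorem isPerfect_place (hM : IsVB M) (hN : IsVB N) {c : Form M N}
    (hc : ∀ U, IsAffineOpen U → (c.app U).IsPerfPair) (v w : Λ) (hvw : v + w = 0) :
    IsPerfect (place v M hM) (place w N hN) c := by
  refine ⟨hc, fun U v' w' x y hx hy h => ?_⟩
  rcases hasWeight_place.mp hx with rfl | rfl
  · rcases hasWeight_place.mp hy with rfl | rfl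
    · exact absurd hvw h
    · exact map_zero (c.app U x)
  · exact LinearMap.map_zero₂ (c.app U) y

/-- If duality acts trivially on `K_0(X)`, then dual bundles have opposite parts. -/
theorem IsPerfect.partCls_eq (h : ∀ (E F : Bundle X Unit) (c : Form E.mod F.mod), IsPerfect E F c →
    K0.cls E = K0.cls F) {E F : Bundle X Λ} {c : Form E.mod F.mod} (hc : IsPerfect E F c) (w : Λ) :
    E.partCls w = F.partCls (-w) :=
  h _ _ (c.comp (splitι (E.proj w) (E.proj_idem w)) (splitι (F.proj (-w)) (F.proj_idem (-w))))
    (isPerfect_place (E.isVB_part w) (F.isVB_part (-w)) (fun U hU =>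
      isPerfPair_split (E.proj_idem w) (F.proj_idem (-w)) (hc.1 U hU) (hc.proj_comm w)) () () rfl)

end Coefficients

/-! ### The rank homomorphism on a nonempty scheme. -/

section Rank

variable {X : Scheme.{u}}

open TensorProduct in
/-- The rank of a vector bundle at a point of an affine open subset, as a ring homomorphism. -/
theorem exists_rank [Nonempty X] : Nonempty (KX X →+* ℤ) := by
  obtain ⟨x⟩ := ‹Nonempty X›
  obtain ⟨U, hU, hxU, -⟩ := exists_affine_le (X := X) (x := x) (U := ⊤) trivial
  have : Nonempty U := ⟨⟨x, hxU⟩⟩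
  have : Nontrivial Γ(X, U) := inferInstance
  obtain ⟨p⟩ : Nonempty (PrimeSpectrum Γ(X, U)) := inferInstance
  -- The point `x` only provides a nonempty affine open; the rank may be taken at any prime of its
  -- nontrivial ring.
  let rk : Bundle X Unit → ℤ := fun E => (Module.rankAtStalk (R := Γ(X, U)) Γ(E.mod, U) p : ℤ)
  have hle : Ideal.span {r | K0Rel X Unit r} ≤ RingHom.ker (MvPolynomial.aeval rk).toRingHom := by
    refine Ideal.span_le.mpr fun r hr => RingHom.mem_ker.mpr ?_
    have hfin (E : Bundle X Unit) : Module.Finite Γ(X, U) Γ(E.mod, U) := E.finite U hU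
    have hproj (E : Bundle X Unit) : Module.Projective Γ(X, U) Γ(E.mod, U) := E.projective U hU
    cases hr with
    | @exact E G F i q h =>
      obtain ⟨σ, ρ, hσ, hρ⟩ := exists_retract_of_exact (i := lapp i U) (q := lapp q U)
        (h.injective U hU) (h.exact U hU) (h.surjective U hU)
      have e : (Γ(E.mod, U) × Γ(F.mod, U)) ≃ₗ[Γ(X, U)] Γ(G.mod, U) :=
        LinearEquiv.ofBijective ((lapp i U).coprod σ) ⟨by
          refine (injective_iff_map_eq_zero _).mpr fun z hz => ?_
          have h1 := congrArg (lapp q U) hz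
          rw [LinearMap.coprod_apply, map_add, hσ, map_zero] at h1
          rw [show lapp q U (lapp i U z.1) = 0 from (h.exact U hU _).mpr ⟨_, rfl⟩, zero_add] at h1
          rw [LinearMap.coprod_apply, h1, map_zero, add_zero] at hz
          exact Prod.ext (h.injective U hU (hz.trans (map_zero (lapp i U)).symm)) h1, fun y =>
          ⟨(ρ y, lapp q U y), by rw [LinearMap.coprod_apply, hρ]; simp⟩⟩
      have := Module.rankAtStalk_eq_of_equiv e
      rw [Module.rankAtStalk_prod] at this
      simp [rk, ← this]
    | @tensor E F G b h =>
      have e : (Γ(E.mod, U) ⊗[Γ(X, U)] Γ(F.mod, U)) ≃ₗ[Γ(X, U)] Γ(G.mod, U) :=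
        (h.1 U hU).equiv
      have := Module.rankAtStalk_eq_of_equiv e
      rw [Module.rankAtStalk_tensorProduct] at this
      simp [rk, ← this]
    | unit =>
      have : rk (lineBundle X 0) = 1 := by
        change ((Module.rankAtStalk (R := Γ(X, U)) Γ(X, U) p : ℕ) : ℤ) = 1
        rw [Module.rankAtStalk_self]
        simp
      simp [this]
  exact ⟨Ideal.Quotient.lift _ (MvPolynomial.aeval rk).toRingHom fun r hr => hle hr⟩

end Rank

/-! ### The generators of the representation ring of the torus. -/

section Torus

variable (X : Scheme.{u}) {t : ℕ}

/-- The class of `𝒪_X(w)`. -/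
def zCls (w : Fin t → ℤ) : KTX X t := K0.cls (lineBundle X w)

theorem zCls_add (v w : Fin t → ℤ) : zCls X (v + w) = zCls X v * zCls X w :=
  K0.cls_lineBundle_add v w

theorem zCls_zero : zCls X (0 : Fin t → ℤ) = 1 := K0.cls_unit

theorem zCls_mul_neg (w : Fin t → ℤ) : zCls X w * zCls X (-w) = 1 := by
  rw [← zCls_add, add_neg_cancel, zCls_zero]

theorem vee_zCls (w : Fin t → ℤ) : vee X t (zCls X w) = zCls X (-w) := K0.map_lineBundle _ w

theorem augmentation_zCls (w : Fin t → ℤ) : augmentation X t (zCls X w) = 1 :=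
  (K0.map_lineBundle _ w).trans K0.cls_unit

theorem augmentation_triv (a : KX X) : augmentation X t (triv X t a) = a := by
  rw [augmentation, triv, K0.map_map]
  exact K0.map_unit _ a

theorem coeff_vee (w : Fin t → ℤ) (a : KTX X t) : K0.coeff w (vee X t a) = K0.coeff (-w) a := by
  induction a using K0.induction_weights with
  | mul c v =>
    change K0.coeff w (vee X t (triv X t c * zCls X v)) = K0.coeff (-w) (triv X t c * zCls X v)
    rw [map_mul, vee_triv, vee_zCls]
    refine (K0.coeff_triv_mul c (-v) w).trans (Eq.trans ?_ (K0.coeff_triv_mul c v (-w)).symm)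
    simp [neg_eq_iff_eq_neg]
  | add a b ha hb => rw [map_add, map_add, map_add, ha, hb]

theorem coeff_triv_mul_zCls (c : KX X) (v w : Fin t → ℤ) :
    K0.coeff w (triv X t c * zCls X v) = if v = w then c else 0 := K0.coeff_triv_mul c v w

theorem coeff_triv (c : KX X) (w : Fin t → ℤ) :
    K0.coeff w (triv X t c) = if 0 = w then c else 0 := by
  have := coeff_triv_mul_zCls X c 0 w
  rwa [zCls_zero, mul_one] at this

/-- Induction over the weights of the torus. -/
theorem weight_induction {P : (Fin t → ℤ) → Prop} (w : Fin t → ℤ) (zero : P 0)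
    (add : ∀ v w, P v → P w → P (v + w)) (pos : ∀ i, P (Pi.single i 1))
    (neg : ∀ i, P (-Pi.single i 1)) : P w := by
  rw [← Finset.univ_sum_single w]
  refine Finset.sum_induction _ P add zero fun i _ => ?_
  induction w i using Int.induction_on with
  | zero => simpa using zero
  | succ n ih => rw [Pi.single_add]; exact add _ _ ih (pos i)
  | pred n ih =>
    rw [Pi.single_sub, sub_eq_add_neg]
    exact add _ _ ih (neg i)

theorem presentation_C (a : KX X) : presentation X t (MvPolynomial.C a) = triv X t a := by
  simp [presentation]

theorem presentation_inl (i : Fin t) :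
    presentation X t (MvPolynomial.X (Sum.inl i)) = zCls X (Pi.single i 1) - 1 := by
  simp [presentation, xCls, zCls]

theorem presentation_inr (i : Fin t) :
    presentation X t (MvPolynomial.X (Sum.inr i)) = zCls X (-Pi.single i 1) - 1 := by
  simp [presentation, yCls, zCls]

/-- The image contains `z_i = 1 + x_i` and `z_i⁻¹ = 1 + y_i`, hence every `z^w`, and these span `R`
over `K_0(X)`. -/
theorem presentation_surjective (t : ℕ) : Function.Surjective (presentation X t) := by
  have hz (w : Fin t → ℤ) : ∃ p, presentation X t p = zCls X w := by
    induction w using weight_induction with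
    | zero => exact ⟨1, by rw [map_one, zCls_zero]⟩
    | add v w hv hw =>
      obtain ⟨p, hp⟩ := hv
      obtain ⟨q, hq⟩ := hw
      exact ⟨p * q, by rw [map_mul, hp, hq, zCls_add]⟩
    | pos i =>
      exact ⟨MvPolynomial.X (Sum.inl i) + 1, by rw [map_add, presentation_inl, map_one]; ring⟩
    | neg i =>
      exact ⟨MvPolynomial.X (Sum.inr i) + 1, by rw [map_add, presentation_inr, map_one]; ring⟩
  intro a
  induction a using K0.induction_weights with
  | mul c w =>
    obtain ⟨p, hp⟩ := hz w
    exact ⟨MvPolynomial.C c * p, by rw [map_mul, presentation_C, hp]; rfl⟩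
  | add a b ha hb =>
    obtain ⟨p, hp⟩ := ha
    obtain ⟨q, hq⟩ := hb
    exact ⟨p + q, by rw [map_add, hp, hq]⟩

end Torus

/-! ### Laurent polynomials as a quotient of a polynomial ring. -/

section LaurentRelations

variable (K : Type*) [CommRing K] {t : ℕ}

/-- The ideal of relations `x_i y_i + x_i + y_i`. -/
abbrev relIdeal (t : ℕ) : Ideal (MvPolynomial (Fin t ⊕ Fin t) K) :=
  Ideal.span (Set.range fun i : Fin t =>
    MvPolynomial.X (Sum.inl i) * MvPolynomial.X (Sum.inr i) +
      MvPolynomial.X (Sum.inl i) + MvPolynomial.X (Sum.inr i))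

/-- The unit `1 + x_i` of the quotient by the relations. -/
def relUnit (i : Fin t) : (MvPolynomial (Fin t ⊕ Fin t) K ⧸ relIdeal K t)ˣ :=
  Units.mkOfMulEqOne (Ideal.Quotient.mk _ (MvPolynomial.X (Sum.inl i) + 1))
    (Ideal.Quotient.mk _ (MvPolynomial.X (Sum.inr i) + 1)) <| by
      rw [← map_mul, ← map_one (Ideal.Quotient.mk _), Ideal.Quotient.eq]
      have : (MvPolynomial.X (Sum.inl i) + 1) * (MvPolynomial.X (Sum.inr i) + 1) - 1 =
        (MvPolynomial.X (Sum.inl i) * MvPolynomial.X (Sum.inr i) + MvPolynomial.X (Sum.inl i) +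
          MvPolynomial.X (Sum.inr i) : MvPolynomial (Fin t ⊕ Fin t) K) := by ring
      rw [this]
      exact Ideal.subset_span ⟨i, rfl⟩

/-- The monomials in units of a commutative ring. -/
def unitMonomial {R : Type*} [CommRing R] (f : Fin t → Rˣ) : Multiplicative (Fin t → ℤ) →* R where
  toFun w := ((∏ i, f i ^ (w.toAdd i) : Rˣ) : R)
  map_one' := by simp
  map_mul' v w := by simp [zpow_add, Finset.prod_mul_distrib]

theorem unitMonomial_single {R : Type*} [CommRing R] (f : Fin t → Rˣ) (i : Fin t) (n : ℤ) :
    unitMonomial f (.ofAdd (Pi.single i n)) = (f i ^ n : Rˣ) := by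
  change ((∏ j, f j ^ ((Pi.single i n : Fin t → ℤ) j) : Rˣ) : R) = _
  rw [Finset.prod_eq_single i]
  · simp
  · intro j _ hj
    rw [Pi.single_eq_of_ne hj, zpow_zero]
  · simp

/-- The ring of Laurent polynomials is the quotient by the relations `x_i y_i + x_i + y_i`. -/
theorem ker_eq_relIdeal {R : Type*} [CommRing R] (φ : MvPolynomial (Fin t ⊕ Fin t) K →+* R)
    (χ : R →+* AddMonoidAlgebra K (Fin t → ℤ))
    (hφ : ∀ i, φ (MvPolynomial.X (Sum.inl i) * MvPolynomial.X (Sum.inr i) +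
      MvPolynomial.X (Sum.inl i) + MvPolynomial.X (Sum.inr i)) = 0)
    (hC : ∀ a, χ (φ (MvPolynomial.C a)) = .single 0 a)
    (hx : ∀ i, χ (φ (MvPolynomial.X (Sum.inl i))) = .single (Pi.single i 1) 1 - 1)
    (hy : ∀ i, χ (φ (MvPolynomial.X (Sum.inr i))) = .single (-Pi.single i 1) 1 - 1) :
    RingHom.ker φ = relIdeal K t := by
  refine le_antisymm (fun p hp => ?_) (Ideal.span_le.mpr ?_)
  -- Sending `z^w` to the monomial in the units `1 + x_i` maps the Laurent ring to the quotient by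
  -- the relations. Then `θ ∘ χ ∘ φ` is the quotient map, so whatever `φ` kills lies in the ideal.
  · let θ : AddMonoidAlgebra K (Fin t → ℤ) →+*
        MvPolynomial (Fin t ⊕ Fin t) K ⧸ relIdeal K t :=
      AddMonoidAlgebra.liftNCRingHom ((Ideal.Quotient.mk _).comp MvPolynomial.C)
        (unitMonomial (relUnit K)) fun _ _ => Commute.all _ _
    have hθ (w a) : θ (.single w a) =
        Ideal.Quotient.mk _ (MvPolynomial.C a) * unitMonomial (relUnit K) (.ofAdd w) :=
      AddMonoidAlgebra.liftNC_single _ _ _ _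
    have key : (θ.comp χ).comp φ = Ideal.Quotient.mk _ := by
      refine MvPolynomial.ringHom_ext (fun a => ?_) ?_
      · change θ (χ (φ _)) = _
        rw [hC, hθ, ofAdd_zero, map_one, mul_one]
      · rintro (i | i)
        · change θ (χ (φ _)) = _
          rw [hx, map_sub, hθ, unitMonomial_single, map_one, map_one, map_one, zpow_one]
          simp [relUnit]
        · change θ (χ (φ _)) = _
          rw [hy, map_sub, hθ, ← Pi.single_neg, unitMonomial_single, map_one, map_one, map_one,
            zpow_neg_one, show ((relUnit K i)⁻¹ : _ˣ).val =
              Ideal.Quotient.mk _ (MvPolynomial.X (Sum.inr i) + 1) from rfl]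
          simp
    have h1 := RingHom.congr_fun key p
    change θ (χ (φ p)) = _ at h1
    rw [RingHom.mem_ker.mp hp, map_zero, map_zero] at h1
    exact Ideal.Quotient.eq_zero_iff_mem.mp h1.symm
  · rintro _ ⟨i, rfl⟩
    exact hφ i

end LaurentRelations

/-! ### The kernel of the presentation. -/

section Torus

variable (X : Scheme.{u}) {t : ℕ}

theorem ker_presentation (t : ℕ) : RingHom.ker (presentation X t) =
    Ideal.span (Set.range fun i : Fin t =>
      MvPolynomial.X (Sum.inl i) * MvPolynomial.X (Sum.inr i) +
        MvPolynomial.X (Sum.inl i) + MvPolynomial.X (Sum.inr i)) := by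
  refine ker_eq_relIdeal (KX X) (presentation X t) (K0.character X (Fin t → ℤ)) (fun i => ?_)
    (fun a => ?_) (fun i => ?_) (fun i => ?_)
  · have h := zCls_mul_neg X (Pi.single i 1)
    rw [map_add, map_add, map_mul, presentation_inl, presentation_inr]
    linear_combination h
  · rw [presentation_C]
    exact K0.character_triv a
  · rw [presentation_inl, map_sub, map_one, zCls, K0.character_lineBundle]
  · rw [presentation_inr, map_sub, map_one, zCls, K0.character_lineBundle]

end Torus

/-! ### The fixed ring of the involution and generators of its augmentation ideal. -/

section InvariantPart

variable (X : Scheme.{u}) {t : ℕ}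

variable {X} in
/-- Induction over the `∨`-fixed elements. -/
theorem vee_fixed_induction {P : KTX X t → Prop} (f : KTX X t) (hf : vee X t f = f)
    (triv : ∀ a, P (triv X t a)) (add : ∀ a b, P a → P b → P (a + b))
    (pair : ∀ a w, w ≠ 0 → P (TorusGW.triv X t a * (zCls X w + zCls X (-w)))) : P f := by
  classical
  obtain ⟨S, hS, -⟩ := K0.eq_sum_coeff f
  have hf' (w) : K0.coeff (-w) f = K0.coeff w f := by rw [← coeff_vee, hf]
  clear hf
  -- Induction on the size of a finite set containing the support: subtracting the symmetric pair at
  -- `w` allows `w` to be erased from it.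
  induction hn : S.card generalizing f S with
  | zero =>
    rw [Finset.card_eq_zero] at hn
    subst hn
    have : f = 0 := K0.coeff_ext fun w => by rw [hS w (by simp), map_zero]
    rw [this, ← map_zero (TorusGW.triv X t)]
    exact triv 0
  | succ n ih =>
    by_cases h0 : ∃ w ∈ S, w ≠ 0
    · obtain ⟨w, hw, hw0⟩ := h0
      have hne : -w ≠ w := fun h => hw0 (neg_eq_self.mp h)
      have hc (v) : K0.coeff v (TorusGW.triv X t (K0.coeff w f) * (zCls X w + zCls X (-w))) =
          (if w = v then K0.coeff w f else 0) + (if -w = v then K0.coeff w f else 0) := by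
        rw [mul_add, map_add, coeff_triv_mul_zCls, coeff_triv_mul_zCls]
      have h1 := ih (f - TorusGW.triv X t (K0.coeff w f) * (zCls X w + zCls X (-w))) (S.erase w)
        (fun v hv => ?_) (fun v => ?_) (by rw [Finset.card_erase_of_mem hw, hn]; rfl)
      · rw [← sub_add_cancel f (TorusGW.triv X t (K0.coeff w f) * (zCls X w + zCls X (-w)))]
        exact add _ _ h1 (pair _ _ hw0)
      · rw [map_sub, hc]
        by_cases hvw : w = v
        · subst hvw
          rw [if_pos rfl, if_neg hne, add_zero, sub_self]
        · have h2 := hS v fun h => hv (Finset.mem_erase.mpr ⟨Ne.symm hvw, h⟩)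
          rw [if_neg hvw, zero_add, h2, zero_sub, neg_eq_zero]
          -- If `v = -w` lies outside `S`, symmetry of the coefficients forces the coefficient at
          -- `w` to vanish, so the subtraction changes nothing there.
          split_ifs with h3
          · rw [← hf', h3, h2]
          · rfl
      · rw [map_sub, map_sub, hc, hc, hf']
        congr 1
        rw [add_comm]
        simp only [neg_eq_iff_eq_neg, neg_neg]
    · push Not at h0
      have : f = TorusGW.triv X t (K0.coeff 0 f) := K0.coeff_ext fun w => by
        rw [coeff_triv]
        split_ifs with h
        · rw [h]
        · exact hS w fun hw => h (h0 w hw).symm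
      rw [this]
      exact triv _

/-- The element `z^w + z^{-w} - 2`. -/
def sCls (w : Fin t → ℤ) : KTX X t := zCls X w + zCls X (-w) - 2

theorem vee_sCls (w : Fin t → ℤ) : vee X t (sCls X w) = sCls X w := by
  rw [sCls, map_sub, map_add, vee_zCls, vee_zCls, neg_neg, map_ofNat, add_comm]

theorem sCls_zero : sCls X (0 : Fin t → ℤ) = 0 := by
  rw [sCls, neg_zero, zCls_zero]; ring

/-- This is `(z^v + z^{-v})(z^w + z^{-w}) = (z^{v+w} + z^{-v-w}) + (z^{v-w} + z^{w-v})`, shifted by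
constants. With `w` a unit vector it is a two-term recursion in one coordinate. -/
theorem sCls_add (v w : Fin t → ℤ) : sCls X (v + w) + sCls X (v - w) =
    sCls X v * sCls X w + 2 * sCls X v + 2 * sCls X w := by
  simp only [sCls, sub_eq_add_neg v w, neg_add, neg_neg, zCls_add]
  ring

variable (t) in
/-- Membership of the ideal generated by the elements `x^γ + y^γ`. -/
def InGenIdeal (f : KTX X t) : Prop :=
  ∃ g ∈ Ideal.span (gen X '' {γ : Fin t → Fin 2 | γ ≠ 0}), (g : KTX X t) = f

variable {X}

theorem InGenIdeal.add {f g : KTX X t} (hf : InGenIdeal X t f) (hg : InGenIdeal X t g) :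
    InGenIdeal X t (f + g) := by
  obtain ⟨f, hf, rfl⟩ := hf
  obtain ⟨g, hg, rfl⟩ := hg
  exact ⟨f + g, add_mem hf hg, rfl⟩

theorem InGenIdeal.sub {f g : KTX X t} (hf : InGenIdeal X t f) (hg : InGenIdeal X t g) :
    InGenIdeal X t (f - g) := by
  obtain ⟨f, hf, rfl⟩ := hf
  obtain ⟨g, hg, rfl⟩ := hg
  exact ⟨f - g, sub_mem hf hg, rfl⟩

theorem InGenIdeal.mul {f g : KTX X t} (hf : vee X t f = f) (hg : InGenIdeal X t g) :
    InGenIdeal X t (f * g) := by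
  obtain ⟨g, hg, rfl⟩ := hg
  exact ⟨⟨f, hf⟩ * g, Ideal.mul_mem_left _ _ hg, rfl⟩

theorem inGenIdeal_zero : InGenIdeal X t 0 := ⟨0, zero_mem _, rfl⟩

variable (X) in
/-- The element `x^A z^B + y^A z^{-B}`. -/
def mixedCls (A B : Finset (Fin t)) : KTX X t :=
  (∏ i ∈ A, xCls X i) * zCls X (∑ i ∈ B, Pi.single i 1) +
    (∏ i ∈ A, yCls X i) * zCls X (-∑ i ∈ B, Pi.single i 1)

theorem xCls_eq (i : Fin t) : xCls X i = zCls X (Pi.single i 1) - 1 := rfl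

theorem yCls_eq (i : Fin t) : yCls X i = zCls X (-Pi.single i 1) - 1 := rfl

/-- Substitute `z_i = x_i + 1` in the first summand and `z_i⁻¹ = y_i + 1` in the second. -/
theorem mixedCls_insert {A B : Finset (Fin t)} {i : Fin t} (hA : i ∉ A) (hB : i ∉ B) :
    mixedCls X A (insert i B) = mixedCls X (insert i A) B + mixedCls X A B := by
  rw [mixedCls, mixedCls, mixedCls, Finset.prod_insert hA, Finset.prod_insert hA,
    Finset.sum_insert hB, neg_add, zCls_add, zCls_add, xCls_eq, yCls_eq]
  ring

theorem gen_indicator (A : Finset (Fin t)) :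
    (gen X (fun i => if i ∈ A then 1 else 0) : KTX X t) = mixedCls X A ∅ := by
  rw [mixedCls, Finset.sum_empty, neg_zero, zCls_zero, mul_one, mul_one, gen]
  have h (f : Fin t → KTX X t) :
      ∏ i, f i ^ ((if i ∈ A then 1 else 0 : Fin 2) : ℕ) = ∏ i ∈ A, f i := by
    rw [← Finset.prod_subset (Finset.subset_univ A) (f := fun i =>
      f i ^ ((if i ∈ A then 1 else 0 : Fin 2) : ℕ)) fun i _ hi => by simp [hi]]
    exact Finset.prod_congr rfl fun i hi => by simp [hi]
  exact congrArg₂ (· + ·) (h _) (h _)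

/-- Each index of `B` is either moved to `A` or dropped, until `B` is empty and a generator remains.
Nonemptiness of `A` is preserved and keeps `γ = 0` from appearing. -/
theorem inGenIdeal_mixedCls (B : Finset (Fin t)) : ∀ A : Finset (Fin t), A.Nonempty →
    Disjoint A B → InGenIdeal X t (mixedCls X A B) := by
  induction B using Finset.induction_on with
  | empty =>
    rintro A ⟨i, hi⟩ -
    refine ⟨_, Ideal.subset_span ⟨_, fun h => ?_, rfl⟩, gen_indicator A⟩
    simpa [hi] using congrFun h i
  | insert i B hi ih =>
    intro A hA hAB
    rw [Finset.disjoint_insert_right] at hAB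
    rw [mixedCls_insert hAB.1 hi]
    exact (ih _ (Finset.insert_nonempty _ _) (Finset.disjoint_insert_left.mpr ⟨hi, hAB.2⟩)).add
      (ih _ hA hAB.2)

/-- Removing `i` from `B` splits off a mixed element with `A = {i}`; only with `A` empty is the
constant `2` to be subtracted, and it stays with the smaller sum. -/
theorem inGenIdeal_sCls_sum (B : Finset (Fin t)) :
    InGenIdeal X t (sCls X (∑ i ∈ B, Pi.single i 1)) := by
  induction B using Finset.induction_on with
  | empty =>
    rw [Finset.sum_empty, sCls_zero]
    exact inGenIdeal_zero
  | insert i B hi ih =>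
    have h1 (B : Finset (Fin t)) :
        sCls X (∑ i ∈ B, Pi.single i 1) = mixedCls X ∅ B - 2 := by
      simp [sCls, mixedCls]
    rw [h1, mixedCls_insert (Finset.notMem_empty i) hi, add_sub_assoc, ← h1]
    exact (inGenIdeal_mixedCls B _ (Finset.insert_nonempty _ _)
      (Finset.disjoint_insert_left.mpr ⟨hi, Finset.disjoint_empty_left _⟩)).add ih

theorem int_two_step_induction {P : ℤ → Prop} (h0 : P 0) (h1 : P 1)
    (up : ∀ n, P n → P (n + 1) → P (n + 2)) (down : ∀ n, P n → P (n + 1) → P (n - 1)) (n : ℤ) :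
    P n := by
  have : P n ∧ P (n + 1) := by
    induction n using Int.induction_on with
    | zero => exact ⟨h0, h1⟩
    | succ n ih => exact ⟨ih.2, by simpa [add_assoc] using up _ ih.1 ih.2⟩
    | pred n ih => exact ⟨down _ ih.1 ih.2, by simpa using ih.1⟩
  exact this.1

/-- Coordinates outside `C` are assumed to be `0` or `1`. Enlarging `C` by `i` frees the coordinate
`i`: the recursion from `sCls_add` runs in both directions from its values at `0` and `1`. -/
theorem inGenIdeal_sCls (w : Fin t → ℤ) : InGenIdeal X t (sCls X w) := by
  have key (C : Finset (Fin t)) : ∀ w : Fin t → ℤ, (∀ i ∉ C, w i = 0 ∨ w i = 1) →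
      InGenIdeal X t (sCls X w) := by
    induction C using Finset.induction_on with
    | empty =>
      intro w hw
      have : w = ∑ i with w i = 1, Pi.single i 1 := by
        rw [Finset.sum_filter]
        conv_lhs => rw [← Finset.univ_sum_single w]
        refine Finset.sum_congr rfl fun i _ => ?_
        rcases hw i (Finset.notMem_empty i) with h | h <;> simp [h]
      rw [this]
      exact inGenIdeal_sCls_sum _
    | insert i C hi ih =>
      intro w hw
      have hi1 : InGenIdeal X t (sCls X (Pi.single i 1)) := by
        simpa using inGenIdeal_sCls_sum (X := X) {i}
      have hup (n m : ℤ) : Function.update w i (n + m) =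
          Function.update w i n + Pi.single i m := by
        ext j
        by_cases hj : j = i
        · subst hj; simp
        · simp [hj]
      have hrec (n : ℤ) : sCls X (Function.update w i (n + 1)) +
          sCls X (Function.update w i (n - 1)) =
          sCls X (Function.update w i n) * sCls X (Pi.single i 1) +
            2 * sCls X (Function.update w i n) + 2 * sCls X (Pi.single i 1) := by
        rw [sub_eq_add_neg, hup, hup, Pi.single_neg, ← sub_eq_add_neg, sCls_add]
      have hmem (n : ℤ) (h : InGenIdeal X t (sCls X (Function.update w i n))) :
          InGenIdeal X t (sCls X (Function.update w i n) * sCls X (Pi.single i 1) +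
            2 * sCls X (Function.update w i n) + 2 * sCls X (Pi.single i 1)) :=
        ((hi1.mul (vee_sCls X _)).add (h.mul (map_ofNat _ 2))).add (hi1.mul (map_ofNat _ 2))
      have hb (n : ℤ) (hn : n = 0 ∨ n = 1) :
          InGenIdeal X t (sCls X (Function.update w i n)) := ih _ fun j hj => by
        by_cases hji : j = i
        · subst hji; simpa using hn
        · rw [Function.update_of_ne hji]
          exact hw j (by simp [hji, hj])
      have := int_two_step_induction (P := fun n => InGenIdeal X t (sCls X (Function.update w i n)))
        (hb 0 (Or.inl rfl)) (hb 1 (Or.inr rfl)) (fun n h h' => by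
          have h2 := hrec (n + 1)
          rw [add_sub_cancel_right, add_assoc, one_add_one_eq_two] at h2
          rw [eq_sub_of_add_eq h2]
          exact (hmem _ h').sub h) (fun n h h' => by
          rw [eq_sub_of_add_eq' (hrec n)]
          exact (hmem _ h).sub h') (w i)
      simpa using this
  exact key Finset.univ w fun i hi => absurd (Finset.mem_univ i) hi

theorem augmentation_gen {γ : Fin t → Fin 2} (hγ : γ ≠ 0) :
    augmentation X t (gen X γ : KTX X t) = 0 := by
  obtain ⟨i, hi⟩ := Function.ne_iff.mp hγ
  have h1 : ((γ i : Fin 2) : ℕ) ≠ 0 := fun h => hi (Fin.ext h)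
  have h (f : Fin t → KTX X t) (hf : augmentation X t (f i) = 0) :
      augmentation X t (∏ i, f i ^ (γ i : ℕ)) = 0 := by
    rw [map_prod]
    exact Finset.prod_eq_zero (Finset.mem_univ i) (by rw [map_pow, hf, zero_pow h1])
  rw [gen, map_add, h, h, add_zero]
  · rw [yCls_eq, map_sub, augmentation_zCls, map_one, sub_self]
  · rw [xCls_eq, map_sub, augmentation_zCls, map_one, sub_self]

/-- For every fixed `f`, the difference of `f` and its augmentation lies in the ideal: it vanishes
for constants and is `a s_w` for `f = a (z^w + z^{-w})`. On `I_+` the difference is `f` itself. -/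
theorem span_gen : Ideal.span (gen X '' {γ : Fin t → Fin 2 | γ ≠ 0}) = IPlus X t := by
  refine le_antisymm (Ideal.span_le.mpr ?_) fun f hf => ?_
  · rintro _ ⟨γ, hγ, rfl⟩
    exact augmentation_gen hγ
  · have h0 : augmentation X t (f : KTX X t) = 0 := hf
    have : InGenIdeal X t ((f : KTX X t) - triv X t (augmentation X t (f : KTX X t))) := by
      refine vee_fixed_induction (P := fun f => InGenIdeal X t (f - triv X t (augmentation X t f)))
        (f : KTX X t) f.2 (fun a => ?_) (fun a b ha hb => ?_) (fun a w _ => ?_)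
      · rw [augmentation_triv, sub_self]
        exact inGenIdeal_zero
      · rw [map_add, map_add, add_sub_add_comm]
        exact ha.add hb
      · rw [map_mul, augmentation_triv, map_add, augmentation_zCls, augmentation_zCls, map_mul,
          map_add, map_one, ← mul_sub]
        have h2 := (inGenIdeal_sCls (X := X) w).mul (vee_triv X t a)
        rwa [sCls, ← one_add_one_eq_two] at h2
    rw [h0, map_zero, sub_zero] at this
    obtain ⟨g, hg, h⟩ := this
    rwa [← Subtype.ext h]

theorem finite_gens : (gen X '' {γ : Fin t → Fin 2 | γ ≠ 0}).Finite := Set.toFinite _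

theorem ncard_nonzero : {γ : Fin t → Fin 2 | γ ≠ 0}.ncard = 2 ^ t - 1 := by
  have : {γ : Fin t → Fin 2 | γ ≠ 0} = {0}ᶜ := rfl
  rw [this, Set.ncard_compl, Set.ncard_singleton]
  simp

/-- Equal generators have equal supports, since for each `γ` there is an evaluation in `ℚ` that does
not kill its generator but kills that of any `δ` not supported inside `γ`. -/
theorem gen_injOn [Nonempty X] : Set.InjOn (gen X) {γ : Fin t → Fin 2 | γ ≠ 0} := by
  obtain ⟨rk⟩ := exists_rank (X := X)
  have key (γ δ : Fin t → Fin 2) (hγ : γ ≠ 0) (h : gen X γ = gen X δ) : ∀ i, γ i = 0 → δ i = 0 := by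
    intro i₀ hi₀
    by_contra hδ
    -- With `z_i = 2` on the support of `γ` and `z_i = 1` elsewhere, `x_i` becomes `1` and `y_i`
    -- becomes `-1/2` on the support, and both vanish off it. The generator of `γ` becomes `1 +
    -- (-1/2)^n`, `n` the size of the support, which is not zero.
    let u : Fin t → ℚˣ := fun i => if γ i = 0 then 1 else Units.mk0 2 two_ne_zero
    let θ : AddMonoidAlgebra (KX X) (Fin t → ℤ) →+* ℚ :=
      AddMonoidAlgebra.liftNCRingHom ((Int.castRingHom ℚ).comp rk) (unitMonomial u)
        fun _ _ => Commute.all _ _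
    have hθ (w a) : θ (.single w a) = (rk a : ℚ) * unitMonomial u (.ofAdd w) :=
      AddMonoidAlgebra.liftNC_single _ _ _ _
    let ev : KTX X t →+* ℚ := θ.comp (K0.character X (Fin t → ℤ))
    have hz (w : Fin t → ℤ) : ev (zCls X w) = unitMonomial u (.ofAdd w) := by
      change θ (K0.character X _ (zCls X w)) = _
      rw [zCls, K0.character_lineBundle, hθ]
      simp
    have hx (i) : ev (xCls X i) = if γ i = 0 then 0 else 1 := by
      rw [xCls_eq, map_sub, hz, map_one, unitMonomial_single]
      split_ifs with h <;> simp [u, h]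
      norm_num
    have hy (i) : ev (yCls X i) = if γ i = 0 then 0 else -1 / 2 := by
      rw [yCls_eq, map_sub, hz, map_one, ← Pi.single_neg, unitMonomial_single]
      split_ifs with h <;> simp [u, h]
      norm_num
    have h1 := congrArg (fun f : RPlus X t => ev (f : KTX X t)) h
    simp only [gen, map_add, map_prod, map_pow, hx, hy] at h1
    have hz0 (c : ℚ) : ∏ i, (if γ i = 0 then 0 else c) ^ (δ i : ℕ) = 0 :=
      Finset.prod_eq_zero (Finset.mem_univ i₀) (by
        rw [if_pos hi₀, zero_pow fun h => hδ (Fin.ext h)])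
    rw [hz0, hz0, add_zero] at h1
    have hprod (c : ℚ) : ∏ i, (if γ i = 0 then 0 else c) ^ (γ i : ℕ) = ∏ i, c ^ (γ i : ℕ) :=
      Finset.prod_congr rfl fun i _ => by
        split_ifs with h
        · simp [h]
        · rfl
    rw [hprod, hprod, Finset.prod_pow_eq_pow_sum, Finset.prod_pow_eq_pow_sum, one_pow] at h1
    have h2 : ∑ i, (γ i : ℕ) ≠ 0 := fun h => hγ (funext fun i => Fin.ext
      (Finset.sum_eq_zero_iff.mp h i (Finset.mem_univ i)))
    have h3 : |(-1 / 2 : ℚ) ^ ∑ i, (γ i : ℕ)| < 1 := by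
      rw [abs_pow]
      exact pow_lt_one₀ (abs_nonneg _) (by norm_num [abs_div]) h2
    rw [abs_lt] at h3
    linarith
  intro γ hγ δ hδ h
  ext i
  have h1 := key γ δ hγ h i
  have h2 := key δ γ hδ h.symm i
  have h3 := (γ i).isLt
  have h4 := (δ i).isLt
  simp only [Fin.ext_iff, Fin.val_zero] at h1 h2
  omega

/-- Compare coefficients: the form pairs the parts of opposite weights perfectly, and dual bundles
without weights have equal classes by assumption. -/
theorem vee_cls (h : ∀ (E F : Bundle X Unit) (c : Form E.mod F.mod), IsPerfect E F c →
    K0.cls E = K0.cls F) (E F : Bundle X (Fin t → ℤ)) (c : Form E.mod F.mod)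
    (hc : IsPerfect E F c) : vee X t (K0.cls E) = K0.cls F :=
  K0.coeff_ext fun w => by
    rw [coeff_vee, K0.coeff_cls, K0.coeff_cls, hc.partCls_eq h, neg_neg]

end InvariantPart

/-! ### Formal properties of the Grothendieck-Witt ring. -/

section GWBasics

variable {X : Scheme.{u}} {Λ Λ' : Type} [AddCommGroup Λ] [AddCommGroup Λ']

/-- The class of a symmetric bundle. -/
def GW0.cls (M : SymBundle X Λ) : GW0 X Λ := Ideal.Quotient.mk _ (.X M)

theorem GW0.mk_eq_zero {r : MvPolynomial (SymBundle X Λ) ℤ} (h : GW0Rel X Λ r) :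
    (Ideal.Quotient.mk _ r : GW0 X Λ) = 0 :=
  Ideal.Quotient.eq_zero_iff_mem.mpr (Ideal.subset_span h)

theorem GW0.cls_sum {M₁ M₂ M : SymBundle X Λ} (h : IsOrthogonalSum M₁ M₂ M) :
    GW0.cls M = GW0.cls M₁ + GW0.cls M₂ := by
  have := GW0.mk_eq_zero (.sum h)
  rw [map_sub, map_add, sub_eq_zero] at this
  exact this

theorem GW0.cls_metabolic {L Q : Bundle X Λ} {c : Form L.mod Q.mod} {M H : SymBundle X Λ}
    (hM : IsMetabolic L Q c M) (hH : IsHyperbolic L Q c H) : GW0.cls M = GW0.cls H := by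
  have := GW0.mk_eq_zero (.metabolic hM hH)
  rw [map_sub, sub_eq_zero] at this
  exact this

theorem GW0.cls_tensor {M₁ M₂ M : SymBundle X Λ} (h : IsSymTensor M₁ M₂ M) :
    GW0.cls M = GW0.cls M₁ * GW0.cls M₂ := by
  have := GW0.mk_eq_zero (.tensor h)
  rw [map_sub, map_mul, sub_eq_zero] at this
  exact this

theorem GW0.map_cls (f : Λ →+ Λ') (M : SymBundle X Λ) :
    GW0.map X f (GW0.cls M) = GW0.cls (M.push f) := by
  simp [GW0.map, GW0.cls]

theorem GW0.forget_cls (M : SymBundle X Λ) : GW0.forget X Λ (GW0.cls M) = K0.cls M.bundle := by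
  simp [GW0.forget, GW0.cls]

theorem GW0.induction_on {P : GW0 X Λ → Prop} (a : GW0 X Λ) (cls : ∀ M, P (GW0.cls M))
    (int : ∀ n : ℤ, P n) (add : ∀ a b, P a → P b → P (a + b)) (mul : ∀ a b, P a → P b → P (a * b)) :
    P a := by
  obtain ⟨p, rfl⟩ := Ideal.Quotient.mk_surjective a
  induction p using MvPolynomial.induction_on with
  | C n => simpa using int n
  | add p q hp hq => rw [map_add]; exact add _ _ hp hq
  | mul_X p E hp => rw [map_mul]; exact mul _ _ hp (cls E)

theorem GW0.ringHom_ext {R : Type*} [CommRing R] {f g : GW0 X Λ →+* R}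
    (h : ∀ M, f (GW0.cls M) = g (GW0.cls M)) : f = g := by
  refine RingHom.ext fun a => ?_
  induction a using GW0.induction_on with
  | cls E => exact h E
  | int n => simp
  | add a b ha hb => rw [map_add, map_add, ha, hb]
  | mul a b ha hb => rw [map_mul, map_mul, ha, hb]

theorem GW0.forget_map (f : Λ →+ Λ') (a : GW0 X Λ) :
    GW0.forget X Λ' (GW0.map X f a) = K0.map X f (GW0.forget X Λ a) := by
  have : (GW0.forget X Λ').comp (GW0.map X f) = (K0.map X f).comp (GW0.forget X Λ) :=
    GW0.ringHom_ext fun M => by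
      change GW0.forget X Λ' (GW0.map X f (GW0.cls M)) = K0.map X f (GW0.forget X Λ (GW0.cls M))
      rw [GW0.map_cls, GW0.forget_cls, GW0.forget_cls, K0.map_cls]
      rfl
  exact RingHom.congr_fun this a

theorem GW0.map_map {Λ'' : Type} [AddCommGroup Λ''] (f : Λ →+ Λ') (g : Λ' →+ Λ'')
    (a : GW0 X Λ) : GW0.map X g (GW0.map X f a) = GW0.map X (g.comp f) a := by
  have : (GW0.map X g).comp (GW0.map X f) = GW0.map X (g.comp f) :=
    GW0.ringHom_ext fun M => by
      change GW0.map X g (GW0.map X f (GW0.cls M)) = GW0.map X (g.comp f) (GW0.cls M)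
      rw [GW0.map_cls, GW0.map_cls, GW0.map_cls]
      exact congrArg GW0.cls (SymBundle.eq_of (Bundle.push_push f g M.bundle) HEq.rfl)
  exact RingHom.congr_fun this a

theorem GW0.map_unit (f : Unit →+ Unit) (a : GWX X) : GW0.map X f a = a := by
  have : GW0.map X f = RingHom.id _ := GW0.ringHom_ext fun M => by
    rw [GW0.map_cls]
    refine congrArg GW0.cls (SymBundle.eq_of ?_ HEq.rfl)
    change M.bundle.push f = M.bundle
    rw [M.bundle.eq_place, push_place]
  exact RingHom.congr_fun this a

end GWBasics

/-! ### Direct sums and hyperbolic bundles. -/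

section DirectSums

open Limits

variable {X : Scheme.{u}} {Λ : Type} [AddCommGroup Λ] {M N K L M' N' K' L' : X.Modules}
  {U V : X.Opens}

theorem IsEquivariant.add {E F : Bundle X Λ} {φ ψ : E.mod ⟶ F.mod} (h : IsEquivariant E F φ)
    (h' : IsEquivariant E F ψ) : IsEquivariant E F (φ + ψ) := fun w => by
  rw [Preadditive.comp_add, Preadditive.add_comp, h w, h' w]

theorem IsEquivariant.hasWeight {E F : Bundle X Λ} {φ : E.mod ⟶ F.mod} (h : IsEquivariant E F φ)
    {w : Λ} {s : Γ(E.mod, U)} (hs : E.HasWeight w s) : F.HasWeight w (φ.app U s) := by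
  rw [Bundle.HasWeight, ← comp_app_apply, ← h w, comp_app_apply]
  exact congrArg _ hs

theorem fst_inl_apply (x : Γ(M, U)) :
    (biprod.fst : M ⊞ N ⟶ M).app U ((biprod.inl : M ⟶ M ⊞ N).app U x) = x := by
  rw [← comp_app_apply, biprod.inl_fst, id_app_apply]

theorem snd_inr_apply (x : Γ(N, U)) :
    (biprod.snd : M ⊞ N ⟶ N).app U ((biprod.inr : N ⟶ M ⊞ N).app U x) = x := by
  rw [← comp_app_apply, biprod.inr_snd, id_app_apply]

theorem snd_inl_apply (x : Γ(M, U)) :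
    (biprod.snd : M ⊞ N ⟶ N).app U ((biprod.inl : M ⟶ M ⊞ N).app U x) = 0 := by
  rw [← comp_app_apply, biprod.inl_snd, zero_app_apply]

theorem fst_inr_apply (x : Γ(N, U)) :
    (biprod.fst : M ⊞ N ⟶ M).app U ((biprod.inr : N ⟶ M ⊞ N).app U x) = 0 := by
  rw [← comp_app_apply, biprod.inr_fst, zero_app_apply]

theorem fst_inl_add_inr_apply (x : Γ(M, U)) (y : Γ(N, U)) :
    (biprod.fst : M ⊞ N ⟶ M).app U ((biprod.inl : M ⟶ M ⊞ N).app U x +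
      (biprod.inr : N ⟶ M ⊞ N).app U y) = x := by
  rw [map_add, fst_inl_apply, fst_inr_apply, add_zero]

theorem snd_inl_add_inr_apply (x : Γ(M, U)) (y : Γ(N, U)) :
    (biprod.snd : M ⊞ N ⟶ N).app U ((biprod.inl : M ⟶ M ⊞ N).app U x +
      (biprod.inr : N ⟶ M ⊞ N).app U y) = y := by
  rw [map_add, snd_inl_apply, snd_inr_apply, zero_add]

theorem inl_fst_add_inr_snd_apply (z : Γ(M ⊞ N, U)) :
    (biprod.inl : M ⟶ M ⊞ N).app U ((biprod.fst : M ⊞ N ⟶ M).app U z) +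
      (biprod.inr : N ⟶ M ⊞ N).app U ((biprod.snd : M ⊞ N ⟶ N).app U z) = z := by
  rw [← comp_app_apply, ← comp_app_apply, ← add_app_apply, biprod.total, id_app_apply]

theorem biprod_section_ext {z z' : Γ(M ⊞ N, U)}
    (h : (biprod.fst : M ⊞ N ⟶ M).app U z = (biprod.fst : M ⊞ N ⟶ M).app U z')
    (h' : (biprod.snd : M ⊞ N ⟶ N).app U z = (biprod.snd : M ⊞ N ⟶ N).app U z') : z = z' := by
  rw [← inl_fst_add_inr_snd_apply z, h, h', inl_fst_add_inr_snd_apply]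

theorem IsVB.biprod (hM : IsVB M) (hN : IsVB N) : IsVB (M ⊞ N) :=
  hM.of_sum hN biprod.inl biprod.inr biprod.fst biprod.snd biprod.total

/-- The direct sum of equivariant bundles. -/
def dsum (E F : Bundle X Λ) : Bundle X Λ where
  mod := E.mod ⊞ F.mod
  quasicoherent := (E.isVB.biprod F.isVB).1
  finite := (E.isVB.biprod F.isVB).2
  projective := (E.isVB.biprod F.isVB).3
  proj := E.proj.mapRange (fun p => biprod.fst ≫ p ≫ biprod.inl) (by simp) +
    F.proj.mapRange (fun p => biprod.snd ≫ p ≫ biprod.inr) (by simp)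
  proj_idem w := by
    have h1 := E.proj_idem w
    have h2 := F.proj_idem w
    simp only [Finsupp.add_apply, Finsupp.mapRange_apply, Preadditive.add_comp,
      Preadditive.comp_add, Category.assoc, biprod.inl_fst_assoc, biprod.inl_snd_assoc,
      biprod.inr_fst_assoc, biprod.inr_snd_assoc, zero_comp, comp_zero, add_zero, zero_add]
    rw [← Category.assoc (E.proj w), h1, ← Category.assoc (F.proj w), h2]
  proj_orth v w h := by
    have h1 := E.proj_orth v w h
    have h2 := F.proj_orth v w h
    simp only [Finsupp.add_apply, Finsupp.mapRange_apply, Preadditive.add_comp,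
      Preadditive.comp_add, Category.assoc, biprod.inl_fst_assoc, biprod.inl_snd_assoc,
      biprod.inr_fst_assoc, biprod.inr_snd_assoc, zero_comp, comp_zero, add_zero, zero_add]
    rw [← Category.assoc (E.proj v), h1, ← Category.assoc (F.proj v), h2]
    simp
  proj_sum := by
    rw [Finsupp.sum_add_index' (fun _ => rfl) (fun _ _ _ => rfl),
      Finsupp.sum_mapRange_index (fun _ => rfl), Finsupp.sum_mapRange_index (fun _ => rfl),
      Finsupp.sum, Finsupp.sum, ← Preadditive.comp_sum, ← Preadditive.comp_sum,
      ← Preadditive.sum_comp, ← Preadditive.sum_comp, E.sum_proj subset_rfl,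
      F.sum_proj subset_rfl, Category.id_comp, Category.id_comp, biprod.total]

theorem dsum_proj (E F : Bundle X Λ) (w : Λ) : (dsum E F).proj w =
    biprod.fst ≫ E.proj w ≫ biprod.inl + biprod.snd ≫ F.proj w ≫ biprod.inr :=
  (Finsupp.add_apply _ _ _).trans (congrArg₂ (· + ·)
    (Finsupp.mapRange_apply (hf := by rw [zero_comp, comp_zero]; rfl))
    (Finsupp.mapRange_apply (hf := by rw [zero_comp, comp_zero]; rfl)))

theorem isEquivariant_inl (E F : Bundle X Λ) : IsEquivariant E (dsum E F) biprod.inl := fun w => by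
  rw [dsum_proj]
  have : E.proj w ≫ (biprod.inl : _ ⟶ E.mod ⊞ F.mod) = biprod.inl ≫ (biprod.fst ≫ E.proj w ≫ biprod.inl +
      biprod.snd ≫ F.proj w ≫ biprod.inr) := by
    simp
  exact this

theorem isEquivariant_inr (E F : Bundle X Λ) : IsEquivariant F (dsum E F) biprod.inr := fun w => by
  rw [dsum_proj]
  have : F.proj w ≫ (biprod.inr : _ ⟶ E.mod ⊞ F.mod) = biprod.inr ≫ (biprod.fst ≫ E.proj w ≫ biprod.inl +
      biprod.snd ≫ F.proj w ≫ biprod.inr) := by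
    simp
  exact this

theorem isEquivariant_fst (E F : Bundle X Λ) : IsEquivariant (dsum E F) E biprod.fst := fun w => by
  rw [dsum_proj]
  have : (biprod.fst ≫ E.proj w ≫ biprod.inl + biprod.snd ≫ F.proj w ≫ biprod.inr) ≫
      (biprod.fst : E.mod ⊞ F.mod ⟶ _) = biprod.fst ≫ E.proj w := by
    simp
  exact this

theorem isEquivariant_snd (E F : Bundle X Λ) : IsEquivariant (dsum E F) F biprod.snd := fun w => by
  rw [dsum_proj]
  have : (biprod.fst ≫ E.proj w ≫ biprod.inl + biprod.snd ≫ F.proj w ≫ biprod.inr) ≫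
      (biprod.snd : E.mod ⊞ F.mod ⟶ _) = biprod.snd ≫ F.proj w := by
    simp
  exact this

theorem isDirectSum_dsum (E F : Bundle X Λ) :
    IsDirectSum E F (dsum E F) biprod.inl biprod.inr :=
  ⟨isEquivariant_inl E F, isEquivariant_inr E F, biprod.fst, biprod.snd, isEquivariant_fst E F,
    isEquivariant_snd E F, biprod.inl_fst, biprod.inr_snd, biprod.inl_snd, biprod.inr_fst,
    biprod.total⟩

/-- The sum of bilinear forms. -/
def Form.add (c c' : Form M N) : Form M N where
  app U := c.app U + c'.app U
  map_app h x y := by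
    rw [LinearMap.add_apply, LinearMap.add_apply, map_add, c.map_app, c'.map_app,
      LinearMap.add_apply, LinearMap.add_apply]

/-- The hyperbolic form of a bilinear form. -/
def Form.hyp (c : Form M N) : Form (M ⊞ N) (M ⊞ N) :=
  (c.comp biprod.fst biprod.snd).add (c.comp biprod.fst biprod.snd).flip

theorem Form.hyp_app (c : Form M N) (x y : Γ(M ⊞ N, U)) :
    c.hyp.app U x y = c.app U ((biprod.fst : M ⊞ N ⟶ M).app U x) ((biprod.snd : M ⊞ N ⟶ N).app U y) +
      c.app U ((biprod.fst : M ⊞ N ⟶ M).app U y) ((biprod.snd : M ⊞ N ⟶ N).app U x) := rfl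

theorem Form.hyp_inl_left (c : Form M N) (x : Γ(M, U)) (z : Γ(M ⊞ N, U)) :
    c.hyp.app U ((biprod.inl : M ⟶ M ⊞ N).app U x) z =
      c.app U x ((biprod.snd : M ⊞ N ⟶ N).app U z) := by
  rw [hyp_app, fst_inl_apply, snd_inl_apply, map_zero, add_zero]

theorem Form.hyp_inl_inl (c : Form M N) (x x' : Γ(M, U)) :
    c.hyp.app U ((biprod.inl : M ⟶ M ⊞ N).app U x) ((biprod.inl : M ⟶ M ⊞ N).app U x') = 0 := by
  rw [hyp_inl_left, snd_inl_apply, map_zero]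

theorem Form.hyp_inl_inr (c : Form M N) (x : Γ(M, U)) (y : Γ(N, U)) :
    c.hyp.app U ((biprod.inl : M ⟶ M ⊞ N).app U x) ((biprod.inr : N ⟶ M ⊞ N).app U y) =
      c.app U x y := by
  rw [hyp_inl_left, snd_inr_apply]

theorem Form.hyp_inr_inr (c : Form M N) (y y' : Γ(N, U)) :
    c.hyp.app U ((biprod.inr : N ⟶ M ⊞ N).app U y) ((biprod.inr : N ⟶ M ⊞ N).app U y') = 0 := by
  rw [hyp_app, fst_inr_apply, fst_inr_apply, map_zero, LinearMap.zero_apply, LinearMap.zero_apply,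
    add_zero]

/-- The orthogonal sum of bilinear forms. -/
def Form.dsum (c : Form M N) (c' : Form M' N') : Form (M ⊞ M') (N ⊞ N') :=
  (c.comp biprod.fst biprod.fst).add (c'.comp biprod.snd biprod.snd)

theorem Form.dsum_app (c : Form M N) (c' : Form M' N') (x : Γ(M ⊞ M', U)) (y : Γ(N ⊞ N', U)) :
    (c.dsum c').app U x y =
      c.app U ((biprod.fst : M ⊞ M' ⟶ M).app U x) ((biprod.fst : N ⊞ N' ⟶ N).app U y) +
      c'.app U ((biprod.snd : M ⊞ M' ⟶ M').app U x) ((biprod.snd : N ⊞ N' ⟶ N').app U y) := rfl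

theorem bijective_dsum {c : Form M N} {c' : Form M' N'} (hc : Function.Bijective (c.app U))
    (hc' : Function.Bijective (c'.app U)) : Function.Bijective ((c.dsum c').app U) := by
  refine ⟨fun x y hxy => biprod_section_ext (hc.1 (LinearMap.ext fun z => ?_))
    (hc'.1 (LinearMap.ext fun z => ?_)), fun φ => ?_⟩
  · have := LinearMap.congr_fun hxy ((biprod.inl : N ⟶ N ⊞ N').app U z)
    simpa only [Form.dsum_app, fst_inl_apply, snd_inl_apply, map_zero, add_zero] using this
  · have := LinearMap.congr_fun hxy ((biprod.inr : N' ⟶ N ⊞ N').app U z)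
    simpa only [Form.dsum_app, fst_inr_apply, snd_inr_apply, map_zero, zero_add] using this
  · obtain ⟨x, hx⟩ := hc.2 (φ ∘ₗ lapp (biprod.inl : N ⟶ N ⊞ N') U)
    obtain ⟨y, hy⟩ := hc'.2 (φ ∘ₗ lapp (biprod.inr : N' ⟶ N ⊞ N') U)
    refine ⟨(biprod.inl : M ⟶ M ⊞ M').app U x + (biprod.inr : M' ⟶ M ⊞ M').app U y,
      LinearMap.ext fun z => ?_⟩
    rw [Form.dsum_app, fst_inl_add_inr_apply, snd_inl_add_inr_apply, hx, hy, LinearMap.comp_apply,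
      LinearMap.comp_apply, ← map_add, lapp_apply, lapp_apply, inl_fst_add_inr_snd_apply]

theorem IsPerfect.dsum {E F E' F' : Bundle X Λ} {c : Form E.mod F.mod} {c' : Form E'.mod F'.mod}
    (hc : IsPerfect E F c) (hc' : IsPerfect E' F' c') :
    IsPerfect (dsum E E') (dsum F F') (c.dsum c') := by
  refine ⟨fun U hU => ⟨bijective_dsum (hc.1 U hU).1 (hc'.1 U hU).1,
    bijective_dsum (c := c.flip) (c' := c'.flip) (hc.1 U hU).2 (hc'.1 U hU).2⟩,
    fun U v w x y hx hy h => ?_⟩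
  exact (congrArg₂ (· + ·)
    (hc.2 U v w _ _ ((isEquivariant_fst E E').hasWeight hx) ((isEquivariant_fst F F').hasWeight hy)
      h)
    (hc'.2 U v w _ _ ((isEquivariant_snd E E').hasWeight hx)
      ((isEquivariant_snd F F').hasWeight hy) h)).trans (add_zero _)

/-- The hyperbolic bundle of a perfect pairing. -/
def hypSym (L Q : Bundle X Λ) (c : Form L.mod Q.mod) (hc : IsPerfect L Q c) : SymBundle X Λ where
  bundle := dsum L Q
  form := c.hyp
  perfect := by
    refine ⟨fun U hU => isPerfPair_hyperbolic (hc.1 U hU) (lapp biprod.inl U) (lapp biprod.inr U)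
      (lapp biprod.fst U) (lapp biprod.snd U) fst_inl_apply snd_inr_apply snd_inl_apply
      fst_inr_apply inl_fst_add_inr_snd_apply c.hyp_app, fun U v w x y hx hy h => ?_⟩
    exact (congrArg₂ (· + ·)
      (hc.2 U v w _ _ ((isEquivariant_fst L Q).hasWeight hx)
        ((isEquivariant_snd L Q).hasWeight hy) h)
      (hc.2 U w v _ _ ((isEquivariant_fst L Q).hasWeight hy)
        ((isEquivariant_snd L Q).hasWeight hx) (by rwa [add_comm]))).trans (add_zero _)
  symm U x y := (c.hyp_app x y).trans ((add_comm _ _).trans (c.hyp_app y x).symm)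

theorem isHyperbolic_hypSym {L Q : Bundle X Λ} {c : Form L.mod Q.mod} (hc : IsPerfect L Q c) :
    IsHyperbolic L Q c (hypSym L Q c hc) := by
  exact ⟨hc, biprod.inl, biprod.inr, isDirectSum_dsum L Q, fun U =>
    ⟨c.hyp_inl_inl, c.hyp_inr_inr, c.hyp_inl_inr⟩⟩

theorem GW0.cls_eq_hypSym {L Q : Bundle X Λ} {c : Form L.mod Q.mod} {M : SymBundle X Λ}
    (h : IsMetabolic L Q c M) : GW0.cls M = GW0.cls (hypSym L Q c h.1) :=
  GW0.cls_metabolic h (isHyperbolic_hypSym h.1)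

/-- A hyperbolic bundle is metabolic for each of its Lagrangians, not only for the evident one. Both
isomorphism invariance and additivity of the hyperbolic class are obtained by exhibiting a suitable
Lagrangian. -/
theorem cls_hypSym_eq {L Q S T : Bundle X Λ} {c : Form L.mod Q.mod} {d : Form S.mod T.mod}
    (hc : IsPerfect L Q c) (hd : IsPerfect S T d) {i : L.mod ⟶ S.mod ⊞ T.mod}
    {q : S.mod ⊞ T.mod ⟶ Q.mod} (hi : IsEquivariant L (dsum S T) i)
    (hq : IsEquivariant (dsum S T) Q q) (h : IsExactSeq i q)
    (h' : ∀ (U : X.Opens) x z, d.hyp.app U (i.app U x) z = c.app U x (q.app U z)) :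
    GW0.cls (hypSym S T d hd) = GW0.cls (hypSym L Q c hc) :=
  GW0.cls_eq_hypSym ⟨hc, i, q, ⟨hi, hq, h.1, h.2, h.3⟩, h'⟩

/-- The hyperbolic bundle with `M` in weight `v` and its dual `N` in weight `w = -v`. -/
def hypPlace {v w : Λ} (hvw : v + w = 0) (hM : IsVB M) (hN : IsVB N) (c : Form M N)
    (hc : ∀ U, IsAffineOpen U → (c.app U).IsPerfPair) : SymBundle X Λ :=
  hypSym (place v M hM) (place w N hN) c (isPerfect_place hM hN hc v w hvw)

theorem isPerfect_evalForm (w : Λ) (hM : IsVB M) :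
    IsPerfect (place w M hM) (place (-w) (dual M) hM.dual) (evalForm M) :=
  isPerfect_place hM hM.dual (fun _ hU => isPerfPair_evalForm hM hU) w (-w) (add_neg_cancel w)

/-- The hyperbolic bundle of a vector bundle, placed in weight `w`. -/
def hypDual (w : Λ) (hM : IsVB M) : SymBundle X Λ :=
  hypPlace (add_neg_cancel w) hM hM.dual (evalForm M) fun _ hU => isPerfPair_evalForm hM hU

theorem isExactSeq_biprod (e : M ≅ M') (f : N' ≅ N) :
    IsExactSeq (e.hom ≫ biprod.inl : M ⟶ M' ⊞ N') (biprod.snd ≫ f.hom) := by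
  have hri (U : X.Opens) (x : Γ(M, U)) : e.inv.app U (e.hom.app U x) = x := by
    rw [← comp_app_apply, e.hom_inv_id, id_app_apply]
  have hir (U : X.Opens) (x : Γ(M', U)) : e.hom.app U (e.inv.app U x) = x := by
    rw [← comp_app_apply, e.inv_hom_id, id_app_apply]
  have hrf (U : X.Opens) (x : Γ(N', U)) : f.inv.app U (f.hom.app U x) = x := by
    rw [← comp_app_apply, f.hom_inv_id, id_app_apply]
  have hfr (U : X.Opens) (x : Γ(N, U)) : f.hom.app U (f.inv.app U x) = x := by
    rw [← comp_app_apply, f.inv_hom_id, id_app_apply]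
  refine ⟨fun U _ => ?_, fun U _ z => ⟨fun hz => ⟨e.inv.app U ((biprod.fst : M' ⊞ N' ⟶ M').app U z),
    ?_⟩, ?_⟩, fun U _ y => ⟨(biprod.inr : N' ⟶ M' ⊞ N').app U (f.inv.app U y), ?_⟩⟩
  · refine Function.LeftInverse.injective
      (g := fun z => e.inv.app U ((biprod.fst : M' ⊞ N' ⟶ M').app U z)) fun x => ?_
    beta_reduce
    rw [comp_app_apply, fst_inl_apply, hri]
  · rw [comp_app_apply] at hz
    rw [comp_app_apply, hir]
    refine biprod_section_ext (fst_inl_apply _) ?_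
    rw [snd_inl_apply, ← hrf U ((biprod.snd : M' ⊞ N' ⟶ N').app U z), hz, map_zero]
  · rintro ⟨x, rfl⟩
    rw [comp_app_apply, comp_app_apply, snd_inl_apply, map_zero]
  · rw [comp_app_apply, snd_inr_apply, hfr]

/-- Perfectness turns `M ≅ M'` into a compatible isomorphism between the second factors, and `M`
becomes a Lagrangian of `M' ⊕ N'` with quotient `N`. So the class does not depend on the model of
the dual. -/
theorem cls_hypPlace_eq_of_iso {v w : Λ} (hvw : v + w = 0) {hM : IsVB M} {hN : IsVB N}
    {c : Form M N} {hc : ∀ U, IsAffineOpen U → (c.app U).IsPerfPair} {hM' : IsVB M'} {hN' : IsVB N'}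
    {c' : Form M' N'} {hc' : ∀ U, IsAffineOpen U → (c'.app U).IsPerfPair} (e : M ≅ M') :
    GW0.cls (hypPlace hvw hM hN c hc) = GW0.cls (hypPlace hvw hM' hN' c' hc') := by
  have hc'' (U) (hU : IsAffineOpen U) : ((c'.comp e.hom (𝟙 N')).app U).IsPerfPair := by
    have hri (x : Γ(M, U)) : e.inv.app U (e.hom.app U x) = x := by
      rw [← comp_app_apply, e.hom_inv_id, id_app_apply]
    have hir (x : Γ(M', U)) : e.hom.app U (e.inv.app U x) = x := by
      rw [← comp_app_apply, e.inv_hom_id, id_app_apply]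
    refine isPerfPair_of_retract (hc' U hU) (lapp e.hom U) (lapp e.inv U) hri (lapp (𝟙 N') U)
      (lapp (𝟙 N') U) (fun x => ?_) (fun x y => ?_) fun x y => rfl
    · simp
    · simp only [lapp_apply]
      rw [hir, id_app_apply, id_app_apply]
  obtain ⟨f, hf⟩ := exists_iso_of_isPerfPair hM (c'.comp e.hom (𝟙 N')) c hc'' hc
  symm
  refine cls_hypSym_eq (L := place v M hM) (Q := place w N hN) (isPerfect_place hM hN hc v w hvw)
    (isPerfect_place hM' hN' hc' v w hvw) (i := e.hom ≫ biprod.inl) (q := biprod.snd ≫ f.hom)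
    ((isEquivariant_place v hM hM' e.hom).comp (isEquivariant_inl _ _))
    ((isEquivariant_snd _ _).comp (isEquivariant_place w hN' hN f.hom)) (isExactSeq_biprod e f)
    fun U x m => ?_
  have key (x : Γ(M, U)) (z : Γ(M' ⊞ N', U)) : c'.hyp.app U ((e.hom ≫ biprod.inl : M ⟶ M' ⊞ N').app U x) z =
      c.app U x ((biprod.snd ≫ f.hom : M' ⊞ N' ⟶ N).app U z) := by
    rw [comp_app_apply, c'.hyp_inl_left, comp_app_apply, hf, Form.comp_app, id_app_apply]
  exact key x m

end DirectSums

/-! ### Interchange of summands in a sum of four objects. -/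

section Interchange

open Limits

variable {C : Type*} [Category C] [Preadditive C] [HasBinaryBiproducts C] (E F E' F' : C)

/-- The inclusion of the first and last summands in a sum of sums. -/
def outer : E ⊞ F ⟶ (E ⊞ F') ⊞ (F ⊞ E') :=
  biprod.lift (biprod.fst ≫ biprod.inl) (biprod.snd ≫ biprod.inl)

/-- The inclusion of the middle summands in a sum of sums, interchanging them. -/
def inner : E' ⊞ F' ⟶ (E ⊞ F') ⊞ (F ⊞ E') :=
  biprod.lift (biprod.snd ≫ biprod.inr) (biprod.fst ≫ biprod.inr)

/-- The projection to the outer summands. -/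
def outerProj : (E ⊞ F') ⊞ (F ⊞ E') ⟶ E ⊞ F :=
  biprod.lift (biprod.fst ≫ biprod.fst) (biprod.snd ≫ biprod.fst)

/-- The projection to the inner summands. -/
def innerProj : (E ⊞ F') ⊞ (F ⊞ E') ⟶ E' ⊞ F' :=
  biprod.lift (biprod.snd ≫ biprod.snd) (biprod.fst ≫ biprod.snd)

theorem outer_outerProj : outer E F E' F' ≫ outerProj E F E' F' = 𝟙 _ := by
  unfold outer outerProj
  ext <;> simp

theorem inner_innerProj : inner E F E' F' ≫ innerProj E F E' F' = 𝟙 _ := by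
  unfold inner innerProj
  ext <;> simp

theorem outer_innerProj : outer E F E' F' ≫ innerProj E F E' F' = 0 := by
  unfold outer innerProj
  ext <;> simp

theorem inner_outerProj : inner E F E' F' ≫ outerProj E F E' F' = 0 := by
  unfold inner outerProj
  ext <;> simp

theorem outerProj_outer_add : outerProj E F E' F' ≫ outer E F E' F' +
    innerProj E F E' F' ≫ inner E F E' F' = 𝟙 _ := by
  unfold inner outerProj outer innerProj
  ext <;> simp

end Interchange

/-! ### Additivity of the hyperbolic class in exact sequences. -/

section HyperbolicAdditive

open Limits

variable {X : Scheme.{u}} {Λ : Type} [AddCommGroup Λ] {M N K L M' N' K' L' : X.Modules}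
  {U V : X.Opens}

theorem IsEquivariant.lift {G E F : Bundle X Λ} {φ : G.mod ⟶ E.mod} {ψ : G.mod ⟶ F.mod}
    (h : IsEquivariant G E φ) (h' : IsEquivariant G F ψ) :
    IsEquivariant G (dsum E F) (biprod.lift φ ψ) := by
  rw [biprod.lift_eq]
  exact (h.comp (isEquivariant_inl E F)).add (h'.comp (isEquivariant_inr E F))

theorem fst_lift_apply (φ : L ⟶ M) (ψ : L ⟶ N) (x : Γ(L, U)) :
    (biprod.fst : M ⊞ N ⟶ M).app U ((biprod.lift φ ψ).app U x) = φ.app U x := by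
  rw [← comp_app_apply, biprod.lift_fst]

theorem snd_lift_apply (φ : L ⟶ M) (ψ : L ⟶ N) (x : Γ(L, U)) :
    (biprod.snd : M ⊞ N ⟶ N).app U ((biprod.lift φ ψ).app U x) = ψ.app U x := by
  rw [← comp_app_apply, biprod.lift_snd]

/-- The sum of two exact sequences, with the two quotients interchanged. For a sequence and its dual
it reads `M ⊕ K^∨ → N ⊕ N^∨ → M^∨ ⊕ K`, where the quotient is listed in the order dual to the
subobject. -/
theorem IsExactSeq.cross {i : M ⟶ N} {q : N ⟶ K} {i' : M' ⟶ N'} {q' : N' ⟶ K'}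
    (h : IsExactSeq i q) (h' : IsExactSeq i' q') :
    IsExactSeq (biprod.lift (biprod.fst ≫ i) (biprod.snd ≫ i') : M ⊞ M' ⟶ N ⊞ N')
      (biprod.lift (biprod.snd ≫ q') (biprod.fst ≫ q) : N ⊞ N' ⟶ K' ⊞ K) := by
  refine ⟨fun U hU x y hxy => ?_, fun U hU z => ⟨fun hz => ?_, ?_⟩, fun U hU y => ?_⟩
  · have h1 := congrArg ((biprod.fst : N ⊞ N' ⟶ N).app U) hxy
    have h2 := congrArg ((biprod.snd : N ⊞ N' ⟶ N').app U) hxy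
    simp only [fst_lift_apply, snd_lift_apply, comp_app_apply] at h1 h2
    exact biprod_section_ext (h.1 U hU h1) (h'.1 U hU h2)
  · have h1 := congrArg ((biprod.fst : K' ⊞ K ⟶ K').app U) hz
    have h2 := congrArg ((biprod.snd : K' ⊞ K ⟶ K).app U) hz
    simp only [fst_lift_apply, snd_lift_apply, comp_app_apply, map_zero] at h1 h2
    obtain ⟨x, hx⟩ := (h.2 U hU _).mp h2
    obtain ⟨x', hx'⟩ := (h'.2 U hU _).mp h1
    refine ⟨(biprod.inl : M ⟶ M ⊞ M').app U x + (biprod.inr : M' ⟶ M ⊞ M').app U x',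
      biprod_section_ext ?_ ?_⟩
    · rw [fst_lift_apply, comp_app_apply, fst_inl_add_inr_apply, hx]
    · rw [snd_lift_apply, comp_app_apply, snd_inl_add_inr_apply, hx']
  · rintro ⟨x, rfl⟩
    refine biprod_section_ext ?_ ?_
    · rw [fst_lift_apply, comp_app_apply, snd_lift_apply, comp_app_apply, map_zero]
      exact (h'.2 U hU _).mpr ⟨_, rfl⟩
    · rw [snd_lift_apply, comp_app_apply, fst_lift_apply, comp_app_apply, map_zero]
      exact (h.2 U hU _).mpr ⟨_, rfl⟩
  · obtain ⟨x, hx⟩ := h.3 U hU ((biprod.snd : K' ⊞ K ⟶ K).app U y)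
    obtain ⟨x', hx'⟩ := h'.3 U hU ((biprod.fst : K' ⊞ K ⟶ K').app U y)
    refine ⟨(biprod.inl : N ⟶ N ⊞ N').app U x + (biprod.inr : N' ⟶ N ⊞ N').app U x',
      biprod_section_ext ?_ ?_⟩
    · rw [fst_lift_apply, comp_app_apply, snd_inl_add_inr_apply, hx']
    · rw [snd_lift_apply, comp_app_apply, fst_inl_add_inr_apply, hx]

/-- A sum of perfect pairings gives an orthogonal sum of hyperbolic bundles. -/
theorem isOrthogonalSum_hypSym {E F E' F' : Bundle X Λ} {c : Form E.mod F.mod}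
    {c' : Form E'.mod F'.mod} (hc : IsPerfect E F c) (hc' : IsPerfect E' F' c') :
    IsOrthogonalSum (hypSym E F c hc) (hypSym E' F' c' hc')
      (hypSym (dsum E F') (dsum F E') (c.dsum c'.flip) (hc.dsum hc'.flip)) := by
  have e1 := isEquivariant_fst E F
  have e2 := isEquivariant_snd E F
  have e1' := isEquivariant_fst E' F'
  have e2' := isEquivariant_snd E' F'
  have f1 := isEquivariant_fst (dsum E F') (dsum F E')
  have f2 := isEquivariant_snd (dsum E F') (dsum F E')
  refine ⟨outer E.mod F.mod E'.mod F'.mod, inner E.mod F.mod E'.mod F'.mod,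
    ⟨(e1.comp (isEquivariant_inl E F')).lift (e2.comp (isEquivariant_inl F E')),
      (e2'.comp (isEquivariant_inr E F')).lift (e1'.comp (isEquivariant_inr F E')),
      outerProj E.mod F.mod E'.mod F'.mod, innerProj E.mod F.mod E'.mod F'.mod,
      (f1.comp (isEquivariant_fst E F')).lift (f2.comp (isEquivariant_fst F E')),
      (f2.comp (isEquivariant_snd F E')).lift (f1.comp (isEquivariant_snd E F')),
      outer_outerProj _ _ _ _, inner_innerProj _ _ _ _, outer_innerProj _ _ _ _,
      inner_outerProj _ _ _ _, outerProj_outer_add _ _ _ _⟩, fun U => ⟨?_, ?_, ?_⟩⟩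
  · have (x y : Γ(E.mod ⊞ F.mod, U)) : (c.dsum c'.flip).hyp.app U
        ((outer E.mod F.mod E'.mod F'.mod).app U x)
        ((outer E.mod F.mod E'.mod F'.mod).app U y) =
        c.hyp.app U x y := by
      simp only [outer, Form.hyp_app, Form.dsum_app, fst_lift_apply, snd_lift_apply, comp_app_apply,
        fst_inl_apply, snd_inl_apply, map_zero, add_zero]
    exact this
  · have (x y : Γ(E'.mod ⊞ F'.mod, U)) : (c.dsum c'.flip).hyp.app U
        ((inner E.mod F.mod E'.mod F'.mod).app U x)
        ((inner E.mod F.mod E'.mod F'.mod).app U y) =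
        c'.hyp.app U x y := by
      simp only [inner, Form.hyp_app, Form.dsum_app, fst_lift_apply, snd_lift_apply, comp_app_apply,
        fst_inr_apply, snd_inr_apply, map_zero, zero_add]
      exact add_comm _ _
    exact this
  · have (x : Γ(E.mod ⊞ F.mod, U)) (y : Γ(E'.mod ⊞ F'.mod, U)) : (c.dsum c'.flip).hyp.app U
        ((outer E.mod F.mod E'.mod F'.mod).app U x)
        ((inner E.mod F.mod E'.mod F'.mod).app U y) = 0 := by
      simp only [outer, inner, Form.hyp_app, Form.dsum_app, fst_lift_apply, snd_lift_apply, comp_app_apply,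
        fst_inr_apply, snd_inr_apply, fst_inl_apply, snd_inl_apply, map_zero,
        LinearMap.zero_apply, add_zero]
    exact this

/-- If `i'` and `q'` are adjoint to `i` and `q`, the crossed sequence satisfies the Lagrangian
condition. -/
theorem Form.hyp_cross {c : Form M M'} {c' : Form N N'} {c'' : Form K K'} {i : M ⟶ N} {q : N ⟶ K}
    {i' : N' ⟶ M'} {q' : K' ⟶ N'}
    (hi : ∀ x y, c.app U x (i'.app U y) = c'.app U (i.app U x) y)
    (hq : ∀ x y, c'.app U x (q'.app U y) = c''.app U (q.app U x) y)
    (x : Γ(M ⊞ K', U)) (z : Γ(N ⊞ N', U)) :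
    c'.hyp.app U ((biprod.lift (biprod.fst ≫ i) (biprod.snd ≫ q')).app U x) z =
      (c.dsum c''.flip).app U x
        ((biprod.lift (biprod.snd ≫ i') (biprod.fst ≫ q)).app U z) := by
  simp only [Form.hyp_app, Form.dsum_app, fst_lift_apply, snd_lift_apply, comp_app_apply, hi, hq]
  rfl

/-- The bundle `M ⊕ K^∨` is a Lagrangian both in the hyperbolic bundle of `N` and in the orthogonal
sum of those of `M` and `K`, with the same induced pairing. -/
theorem cls_hypDual_eq_add (w : Λ) {i : M ⟶ N} {q : N ⟶ K} (h : IsExactSeq i q) (hM : IsVB M)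
    (hN : IsVB N) (hK : IsVB K) :
    GW0.cls (hypDual w hN) = GW0.cls (hypDual w hM) + GW0.cls (hypDual w hK) := by
  refine Eq.trans ?_ (GW0.cls_sum (isOrthogonalSum_hypSym
    (isPerfect_evalForm w hM) (isPerfect_evalForm w hK)))
  refine cls_hypSym_eq _ (isPerfect_evalForm w hN)
    (((isEquivariant_fst _ _).comp (isEquivariant_place w hM hN i)).lift
      ((isEquivariant_snd _ _).comp (isEquivariant_place (-w) hK.dual hN.dual _)))
    (((isEquivariant_snd _ _).comp (isEquivariant_place (-w) hN.dual hM.dual _)).lift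
      ((isEquivariant_fst _ _).comp (isEquivariant_place w hN hK q)))
    (h.cross (h.dual hM hN hK)) fun U x z => ?_
  exact Form.hyp_cross (fun _ _ => rfl) (fun _ _ => rfl) x z

end HyperbolicAdditive

/-! ### Additive invariants of vector bundles extend to the Grothendieck ring. -/

section AdditiveMaps

variable {X : Scheme.{u}} {M N K : X.Modules}

instance VB.setoid (X : Scheme.{u}) : Setoid {M : X.Modules // IsVB M} where
  r M N := Nonempty (M.1 ≅ N.1)
  iseqv := ⟨fun _ => ⟨Iso.refl _⟩, fun ⟨e⟩ => ⟨e.symm⟩, fun ⟨e⟩ ⟨f⟩ => ⟨e.trans f⟩⟩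

/-- Isomorphism classes of vector bundles. -/
def VBIso (X : Scheme.{u}) : Type (u + 1) := Quotient (VB.setoid X)

/-- The isomorphism class of a vector bundle. -/
def VBIso.mk (hM : IsVB M) : VBIso X := Quotient.mk _ ⟨M, hM⟩

theorem VBIso.mk_eq (hM : IsVB M) (hN : IsVB N) (h : Nonempty (M ≅ N)) : mk hM = mk hN :=
  Quotient.sound h

theorem VBIso.ind {P : VBIso X → Prop} (h : ∀ (M : X.Modules) (hM : IsVB M), P (mk hM))
    (a : VBIso X) : P a :=
  Quotient.ind (fun M => h M.1 M.2) a

instance : CommMonoid (VBIso X) where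
  mul := Quotient.map₂ (fun M N => ⟨tensor M.1 N.1, M.2.tensor N.2⟩)
    fun M M' ⟨e⟩ _ _ ⟨f⟩ => tensor_congr M.2 M'.2 e f
  one := VBIso.mk (isVB_structureSheaf X)
  mul_assoc a b c := by
    induction a using VBIso.ind
    induction b using VBIso.ind
    induction c using VBIso.ind
    exact Quotient.sound (tensor_assoc ‹_› ‹_›)
  mul_comm a b := by
    induction a using VBIso.ind
    induction b using VBIso.ind
    exact Quotient.sound (tensor_comm ‹_› ‹_›)
  one_mul a := by
    induction a using VBIso.ind
    exact Quotient.sound (tensor_one _)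
  mul_one a := by
    induction a using VBIso.ind with | h M hM
    exact Quotient.sound ((tensor_comm hM (isVB_structureSheaf X)).map2 (· ≪≫ ·) (tensor_one _))

theorem VBIso.mk_mul_mk (hM : IsVB M) (hN : IsVB N) : mk hM * mk hN = mk (hM.tensor hN) := rfl

/-- The exact sequence relations in the ring of isomorphism classes of vector bundles. -/
def exactIdeal (X : Scheme.{u}) : Ideal (MonoidAlgebra ℤ (VBIso X)) :=
  Ideal.span {r | ∃ (M N K : X.Modules) (hM : IsVB M) (hN : IsVB N) (hK : IsVB K) (i : M ⟶ N)
    (q : N ⟶ K), IsExactSeq i q ∧ r = MonoidAlgebra.single (VBIso.mk hN) 1 -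
      (MonoidAlgebra.single (VBIso.mk hM) 1 + MonoidAlgebra.single (VBIso.mk hK) 1)}

/-- The homomorphism from the Grothendieck ring to the ring of isomorphism classes of vector bundles
modulo exact sequences. -/
theorem exists_toExact (X : Scheme.{u}) :
    ∃ Φ : KX X →+* MonoidAlgebra ℤ (VBIso X) ⧸ exactIdeal X, ∀ E : Bundle X Unit,
      Φ (K0.cls E) = Ideal.Quotient.mk _ (MonoidAlgebra.single (VBIso.mk E.isVB) 1) := by
  let Ψ : MvPolynomial (Bundle X Unit) ℤ →+* MonoidAlgebra ℤ (VBIso X) ⧸ exactIdeal X :=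
    MvPolynomial.eval₂Hom (Int.castRingHom _) fun E =>
      Ideal.Quotient.mk _ (MonoidAlgebra.single (VBIso.mk E.isVB) 1)
  have hΨ (E) : Ψ (.X E) = Ideal.Quotient.mk _ (MonoidAlgebra.single (VBIso.mk E.isVB) 1) :=
    MvPolynomial.eval₂Hom_X' _ _ _
  have hle : Ideal.span {r | K0Rel X Unit r} ≤ RingHom.ker Ψ := by
    refine Ideal.span_le.mpr fun r hr => RingHom.mem_ker.mpr ?_
    cases hr with
    | exact h =>
      rw [map_sub, map_add, hΨ, hΨ, hΨ, ← map_add, ← map_sub]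
      exact Ideal.Quotient.eq_zero_iff_mem.mpr (Ideal.subset_span
        ⟨_, _, _, _, _, _, _, _, h.isExactSeq, rfl⟩)
    | @tensor E F G b h =>
      rw [map_sub, map_mul, hΨ, hΨ, hΨ, ← map_mul, MonoidAlgebra.single_mul_single, mul_one,
        VBIso.mk_mul_mk, VBIso.mk_eq G.isVB (E.isVB.tensor F.isVB), sub_self]
      exact exists_iso_of_isTensorProduct b h.1 _
        (fun _ hU => isTensorProduct_tensorPairing E.isVB F.mod hU) (Iso.refl _) (Iso.refl _)
    | unit =>
      rw [map_sub, map_one, hΨ, sub_eq_zero]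
      exact (congrArg _ MonoidAlgebra.one_def.symm).trans (map_one _)
  exact ⟨Ideal.Quotient.lift _ Ψ hle, hΨ⟩

/-- The universal property of the Grothendieck group: additive invariants of vector bundles extend
to it. -/
theorem K0.exists_addMonoidHom {A : Type*} [Ring A] (η : ∀ M : X.Modules, IsVB M → A)
    (hiso : ∀ (M N : X.Modules) (hM : IsVB M) (hN : IsVB N), (M ≅ N) → η M hM = η N hN)
    (hexact : ∀ (M N K : X.Modules) (hM : IsVB M) (hN : IsVB N) (hK : IsVB K) (i : M ⟶ N)
      (q : N ⟶ K), IsExactSeq i q → η N hN = η M hM + η K hK) :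
    ∃ H : KX X →+ A, ∀ E : Bundle X Unit, H (K0.cls E) = η E.mod E.isVB := by
  -- The relations of `K0` generate an ideal, not just a subgroup. The tensor relations are absorbed
  -- into the monoid ring on isomorphism classes, whose additive group is free, so that `η` extends
  -- to it.
  obtain ⟨Φ, hΦ⟩ := exists_toExact X
  let η' : VBIso X → A := Quotient.lift (fun M => η M.1 M.2) fun M N ⟨e⟩ => hiso _ _ _ _ e
  have hη' {M} (hM : IsVB M) : η' (VBIso.mk hM) = η M hM := rfl
  let g : MonoidAlgebra ℤ (VBIso X) →+ A := MonoidAlgebra.liftNC (Int.castAddHom A) η'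
  have hg (a) (n : ℤ) : g (MonoidAlgebra.single a n) = n * η' a := MonoidAlgebra.liftNC_single _ _ _ _
  have hle : (Ideal.Quotient.mk (exactIdeal X)).toAddMonoidHom.ker ≤ g.ker := by
    intro r hr
    have hr' : r ∈ exactIdeal X := Ideal.Quotient.eq_zero_iff_mem.mp hr
    -- As `g` is only additive, vanishing must be shown for all multiples of the relations.
    -- Multiplying by a class tensors the sequence with a bundle, which keeps it exact.
    have key : ∀ a, g (a * r) = 0 := by
      refine Submodule.span_induction (p := fun r _ => ∀ a, g (a * r) = 0) ?_ ?_ ?_ ?_ hr'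
      · rintro _ ⟨M, N, K, hM, hN, hK, i, q, h, rfl⟩ a
        induction a using MonoidAlgebra.induction with
        | zero => rw [zero_mul, map_zero]
        | single_add a n b _ _ hb =>
          rw [add_mul, map_add, hb, add_zero, mul_sub, mul_add, map_sub, map_add,
            MonoidAlgebra.single_mul_single, MonoidAlgebra.single_mul_single,
            MonoidAlgebra.single_mul_single, hg, hg, hg]
          induction a using VBIso.ind with | h P hP
          rw [VBIso.mk_mul_mk, VBIso.mk_mul_mk, VBIso.mk_mul_mk, hη', hη', hη',
            hexact _ _ _ (hP.tensor hM) (hP.tensor hN) (hP.tensor hK) _ _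
              (h.homSheafMap hP.dual), mul_add, sub_self]
      · intro a
        rw [mul_zero, map_zero]
      · intro x y _ _ hx hy a
        rw [mul_add, map_add, hx, hy, add_zero]
      · intro b x _ hx a
        rw [smul_eq_mul, ← mul_assoc, hx]
    simpa using key 1
  obtain ⟨H, hH⟩ : ∃ H : MonoidAlgebra ℤ (VBIso X) ⧸ exactIdeal X →+ A,
      ∀ r, H (Ideal.Quotient.mk _ r) = g r :=
    ⟨AddMonoidHom.liftOfRightInverse (Ideal.Quotient.mk (exactIdeal X)).toAddMonoidHom _
      (Function.rightInverse_surjInv Ideal.Quotient.mk_surjective) ⟨g, hle⟩,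
      AddMonoidHom.liftOfRightInverse_comp_apply _ _
        (Function.rightInverse_surjInv Ideal.Quotient.mk_surjective) ⟨g, hle⟩⟩
  refine ⟨H.comp Φ.toAddMonoidHom, fun E => (congrArg H (hΦ E)).trans ?_⟩
  rw [hH, hg, hη', Int.cast_one, one_mul]

end AdditiveMaps

/-! ### The hyperbolic maps. -/

section Hyperbolic

variable {X : Scheme.{u}} {Λ : Type} [AddCommGroup Λ]

theorem exists_hyperbolicMap (w : Λ) : ∃ H : KX X →+ GW0 X Λ,
    ∀ E : Bundle X Unit, H (K0.cls E) = GW0.cls (hypDual w E.isVB) :=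
  K0.exists_addMonoidHom (fun _ hM => GW0.cls (hypDual w hM))
    (fun _ _ _ _ e => cls_hypPlace_eq_of_iso _ e)
    fun _ _ _ hM hN hK _ _ h => cls_hypDual_eq_add w h hM hN hK

variable (X) in
/-- The hyperbolic map in weight `w`. -/
def hyperbolicMap (w : Λ) : KX X →+ GW0 X Λ := (exists_hyperbolicMap w).choose

theorem hyperbolicMap_cls (w : Λ) (E : Bundle X Unit) :
    hyperbolicMap X w (K0.cls E) = GW0.cls (hypDual w E.isVB) :=
  (exists_hyperbolicMap w).choose_spec E

end Hyperbolic

/-! ### Tensor products of symmetric bundles with hyperbolic bundles. -/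

section SymTensor

open Limits

variable {X : Scheme.{u}} {Λ : Type} [AddCommGroup Λ] {M N K L M' N' K' L' : X.Modules}
  {U V : X.Opens}

/-- The evaluation of homomorphisms at sections. -/
def evalPairing (M N : X.Modules) : Pairing (homSheaf M N) M N where
  app U := LinearMap.mk₂ Γ(X, U)
    (fun φ x => (homSheafEquiv M N U φ).app U le_rfl x)
    (fun φ ψ x => rfl)
    (fun a φ x => by
      change fres le_rfl a • (homSheafEquiv M N U φ).app U le_rfl x = _
      rw [fres_self])
    (fun φ x y => ((homSheafEquiv M N U φ).app U le_rfl).map_add x y)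
    (fun a φ x => ((homSheafEquiv M N U φ).app U le_rfl).map_smul a x)
  map_app {U V} h φ x := (homSheafEquiv M N U φ).res_app le_rfl h.le x

/-- The contraction of a tensor product with the dual of its first factor. -/
def tensorEval (M N : X.Modules) : Pairing (tensor M N) (dual M) N := evalPairing (dual M) N

theorem tensorEval_tensorPairing (x : Γ(M, U)) (y : Γ(N, U)) (φ : Γ(dual M, U)) :
    (tensorEval M N).app U ((tensorPairing M N).app U x y) φ =
      (evalForm M).app U x φ • y := by
  refine (tensorPairing_app x y le_rfl φ).trans ?_
  rw [res_self, res_self]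

/-- The values of the pairing of a module with a form and the dual of `N` in the dual of the tensor
product with `N`. -/
def contractionBilin (c : Form M M) (N : X.Modules) (U : X.Opens) :
    Γ(M, U) →ₗ[Γ(X, U)] Γ(dual N, U) →ₗ[Γ(X, U)] Γ(tensor M N, U) →ₗ[Γ(X, U)] Γ(X, U) :=
  LinearMap.mk₂ Γ(X, U)
    (fun x φ => ((evalForm N).app U).flip φ ∘ₗ
      ((tensorEval M N).app U).flip (lapp (formHom c) U x))
    (fun x x' φ => by rw [map_add, map_add, LinearMap.comp_add])
    (fun a x φ => by rw [map_smul, map_smul, LinearMap.comp_smul])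
    (fun x φ ψ => by rw [map_add, LinearMap.add_comp])
    (fun a x φ => by rw [map_smul, LinearMap.smul_comp])

theorem contractionBilin_apply (c : Form M M) (x : Γ(M, U)) (φ : Γ(dual N, U))
    (α : Γ(tensor M N, U)) : contractionBilin c N U x φ α =
      (evalForm N).app U ((tensorEval M N).app U α ((formHom c).app U x)) φ := rfl

theorem fres_contractionBilin (c : Form M M) (h : V ≤ U) (x : Γ(M, U)) (φ : Γ(dual N, U))
    (α : Γ(tensor M N, U)) : fres h (contractionBilin c N U x φ α) =
      contractionBilin c N V (res M h x) (res (dual N) h φ) (res (tensor M N) h α) := by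
  rw [contractionBilin_apply, contractionBilin_apply, (evalForm N).res_app h]
  refine congrArg (fun y => (evalForm N).app V y _)
    (((tensorEval M N).res_app h _ _).trans ?_)
  rw [← app_res]

/-- The bilinear map to a dual given by a trilinear form. -/
def Pairing.ofTrilinear
    (T : ∀ U : X.Opens, Γ(M, U) →ₗ[Γ(X, U)] Γ(N, U) →ₗ[Γ(X, U)] Γ(L, U) →ₗ[Γ(X, U)] Γ(X, U))
    (hT : ∀ {U V : X.Opens} (h : V ≤ U) (x : Γ(M, U)) (y : Γ(N, U)) (z : Γ(L, U)),
      fres h (T U x y z) = T V (res M h x) (res N h y) (res L h z)) :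
    Pairing M N (dual L) where
  app U := LinearMap.mk₂ Γ(X, U)
    (fun x y => (homSheafEquiv L (structureSheaf X) U).symm
      { app := fun V h => T V (res M h x) (res N h y)
        res_app := fun {V V'} h h' z => by
          refine (hT h' _ _ _).trans ?_
          rw [res_res, res_res]
          rfl })
    (fun x x' y => HomSec.ext (funext fun V => funext fun h =>
      show T V (res M h (x + x')) (res N h y) =
        T V (res M h x) (res N h y) + T V (res M h x') (res N h y) by
      rw [map_add, map_add, LinearMap.add_apply]))
    (fun a x y => HomSec.ext (funext fun V => funext fun h =>
      show T V (res M h (a • x)) (res N h y) = fres h a • T V (res M h x) (res N h y) by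
      rw [res_smul, map_smul, LinearMap.smul_apply]))
    (fun x y y' => HomSec.ext (funext fun V => funext fun h =>
      show T V (res M h x) (res N h (y + y')) =
        T V (res M h x) (res N h y) + T V (res M h x) (res N h y') by
      rw [map_add, map_add]))
    (fun a x y => HomSec.ext (funext fun V => funext fun h =>
      show T V (res M h x) (res N h (a • y)) = fres h a • T V (res M h x) (res N h y) by
      rw [res_smul, map_smul]))
  map_app {U V} i x y := HomSec.ext (funext fun W => funext fun h => LinearMap.ext fun z => by
    change T W (res M (h.trans i.le) x) (res N (h.trans i.le) y) z =
      T W (res M h (res M i.le x)) (res N h (res N i.le y)) z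
    rw [res_res, res_res])

theorem Pairing.evalForm_ofTrilinear
    (T : ∀ U : X.Opens, Γ(M, U) →ₗ[Γ(X, U)] Γ(N, U) →ₗ[Γ(X, U)] Γ(L, U) →ₗ[Γ(X, U)] Γ(X, U))
    (hT : ∀ {U V : X.Opens} (h : V ≤ U) (x : Γ(M, U)) (y : Γ(N, U)) (z : Γ(L, U)),
      fres h (T U x y z) = T V (res M h x) (res N h y) (res L h z)) (x : Γ(M, U)) (y : Γ(N, U))
    (z : Γ(L, U)) :
    (evalForm L).app U z ((Pairing.ofTrilinear T hT).app U x y) = T U x y z := by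
  change T U (res M le_rfl x) (res N le_rfl y) z = _
  rw [res_self, res_self]

/-- The pairing of a module with a form and the dual of `N`, with values in the dual of the tensor
product with `N`. -/
def contraction (c : Form M M) (N : X.Modules) : Pairing M (dual N) (dual (tensor M N)) :=
  Pairing.ofTrilinear (contractionBilin c N) (fres_contractionBilin c)

/-- The form on `M` takes the place of evaluation in the first factor, so `x' ⊗ φ` acts on `M ⊗ N`
as the product of two functionals. -/
theorem evalForm_contraction (c : Form M M) (x x' : Γ(M, U)) (y : Γ(N, U)) (φ : Γ(dual N, U)) :
    (evalForm (tensor M N)).app U ((tensorPairing M N).app U x y)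
      ((contraction c N).app U x' φ) = c.app U x x' * (evalForm N).app U y φ := by
  refine (Pairing.evalForm_ofTrilinear _ _ _ _ _).trans ?_
  rw [contractionBilin_apply, tensorEval_tensorPairing, evalForm_formHom, map_smul,
    LinearMap.smul_apply]
  rfl

/-- Since `M` is self-dual through `c`, the dual of `M ⊗ N` is `M ⊗ N^∨`. -/
theorem isTensorProduct_contraction {c : Form M M} (hM : IsVB M) (hN : IsVB N)
    (hU : IsAffineOpen U) (hc : (c.app U).IsPerfPair) :
    IsTensorProduct ((contraction c N).app U) :=
  have := hM.2 U hU
  have := hM.3 U hU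
  IsTensorProduct.of_isPerfPair hc (isPerfPair_evalForm hN hU)
    (isPerfPair_evalForm (hM.tensor hN) hU) (isTensorProduct_tensorPairing hM N hU)
    fun x x' y φ => evalForm_contraction c x x' y φ

/-- The direct sum of two bilinear maps with the same first argument. -/
def Pairing.sum (b : Pairing M N K) (b' : Pairing M N' K') : Pairing M (N ⊞ N') (K ⊞ K') where
  app U := (b.comp (𝟙 M) biprod.fst biprod.inl).app U +
    (b'.comp (𝟙 M) biprod.snd biprod.inr).app U
  map_app h x y := by
    rw [LinearMap.add_apply, LinearMap.add_apply, map_add, Pairing.map_app, Pairing.map_app,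
      LinearMap.add_apply, LinearMap.add_apply]

theorem Pairing.sum_app (b : Pairing M N K) (b' : Pairing M N' K') (x : Γ(M, U))
    (y : Γ(N ⊞ N', U)) : (b.sum b').app U x y =
      (biprod.inl : K ⟶ K ⊞ K').app U (b.app U x ((biprod.fst : N ⊞ N' ⟶ N).app U y)) +
      (biprod.inr : K' ⟶ K ⊞ K').app U (b'.app U x ((biprod.snd : N ⊞ N' ⟶ N').app U y)) := by
  change (b.comp (𝟙 M) biprod.fst biprod.inl).app U x y +
    (b'.comp (𝟙 M) biprod.snd biprod.inr).app U x y = _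
  rw [comp_app, comp_app, id_app_apply]

theorem isTensorProduct_sum {b : Pairing M N K} {b' : Pairing M N' K'}
    (h : IsTensorProduct (b.app U)) (h' : IsTensorProduct (b'.app U)) :
    IsTensorProduct ((b.sum b').app U) :=
  h.directSum h' (lapp biprod.inl U) (lapp biprod.inr U) (lapp biprod.fst U) (lapp biprod.snd U)
    fst_inl_apply snd_inr_apply snd_inl_apply fst_inr_apply inl_fst_add_inr_snd_apply
    (lapp biprod.inl U) (lapp biprod.inr U) (lapp biprod.fst U) (lapp biprod.snd U)
    fst_inl_apply snd_inr_apply snd_inl_apply fst_inr_apply inl_fst_add_inr_snd_apply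
    (Pairing.sum_app b b')

theorem Bundle.HasWeight.add {E : Bundle X Λ} {w : Λ} {s s' : Γ(E.mod, U)} (h : E.HasWeight w s)
    (h' : E.HasWeight w s') : E.HasWeight w (s + s') := by
  rw [Bundle.HasWeight, map_add, h, h']

theorem hyp_sum_apply {c : Form M M} {b : Pairing M N K} {b' : Pairing M N' K'} {d : Form N N'}
    {d' : Form K K'}
    (h : ∀ x x' y y', d'.app U (b.app U x y) (b'.app U x' y') = c.app U x x' * d.app U y y')
    (hc : ∀ x x', c.app U x x' = c.app U x' x) (x x' : Γ(M, U)) (y y' : Γ(N ⊞ N', U)) :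
    d'.hyp.app U ((b.sum b').app U x y) ((b.sum b').app U x' y') =
      c.app U x x' * d.hyp.app U y y' := by
  rw [Form.hyp_app, Form.hyp_app, Pairing.sum_app, Pairing.sum_app, fst_inl_add_inr_apply,
    fst_inl_add_inr_apply, snd_inl_add_inr_apply, snd_inl_add_inr_apply, h, h, hc x' x, mul_add]

/-- The tensor product of a symmetric bundle with a hyperbolic bundle. -/
theorem isSymTensor_hypSym {M : SymBundle X Λ} {E E' F F' : Bundle X Λ}
    {b : Pairing M.bundle.mod E.mod F.mod} {b' : Pairing M.bundle.mod E'.mod F'.mod}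
    {d : Form E.mod E'.mod} {d' : Form F.mod F'.mod} (hb : IsTensor M.bundle E F b)
    (hb' : IsTensor M.bundle E' F' b') (hd : IsPerfect E E' d) (hd' : IsPerfect F F' d')
    (h : ∀ U x x' y y', d'.app U (b.app U x y) (b'.app U x' y') =
      M.form.app U x x' * d.app U y y') :
    IsSymTensor M (hypSym E E' d hd) (hypSym F F' d' hd') := by
  refine ⟨b.sum b', ⟨fun U hU => isTensorProduct_sum (hb.1 U hU) (hb'.1 U hU),
    fun U v w x y hx hy => ?_⟩, fun U => hyp_sum_apply (h U) (M.symm U)⟩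
  have h1 := (isEquivariant_inl F F').hasWeight
    (hb.2 U v w x _ hx ((isEquivariant_fst E E').hasWeight hy))
  have h2 := (isEquivariant_inr F F').hasWeight
    (hb'.2 U v w x _ hx ((isEquivariant_snd E E').hasWeight hy))
  have h3 := h1.add h2
  exact (congrArg _ (Pairing.sum_app b b' x y)).mpr h3

theorem hasWeight_push_zero {E : Bundle X Unit} {v : Λ} {s : Γ(E.mod, U)} :
    (E.push (0 : Unit →+ Λ)).HasWeight v s ↔ v = 0 ∨ s = 0 := by
  have h : (E.push (0 : Unit →+ Λ)).proj = (place (0 : Λ) E.mod E.isVB).proj := by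
    refine (congrArg (Finsupp.mapDomain _) (Finsupp.unique_single E.proj)).trans ?_
    refine Finsupp.mapDomain_single.trans ?_
    exact congrArg (Finsupp.single (0 : Λ)) E.proj_unit
  refine Iff.trans (Iff.of_eq ?_) (hasWeight_place (hM := E.isVB))
  exact congrArg (fun p : Λ →₀ (E.mod ⟶ E.mod) => (p v).app U s = s) h

theorem isTensor_push_place {E : Bundle X Unit} {b : Pairing E.mod N K} (hN : IsVB N) (hK : IsVB K)
    (hb : ∀ U, IsAffineOpen U → IsTensorProduct (b.app U)) (w : Λ) :
    IsTensor (E.push (0 : Unit →+ Λ)) (place w N hN) (place w K hK) b := by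
  refine ⟨hb, fun U v' w' x y hx hy => hasWeight_place.mpr ?_⟩
  rcases hasWeight_push_zero.mp hx with rfl | rfl
  · rcases hasWeight_place.mp hy with rfl | rfl
    · exact Or.inl (zero_add _)
    · exact Or.inr (map_zero (b.app U x))
  · exact Or.inr (LinearMap.map_zero₂ (b.app U) y)

/-- The projection formula on bundles: `M ⊗ (N ⊕ N^∨)` is the sum of `M ⊗ N` and its dual. -/
theorem cls_push_mul_cls_hypDual (M : SymBundle X Unit) (w : Λ) (hN : IsVB N) :
    GW0.cls (M.push (0 : Unit →+ Λ)) * GW0.cls (hypDual w hN) =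
      GW0.cls (hypDual w (M.bundle.isVB.tensor hN)) :=
  (GW0.cls_tensor (isSymTensor_hypSym
    (isTensor_push_place hN (M.bundle.isVB.tensor hN)
      (fun _ hU => isTensorProduct_tensorPairing M.bundle.isVB N hU) w)
    (isTensor_push_place hN.dual (M.bundle.isVB.tensor hN).dual
      (fun U hU => isTensorProduct_contraction M.bundle.isVB hN hU (M.perfect.1 U hU)) (-w))
    (isPerfect_evalForm w hN) (isPerfect_evalForm w (M.bundle.isVB.tensor hN))
    fun _ => evalForm_contraction M.form)).symm

end SymTensor

/-! ### The projection formula for the hyperbolic maps. -/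

section ProjectionFormula

variable {X : Scheme.{u}} {Λ : Type} [AddCommGroup Λ]

/-- Tensor products show that the classes of bundles are closed under multiplication, so the subring
they generate, which is everything, is already their additive span. -/
theorem K0.additive_induction {P : KX X → Prop} (a : KX X) (cls : ∀ E, P (K0.cls E))
    (add : ∀ a b, P a → P b → P (a + b)) (neg : ∀ a, P a → P (-a)) : P a := by
  have zero : P 0 := by
    rw [← add_neg_cancel (K0.cls (lineBundle X 0))]
    exact add _ _ (cls _) (neg _ (cls _))
  let S : Subring (KX X) := Subring.closure (Set.range K0.cls)
  have hmem : a ∈ S := by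
    induction a using K0.induction_on with
    | cls E => exact Subring.subset_closure ⟨E, rfl⟩
    | int n => exact intCast_mem S n
    | add a b ha hb => exact S.add_mem ha hb
    | mul a b ha hb => exact S.mul_mem ha hb
  have hsub : (Submonoid.closure (Set.range (K0.cls : Bundle X Unit → KX X)) : Set (KX X)) ⊆
      Set.range K0.cls := by
    intro b hb
    induction hb using Submonoid.closure_induction with
    | mem b hb => exact hb
    | one => exact ⟨_, K0.cls_unit⟩
    | mul a b _ _ ha hb =>
      obtain ⟨E, rfl⟩ := ha
      obtain ⟨F, rfl⟩ := hb
      exact ⟨place () _ (E.isVB.tensor F.isVB), K0.cls_tensor (b := tensorPairing E.mod F.mod)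
        ⟨fun _ hU => isTensorProduct_tensorPairing E.isVB F.mod hU, fun U v w x y _ _ =>
          hasWeight_place.mpr (Or.inl rfl)⟩⟩
  rw [Subring.mem_closure_iff] at hmem
  induction hmem using AddSubgroup.closure_induction with
  | mem b hb =>
    obtain ⟨E, rfl⟩ := hsub hb
    exact cls E
  | zero => exact zero
  | add a b _ _ ha hb => exact add _ _ ha hb
  | neg a _ ha => exact neg _ ha

/-- For classes of bundles this is `cls_push_mul_cls_hypDual`. Both sides are additive in `a` and in
`κ`, and products in `κ` are handled because `a` stays arbitrary in the induction. -/
theorem hyperbolicMap_forget_mul (w : Λ) (κ : GWX X) (a : KX X) :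
    hyperbolicMap X w (GW0.forget X Unit κ * a) = GW0.map X 0 κ * hyperbolicMap X w a := by
  induction κ using GW0.induction_on generalizing a with
  | cls M =>
    induction a using K0.additive_induction with
    | cls E =>
      rw [GW0.forget_cls, GW0.map_cls, hyperbolicMap_cls, cls_push_mul_cls_hypDual]
      have h : K0.cls (place () _ (M.bundle.isVB.tensor E.isVB)) = K0.cls M.bundle * K0.cls E :=
        K0.cls_tensor (b := tensorPairing M.bundle.mod E.mod)
          ⟨fun _ hU => isTensorProduct_tensorPairing M.bundle.isVB E.mod hU, fun U v w x y _ _ =>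
            hasWeight_place.mpr (Or.inl rfl)⟩
      rw [← h, hyperbolicMap_cls]
      rfl
    | add a b ha hb => rw [mul_add, map_add, ha, hb, map_add, mul_add]
    | neg a ha =>
      let f := (hyperbolicMap X w).comp (AddMonoidHom.mulLeft (GW0.forget X Unit (GW0.cls M)))
      let g := (AddMonoidHom.mulLeft (GW0.map X 0 (GW0.cls M))).comp (hyperbolicMap X w)
      exact (map_neg f a).trans ((congrArg Neg.neg ha).trans (map_neg g a).symm)
  | int n => rw [map_intCast, map_intCast, ← zsmul_eq_mul, ← zsmul_eq_mul, map_zsmul]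
  | add κ κ' h h' => rw [map_add, map_add, add_mul, add_mul, map_add, h, h']
  | mul κ κ' h h' => rw [RingHom.map_mul, RingHom.map_mul, mul_assoc, mul_assoc, h, h']

theorem isPerfPair_mulForm (U : X.Opens) : ((mulForm X).app U).IsPerfPair :=
  isPerfPair_mul Γ(X, U)

theorem hyperbolicMap_one (w : Λ) : hyperbolicMap X w 1 =
    GW0.cls (hypPlace (add_neg_cancel w) (isVB_structureSheaf X) (isVB_structureSheaf X) (mulForm X)
      fun U _ => isPerfPair_mulForm U) := by
  rw [← K0.cls_unit, hyperbolicMap_cls]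
  exact cls_hypPlace_eq_of_iso _ (Iso.refl _)

theorem forget_hyperbolicMap_one (w : Λ) : GW0.forget X Λ (hyperbolicMap X w 1) =
    K0.cls (lineBundle X w) + K0.cls (lineBundle X (-w)) := by
  rw [hyperbolicMap_one (w := w), GW0.forget_cls]
  exact K0.cls_of_isDirectSum (isDirectSum_dsum (lineBundle X w) (lineBundle X (-w)))

end ProjectionFormula

/-! ### Splitting off the hyperbolic part in a pair of opposite weights. -/

section Decomposition

open Limits

variable {X : Scheme.{u}} {Λ : Type} [AddCommGroup Λ] {U V : X.Opens}

theorem sub_app_apply {M N : X.Modules} (φ ψ : M ⟶ N) (s : Γ(M, U)) :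
    (φ - ψ).app U s = φ.app U s - ψ.app U s := map_sub (evalHom s) φ ψ

/-- The image of an equivariant idempotent. -/
def Bundle.split (E : Bundle X Λ) (s : E.mod ⟶ E.mod) (hs : s ≫ s = s)
    (hc : ∀ v, E.proj v ≫ s = s ≫ E.proj v) : Bundle X Λ :=
  E.retract (splitι s hs) (splitπ s hs) (splitι_π s hs) fun w => by
    rw [splitπ_ι, ← Category.assoc (splitπ s hs), splitπ_ι, hc]

theorem Bundle.split_proj (E : Bundle X Λ) {s : E.mod ⟶ E.mod} (hs : s ≫ s = s)
    (hc : ∀ v, E.proj v ≫ s = s ≫ E.proj v) (v : Λ) :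
    (E.split s hs hc).proj v = splitι s hs ≫ E.proj v ≫ splitπ s hs :=
  E.retract_proj _ _ _ _ v

theorem isEquivariant_splitι (E : Bundle X Λ) {s : E.mod ⟶ E.mod} (hs : s ≫ s = s)
    (hc : ∀ v, E.proj v ≫ s = s ≫ E.proj v) : IsEquivariant (E.split s hs hc) E (splitι s hs) :=
  E.retract_equivariant_ι _ _ _ _

theorem isEquivariant_splitπ (E : Bundle X Λ) {s : E.mod ⟶ E.mod} (hs : s ≫ s = s)
    (hc : ∀ v, E.proj v ≫ s = s ≫ E.proj v) : IsEquivariant E (E.split s hs hc) (splitπ s hs) :=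
  E.retract_equivariant_π _ _ _ _

/-- The image of a self-adjoint equivariant idempotent. -/
def SymBundle.split (M : SymBundle X Λ) (s : M.bundle.mod ⟶ M.bundle.mod) (hs : s ≫ s = s)
    (hc : ∀ v, M.bundle.proj v ≫ s = s ≫ M.bundle.proj v)
    (ha : ∀ (U : X.Opens) x y, M.form.app U (s.app U x) y = M.form.app U x (s.app U y)) :
    SymBundle X Λ where
  bundle := M.bundle.split s hs hc
  form := M.form.comp (splitι s hs) (splitι s hs)
  perfect := ⟨fun U hU => isPerfPair_split hs hs (M.perfect.1 U hU) (ha U),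
    fun U v w _ _ hx hy h => M.perfect.2 U v w _ _ ((isEquivariant_splitι _ hs hc).hasWeight hx)
      ((isEquivariant_splitι _ hs hc).hasWeight hy) h⟩
  symm U _ _ := M.symm U _ _

theorem comp_splitπ_eq_zero {M N : X.Modules} {p : M ⟶ M} (hp : p ≫ p = p) {φ : N ⟶ M}
    (h : φ ≫ p = 0) : φ ≫ splitπ p hp = 0 := by
  rw [← comp_splitπ, ← Category.assoc, h, zero_comp]

theorem splitι_comp_eq_zero {M N : X.Modules} {p : M ⟶ M} (hp : p ≫ p = p) {φ : M ⟶ N}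
    (h : p ≫ φ = 0) : splitι p hp ≫ φ = 0 := by
  rw [← splitι_comp, Category.assoc, h, comp_zero]

section SplitSum

variable {M : X.Modules} {p q s : M ⟶ M} (hp : p ≫ p = p) (hq : q ≫ q = q) (hs : s ≫ s = s)

theorem desc_lift_split (hpq : p ≫ q = 0) (hqp : q ≫ p = 0) :
    biprod.desc (splitι p hp) (splitι q hq) ≫ biprod.lift (splitπ p hp) (splitπ q hq) = 𝟙 _ := by
  apply biprod.hom_ext' <;> apply biprod.hom_ext
  · simp [splitι_π]
  · simp [comp_splitπ_eq_zero hq (splitι_comp_eq_zero hp hpq)]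
  · simp [comp_splitπ_eq_zero hp (splitι_comp_eq_zero hq hqp)]
  · simp [splitι_π]

theorem desc_splitπ (hps : p ≫ s = 0) (hqs : q ≫ s = 0) :
    biprod.desc (splitι p hp) (splitι q hq) ≫ splitπ s hs = 0 := by
  apply biprod.hom_ext'
  · simp [comp_splitπ_eq_zero hs (splitι_comp_eq_zero hp hps)]
  · simp [comp_splitπ_eq_zero hs (splitι_comp_eq_zero hq hqs)]

theorem splitι_lift (hsp : s ≫ p = 0) (hsq : s ≫ q = 0) :
    splitι s hs ≫ biprod.lift (splitπ p hp) (splitπ q hq) = 0 := by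
  apply biprod.hom_ext
  · simp [comp_splitπ_eq_zero hp (splitι_comp_eq_zero hs hsp)]
  · simp [comp_splitπ_eq_zero hq (splitι_comp_eq_zero hs hsq)]

theorem lift_desc_add_split (h : p + q + s = 𝟙 M) :
    biprod.lift (splitπ p hp) (splitπ q hq) ≫ biprod.desc (splitι p hp) (splitι q hq) +
      splitπ s hs ≫ splitι s hs = 𝟙 M := by
  rw [biprod.lift_desc, splitπ_ι, splitπ_ι, splitπ_ι, h]

theorem desc_split_app (x : Γ(splitObj p hp ⊞ splitObj q hq, U)) :
    (biprod.desc (splitι p hp) (splitι q hq)).app U x =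
      (splitι p hp).app U ((biprod.fst : splitObj p hp ⊞ splitObj q hq ⟶ _).app U x) +
      (splitι q hq).app U ((biprod.snd : splitObj p hp ⊞ splitObj q hq ⟶ _).app U x) := by
  rw [biprod.desc_eq, add_app_apply, comp_app_apply, comp_app_apply]

end SplitSum

theorem IsEquivariant.desc {G E F : Bundle X Λ} {φ : E.mod ⟶ G.mod} {ψ : F.mod ⟶ G.mod}
    (h : IsEquivariant E G φ) (h' : IsEquivariant F G ψ) :
    IsEquivariant (dsum E F) G (biprod.desc φ ψ) := by
  rw [biprod.desc_eq]
  exact ((isEquivariant_fst E F).comp h).add ((isEquivariant_snd E F).comp h')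

/-- The hyperbolic part of a symmetric bundle in the weights `w` and `-w` splits off. -/
theorem SymBundle.exists_split (M : SymBundle X Λ) (w : Λ) (hw : w + w ≠ 0) :
    ∃ M' : SymBundle X Λ, GW0.cls M = hyperbolicMap X w (M.bundle.partCls w) + GW0.cls M' ∧
      (∀ v, M.bundle.proj v = 0 → M'.bundle.proj v = 0) ∧ M'.bundle.proj w = 0 ∧
      M'.bundle.proj (-w) = 0 := by
  classical
  have hne : w ≠ -w := fun h => hw (by nth_rewrite 2 [h]; exact add_neg_cancel w)
  let p := M.bundle.proj w
  let q := M.bundle.proj (-w)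
  -- The projection to the complement of the weights `w` and `-w`. It is self-adjoint because `p`
  -- and `q` are adjoint to each other, so its image inherits a perfect form.
  let s : M.bundle.mod ⟶ M.bundle.mod := 𝟙 _ - p - q
  have hpp : p ≫ p = p := M.bundle.proj_idem w
  have hqq : q ≫ q = q := M.bundle.proj_idem (-w)
  have hpq : p ≫ q = 0 := M.bundle.proj_orth w (-w) hne
  have hqp : q ≫ p = 0 := M.bundle.proj_orth (-w) w hne.symm
  have hcomm (v v' : Λ) : M.bundle.proj v ≫ M.bundle.proj v' =
      M.bundle.proj v' ≫ M.bundle.proj v := by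
    by_cases h : v = v'
    · rw [h]
    · rw [M.bundle.proj_orth v v' h, M.bundle.proj_orth v' v (Ne.symm h)]
  have hps : p ≫ s = 0 := by
    simp only [s, Preadditive.comp_sub, Category.comp_id, hpp, hpq, sub_self]
  have hqs : q ≫ s = 0 := by
    simp only [s, Preadditive.comp_sub, Category.comp_id, hqq, hqp, sub_zero, sub_self]
  have hsp : s ≫ p = 0 := by
    simp only [s, Preadditive.sub_comp, Category.id_comp, hpp, hqp, sub_self]
  have hsq : s ≫ q = 0 := by
    simp only [s, Preadditive.sub_comp, Category.id_comp, hqq, hpq, sub_zero, sub_self]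
  have hss : s ≫ s = s := by
    change (𝟙 _ - p - q) ≫ s = s
    rw [Preadditive.sub_comp, Preadditive.sub_comp, hps, hqs, Category.id_comp, sub_zero, sub_zero]
  have hsc (v : Λ) : M.bundle.proj v ≫ s = s ≫ M.bundle.proj v := by
    simp only [s, p, q, Preadditive.sub_comp, Preadditive.comp_sub, Category.id_comp,
      Category.comp_id, hcomm v w, hcomm v (-w)]
  have hp_adj (U : X.Opens) (x y) : M.form.app U (p.app U x) y = M.form.app U x (q.app U y) :=
    M.perfect.proj_comm w x y
  have hq_adj (U : X.Opens) (x y) : M.form.app U (q.app U x) y = M.form.app U x (p.app U y) := by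
    have := M.perfect.proj_comm (-w) x y
    rwa [neg_neg] at this
  have hs_adj (U : X.Opens) (x y) : M.form.app U (s.app U x) y = M.form.app U x (s.app U y) := by
    simp only [s, sub_app_apply, map_sub, LinearMap.sub_apply, hp_adj, hq_adj, id_app_apply]
    abel
  have hperf (U : X.Opens) (hU : IsAffineOpen U) :
      ((M.form.comp (splitι p hpp) (splitι q hqq)).app U).IsPerfPair :=
    isPerfPair_split hpp hqq (M.perfect.1 U hU) (hp_adj U)
  let hP := M.bundle.isVB.split p hpp
  let hQ := M.bundle.isVB.split q hqq
  have e1 : IsEquivariant (place w _ hP) M.bundle (splitι p hpp) :=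
    isEquivariant_place_left (splitι_comp p hpp)
  have e2 : IsEquivariant (place (-w) _ hQ) M.bundle (splitι q hqq) :=
    isEquivariant_place_left (splitι_comp q hqq)
  have f1 : IsEquivariant M.bundle (place w _ hP) (splitπ p hpp) :=
    isEquivariant_place_right (comp_splitπ p hpp)
  have f2 : IsEquivariant M.bundle (place (-w) _ hQ) (splitπ q hqq) :=
    isEquivariant_place_right (comp_splitπ q hqq)
  let M' := M.split s hss hsc hs_adj
  have hproj (v : Λ) : M'.bundle.proj v = splitι s hss ≫ M.bundle.proj v ≫ splitπ s hss :=
    M.bundle.split_proj hss hsc v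
  have hι : IsEquivariant M'.bundle M.bundle (splitι s hss) := isEquivariant_splitι _ hss hsc
  have hπ : IsEquivariant M.bundle M'.bundle (splitπ s hss) := isEquivariant_splitπ _ hss hsc
  have wp (U : X.Opens) (a : Γ(splitObj p hpp, U)) : M.bundle.HasWeight w ((splitι p hpp).app U a) :=
    (comp_app_apply _ _ _).symm.trans (congrArg (evalHom a) (splitι_comp p hpp))
  have wq (U : X.Opens) (a : Γ(splitObj q hqq, U)) :
      M.bundle.HasWeight (-w) ((splitι q hqq).app U a) :=
    (comp_app_apply _ _ _).symm.trans (congrArg (evalHom a) (splitι_comp q hqq))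
  -- The part of weight `w` is totally isotropic because `w + w ≠ 0`; likewise that of weight `-w`.
  have hpp_form (U : X.Opens) (a b) :
      M.form.app U ((splitι p hpp).app U a) ((splitι p hpp).app U b) = 0 :=
    M.perfect.2 U w w _ _ (wp U a) (wp U b) hw
  have hqq_form (U : X.Opens) (a b) :
      M.form.app U ((splitι q hqq).app U a) ((splitι q hqq).app U b) = 0 :=
    M.perfect.2 U (-w) (-w) _ _ (wq U a) (wq U b) fun h => hw (by
      rw [← neg_add, neg_eq_zero] at h
      exact h)
  have hps_form (U : X.Opens) (a) (b) :
      M.form.app U ((splitι p hpp).app U a) ((splitι s hss).app U b) = 0 := by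
    have h1 : q.app U ((splitι s hss).app U b) = 0 := by
      rw [← comp_app_apply, splitι_comp_eq_zero hss hsq, zero_app_apply]
    have h2 := hp_adj U ((splitι p hpp).app U a) ((splitι s hss).app U b)
    rwa [show p.app U ((splitι p hpp).app U a) = (splitι p hpp).app U a from wp U a, h1,
      map_zero] at h2
  have hqs_form (U : X.Opens) (a) (b) :
      M.form.app U ((splitι q hqq).app U a) ((splitι s hss).app U b) = 0 := by
    have h1 : p.app U ((splitι s hss).app U b) = 0 := by
      rw [← comp_app_apply, splitι_comp_eq_zero hss hsp, zero_app_apply]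
    have h2 := hq_adj U ((splitι q hqq).app U a) ((splitι s hss).app U b)
    rwa [show q.app U ((splitι q hqq).app U a) = (splitι q hqq).app U a from wq U a, h1,
      map_zero] at h2
  have hsum : IsOrthogonalSum (hypPlace (add_neg_cancel w) hP hQ _ hperf) M' M := by
    refine ⟨biprod.desc (splitι p hpp) (splitι q hqq), splitι s hss, ⟨e1.desc e2, hι,
      biprod.lift (splitπ p hpp) (splitπ q hqq), splitπ s hss, f1.lift f2, hπ,
      desc_lift_split hpp hqq hpq hqp, splitι_π s hss, desc_splitπ hpp hqq hss hps hqs,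
      splitι_lift hpp hqq hss hsp hsq, lift_desc_add_split hpp hqq hss (by simp [s])⟩,
      fun U => ⟨?_, fun x y => rfl, ?_⟩⟩
    · have key (x y : Γ(splitObj p hpp ⊞ splitObj q hqq, U)) :
          M.form.app U ((biprod.desc (splitι p hpp) (splitι q hqq)).app U x)
            ((biprod.desc (splitι p hpp) (splitι q hqq)).app U y) =
          (M.form.comp (splitι p hpp) (splitι q hqq)).hyp.app U x y := by
        rw [desc_split_app, desc_split_app, Form.hyp_app, Form.comp_app, Form.comp_app, map_add,
          map_add, LinearMap.add_apply, LinearMap.add_apply, hpp_form, hqq_form, zero_add,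
          add_zero, M.symm U ((splitι q hqq).app U _), add_comm]
      exact key
    · have key (x : Γ(splitObj p hpp ⊞ splitObj q hqq, U)) (y : Γ(splitObj s hss, U)) :
          M.form.app U ((biprod.desc (splitι p hpp) (splitι q hqq)).app U x)
            ((splitι s hss).app U y) = 0 := by
        rw [desc_split_app, map_add, LinearMap.add_apply, hps_form, hqs_form, add_zero]
      exact key
  refine ⟨M', ?_, fun v hv => ?_, ?_, ?_⟩
  · rw [GW0.cls_sum hsum]
    congr 1
    -- The summand pairs the part of weight `w` with the part of weight `-w` instead of with its
    -- dual bundle; the class is the same.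
    refine Eq.trans ?_ (hyperbolicMap_cls w _).symm
    exact cls_hypPlace_eq_of_iso _ (Iso.refl _)
  · rw [hproj, hv, zero_comp, comp_zero]
    rfl
  · rw [hproj]
    exact (congrArg _ (comp_splitπ_eq_zero hss hps)).trans comp_zero
  · rw [hproj]
    exact (congrArg _ (comp_splitπ_eq_zero hss hqs)).trans comp_zero

end Decomposition

/-! ### Shifts of weights and products with hyperbolic planes. -/

section Shift

variable {X : Scheme.{u}} {Λ : Type} [AddCommGroup Λ] {U V : X.Opens}

/-- An equivariant bundle with its weights shifted. -/
def Bundle.shift (E : Bundle X Λ) (w : Λ) : Bundle X Λ where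
  mod := E.mod
  quasicoherent := E.quasicoherent
  finite := E.finite
  projective := E.projective
  proj := E.proj.equivMapDomain (Equiv.addRight w)
  proj_idem v := E.proj_idem (v + -w)
  proj_orth v v' h := E.proj_orth (v + -w) (v' + -w) fun h' => h (add_right_cancel h')
  proj_sum := (Finsupp.sum_equivMapDomain _ _ _).trans E.proj_sum

theorem Bundle.hasWeight_shift {E : Bundle X Λ} {v w : Λ} {s : Γ(E.mod, U)} :
    (E.shift w).HasWeight v s ↔ E.HasWeight (v + -w) s := Iff.rfl

theorem IsPerfect.shift {E F : Bundle X Λ} {c : Form E.mod F.mod} (hc : IsPerfect E F c) {v w : Λ}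
    (h : v + w = 0) : IsPerfect (E.shift v) (F.shift w) c :=
  ⟨hc.1, fun U v' w' x y hx hy h' => hc.2 U (v' + -v) (w' + -w) x y hx hy fun h0 => h' (by
    rw [add_add_add_comm, ← neg_add, h, neg_zero, add_zero] at h0
    exact h0)⟩

theorem isTensor_shift (E : Bundle X Λ) (w : Λ) :
    IsTensor E (lineBundle X w) (E.shift w) (smulPairing E.mod).flip := by
  refine ⟨fun U _ => (isTensorProduct_smulPairing E.mod U).flip, fun U v v' x y hx hy => ?_⟩
  have key (a : Γ(X, U)) (x : Γ(E.mod, U)) (hx : E.HasWeight v x) : E.HasWeight v (a • x) :=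
    ((lapp (E.proj v) U).map_smul a x).trans (congrArg (a • ·) hx)
  rcases (hasWeight_place (hM := isVB_structureSheaf X)).mp hy with rfl | rfl
  · refine Bundle.hasWeight_shift.mpr ?_
    rw [add_neg_cancel_right]
    exact key y x hx
  · exact (congrArg ((E.shift w).HasWeight (v + v'))
      (map_zero ((smulPairing E.mod).flip.app U x))).mpr (map_zero _)

/-- Tensoring `M` with the hyperbolic plane in weights `w` and `-w` gives the two shifts of `M`,
paired by the form of `M`. In particular the product is again the class of a symmetric bundle. -/
theorem cls_mul_hyperbolicMap_one (M : SymBundle X Λ) (w : Λ) :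
    GW0.cls M * hyperbolicMap X w 1 = GW0.cls (hypSym (M.bundle.shift w) (M.bundle.shift (-w))
      M.form (M.perfect.shift (add_neg_cancel w))) := by
  rw [hyperbolicMap_one]
  refine (GW0.cls_tensor (isSymTensor_hypSym (isTensor_shift M.bundle w)
    (isTensor_shift M.bundle (-w)) (isPerfect_place (isVB_structureSheaf X) (isVB_structureSheaf X)
      (fun U _ => isPerfPair_mulForm U) w (-w) (add_neg_cancel w))
    (M.perfect.shift (add_neg_cancel w)) fun U x x' y y' => ?_)).symm
  have key (a a' : Γ(X, U)) : M.form.app U (a • x) (a' • x') = M.form.app U x x' * (a * a') := by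
    rw [map_smul, map_smul, LinearMap.smul_apply, smul_eq_mul, smul_eq_mul]
    ring
  exact key y y'

end Shift

/-! ### Additive generators of the equivariant Grothendieck-Witt ring. -/

section Structure

variable {X : Scheme.{u}} {Λ : Type} [AddCommGroup Λ]

/-- A set that contains exactly one of any two opposite nonzero weights. -/
structure IsHalf (P : Set Λ) : Prop where
  zero_notMem : 0 ∉ P
  neg_mem_iff : ∀ w, w ≠ 0 → (-w ∈ P ↔ w ∉ P)

theorem IsHalf.ne_zero {P : Set Λ} (hP : IsHalf P) {w : Λ} (hw : w ∈ P) : w ≠ 0 :=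
  fun h => hP.zero_notMem (h ▸ hw)

theorem IsHalf.neg_notMem {P : Set Λ} (hP : IsHalf P) {w : Λ} (hw : w ∈ P) : -w ∉ P :=
  fun h => (hP.neg_mem_iff w (hP.ne_zero hw)).mp h hw

theorem IsHalf.add_self_ne_zero {P : Set Λ} (hP : IsHalf P) {w : Λ} (hw : w ∈ P) : w + w ≠ 0 :=
  fun h => hP.neg_notMem hw (by rwa [neg_eq_of_add_eq_zero_left h])

theorem SymBundle.exists_push (M : SymBundle X Λ) (h : ∀ v ≠ 0, M.bundle.proj v = 0) :
    ∃ M₀ : SymBundle X Unit, M₀.push 0 = M := by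
  classical
  refine ⟨⟨place () M.bundle.mod M.bundle.isVB, M.form, ⟨M.perfect.1, fun _ _ _ _ _ _ _ h =>
    absurd rfl h⟩, M.symm⟩, SymBundle.eq_of ?_ HEq.rfl⟩
  refine (push_place 0 () M.bundle.isVB).trans (Bundle.eq_of rfl (heq_of_eq ?_))
  have h0 : M.bundle.proj 0 = 𝟙 _ := by
    rw [← M.bundle.sum_proj (S := {0}), Finset.sum_singleton]
    intro v hv
    rw [Finset.mem_singleton]
    by_contra hv'
    exact Finsupp.mem_support_iff.mp hv (h v hv')
  refine Finsupp.ext fun v => ?_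
  by_cases hv : v = 0
  · subst hv
    exact (place_proj_self 0 M.bundle.isVB).trans h0.symm
  · exact (place_proj_of_ne hv M.bundle.isVB).trans (h v hv).symm

/-- The subgroup generated by the bundles of weight `0` and the hyperbolic bundles. -/
def hypSubgroup (X : Scheme.{u}) (P : Set Λ) : AddSubgroup (GW0 X Λ) :=
  AddSubgroup.closure ({a | ∃ κ : GWX X, a = GW0.map X 0 κ} ∪
    {a | ∃ w ∈ P, ∃ b : KX X, a = hyperbolicMap X w b})

theorem map_mem_hypSubgroup (P : Set Λ) (κ : GWX X) : GW0.map X 0 κ ∈ hypSubgroup X P :=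
  AddSubgroup.subset_closure (Or.inl ⟨κ, rfl⟩)

theorem hyperbolicMap_mem_hypSubgroup {P : Set Λ} {w : Λ} (hw : w ∈ P) (b : KX X) :
    hyperbolicMap X w b ∈ hypSubgroup X P :=
  AddSubgroup.subset_closure (Or.inr ⟨w, hw, b, rfl⟩)

/-- Induction on the number of weights: while a nonzero weight is present, `SymBundle.exists_split`
removes it together with its negative; a bundle of weight `0` alone comes from `X`. -/
theorem cls_mem_hypSubgroup {P : Set Λ} (hP : IsHalf P) (M : SymBundle X Λ) :
    GW0.cls M ∈ hypSubgroup X P := by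
  induction hn : M.bundle.proj.support.card using Nat.strong_induction_on generalizing M with
  | h n ih =>
    subst hn
    by_cases h : ∀ v ≠ 0, M.bundle.proj v = 0
    · obtain ⟨M₀, rfl⟩ := M.exists_push h
      rw [← GW0.map_cls]
      exact map_mem_hypSubgroup P _
    · push Not at h
      obtain ⟨v, hv, hv'⟩ := h
      obtain ⟨w, hw, hwv⟩ : ∃ w ∈ P, w = v ∨ -w = v := by
        by_cases h : v ∈ P
        · exact ⟨v, h, Or.inl rfl⟩
        · exact ⟨-v, (hP.neg_mem_iff v hv).mpr h, Or.inr (neg_neg v)⟩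
      obtain ⟨M', h1, h2, h3, h4⟩ := M.exists_split w (hP.add_self_ne_zero hw)
      rw [h1]
      refine add_mem (hyperbolicMap_mem_hypSubgroup hw _) (ih _ ?_ M' rfl)
      refine Finset.card_lt_card (Finset.ssubset_iff_subset_ne.mpr ⟨fun u hu => ?_, fun h => ?_⟩)
      · rw [Finsupp.mem_support_iff] at hu ⊢
        exact fun h => hu (h2 u h)
      · have h5 : v ∈ M'.bundle.proj.support := h ▸ Finsupp.mem_support_iff.mpr hv'
        rw [Finsupp.mem_support_iff] at h5
        rcases hwv with rfl | rfl
        · exact h5 h3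
        · exact h5 h4

theorem map_mul_mem_hypSubgroup {P : Set Λ} (κ : GWX X) {a : GW0 X Λ} (ha : a ∈ hypSubgroup X P) :
    GW0.map X 0 κ * a ∈ hypSubgroup X P := by
  suffices h : hypSubgroup X P ≤
      (hypSubgroup X P).comap (AddMonoidHom.mulLeft (GW0.map X 0 κ)) from h ha
  refine (AddSubgroup.closure_le _).mpr ?_
  rintro _ (⟨κ', rfl⟩ | ⟨w, hw, b, rfl⟩)
  · have h : GW0.map X 0 κ * GW0.map X 0 κ' ∈ hypSubgroup X P := by
      rw [← map_mul]
      exact map_mem_hypSubgroup P _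
    exact h
  · have h : GW0.map X 0 κ * hyperbolicMap X w b ∈ hypSubgroup X P := by
      rw [← hyperbolicMap_forget_mul]
      exact hyperbolicMap_mem_hypSubgroup hw _
    exact h

/-- The projection formula at `a = 1`. The lift `κ` does not depend on `w`. -/
theorem exists_hyperbolicMap_eq (hs : Function.Surjective (GW0.forget X Unit)) (b : KX X) :
    ∃ κ : GWX X, GW0.forget X Unit κ = b ∧
      ∀ w : Λ, hyperbolicMap X w b = GW0.map X 0 κ * hyperbolicMap X w 1 := by
  obtain ⟨κ, rfl⟩ := hs b
  exact ⟨κ, rfl, fun w => by rw [← hyperbolicMap_forget_mul, mul_one]⟩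

end Structure

/-! ### The forgetful map on the Hermitian augmentation ideal. -/

section Forget

variable {X : Scheme.{u}} {Λ : Type} [AddCommGroup Λ]

/-- Coefficients are moved into `GW_0(X)` by `exists_hyperbolicMap_eq`. What remains is a product of
two hyperbolic planes, the class of a symmetric bundle, to which `cls_mem_hypSubgroup` applies. -/
theorem mul_mem_hypSubgroup (hs : Function.Surjective (GW0.forget X Unit)) {P : Set Λ}
    (hP : IsHalf P) {a b : GW0 X Λ} (ha : a ∈ hypSubgroup X P) (hb : b ∈ hypSubgroup X P) :
    a * b ∈ hypSubgroup X P := by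
  have h1 (w w' : Λ) : hyperbolicMap X w 1 * hyperbolicMap X w' 1 ∈ hypSubgroup X P := by
    rw [hyperbolicMap_one, cls_mul_hyperbolicMap_one]
    exact cls_mem_hypSubgroup hP _
  suffices h : hypSubgroup X P ≤ (hypSubgroup X P).comap (AddMonoidHom.mulRight b) from h ha
  refine (AddSubgroup.closure_le _).mpr ?_
  rintro _ (⟨κ, rfl⟩ | ⟨w, -, c, rfl⟩)
  · exact map_mul_mem_hypSubgroup κ hb
  have h2 : hypSubgroup X P ≤
      (hypSubgroup X P).comap (AddMonoidHom.mulLeft (hyperbolicMap X w c)) := by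
    refine (AddSubgroup.closure_le _).mpr ?_
    rintro _ (⟨κ, rfl⟩ | ⟨w', -, d, rfl⟩)
    · have h : hyperbolicMap X w c * GW0.map X 0 κ ∈ hypSubgroup X P := by
        obtain ⟨κ', -, h⟩ := exists_hyperbolicMap_eq (Λ := Λ) hs c
        rw [h, mul_right_comm, ← map_mul]
        refine map_mul_mem_hypSubgroup _ ?_
        rw [hyperbolicMap_one]
        exact cls_mem_hypSubgroup hP _
      exact h
    · have h : hyperbolicMap X w c * hyperbolicMap X w' d ∈ hypSubgroup X P := by
        obtain ⟨κ, -, h⟩ := exists_hyperbolicMap_eq (Λ := Λ) hs c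
        obtain ⟨κ', -, h'⟩ := exists_hyperbolicMap_eq (Λ := Λ) hs d
        rw [h, h', mul_mul_mul_comm, ← map_mul]
        exact map_mul_mem_hypSubgroup _ (h1 w w')
      exact h
  exact h2 hb

theorem mem_hypSubgroup (hs : Function.Surjective (GW0.forget X Unit)) {P : Set Λ} (hP : IsHalf P)
    (a : GW0 X Λ) : a ∈ hypSubgroup X P := by
  induction a using GW0.induction_on with
  | cls M => exact cls_mem_hypSubgroup hP M
  | int n =>
    rw [← map_intCast (GW0.map X (0 : Unit →+ Λ)) n]
    exact map_mem_hypSubgroup P _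
  | add a b ha hb => exact add_mem ha hb
  | mul a b ha hb => exact mul_mem_hypSubgroup hs hP ha hb

theorem forget_hyperbolicMap (hs : Function.Surjective (GW0.forget X Unit)) (w : Λ) (b : KX X) :
    GW0.forget X Λ (hyperbolicMap X w b) =
      K0.triv Λ b * (K0.cls (lineBundle X w) + K0.cls (lineBundle X (-w))) := by
  obtain ⟨κ, rfl, h⟩ := exists_hyperbolicMap_eq (Λ := Λ) hs b
  rw [h, map_mul, GW0.forget_map, forget_hyperbolicMap_one]

open scoped Classical in
/-- The sum over the weights in `P` of the hyperbolic bundles on the parts of a bundle. -/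
def hypSum (X : Scheme.{u}) (P : Set Λ) : K0 X Λ →+ GW0 X Λ :=
  (Finsupp.liftAddHom fun w => if w ∈ P then hyperbolicMap X w else 0).comp
    (AddMonoidAlgebra.coeffAddEquiv.toAddMonoidHom.comp (K0.character X Λ).toAddMonoidHom)

open scoped Classical in
theorem hypSum_triv_mul (P : Set Λ) (a : KX X) (w : Λ) :
    hypSum X P (K0.triv Λ a * K0.cls (lineBundle X w)) =
      if w ∈ P then hyperbolicMap X w a else 0 := by
  have h : K0.character X Λ (K0.triv Λ a * K0.cls (lineBundle X w)) = .single w a := by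
    rw [map_mul, K0.character_triv, K0.character_lineBundle, AddMonoidAlgebra.single_mul_single,
      zero_add, mul_one]
  change Finsupp.liftAddHom (fun w => if w ∈ P then hyperbolicMap X w else 0)
    (K0.character X Λ (K0.triv Λ a * K0.cls (lineBundle X w))).coeff = _
  rw [h]
  refine (Finsupp.liftAddHom_apply_single _ w a).trans ?_
  split_ifs <;> rfl

theorem hypSum_triv {P : Set Λ} (hP : IsHalf P) (a : KX X) : hypSum X P (K0.triv Λ a) = 0 := by
  have h := hypSum_triv_mul P a 0
  rwa [K0.cls_unit, mul_one, if_neg hP.zero_notMem] at h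

/-- The map `hypSum` recovers the hyperbolic terms from the image in `K0`: of the two weights in `b
(z^w + z^{-w})` exactly one lies in `P`, and constants contribute nothing since `0 ∉ P`. -/
theorem exists_eq_map_add (hs : Function.Surjective (GW0.forget X Unit)) {P : Set Λ}
    (hP : IsHalf P) (a : GW0 X Λ) :
    ∃ κ : GWX X, a = GW0.map X 0 κ + hypSum X P (GW0.forget X Λ a) := by
  let φ : GW0 X Λ →+ GW0 X Λ := (AddMonoidHom.id _) -
    (hypSum X P).comp (GW0.forget X Λ).toAddMonoidHom
  suffices h : hypSubgroup X P ≤ (GW0.map X (0 : Unit →+ Λ)).toAddMonoidHom.range.comap φ by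
    obtain ⟨κ, hκ⟩ := h (mem_hypSubgroup hs hP a)
    exact ⟨κ, eq_add_of_sub_eq hκ.symm⟩
  refine (AddSubgroup.closure_le _).mpr ?_
  rintro _ (⟨κ, rfl⟩ | ⟨w, hw, b, rfl⟩)
  · refine ⟨κ, ?_⟩
    change GW0.map X 0 κ = GW0.map X 0 κ - hypSum X P (GW0.forget X Λ (GW0.map X 0 κ))
    rw [GW0.forget_map]
    exact ((congrArg _ (hypSum_triv hP _)).trans (sub_zero _)).symm
  · refine ⟨0, ?_⟩
    change GW0.map X 0 0 = hyperbolicMap X w b - hypSum X P (GW0.forget X Λ (hyperbolicMap X w b))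
    rw [forget_hyperbolicMap hs, mul_add, map_add, hypSum_triv_mul, hypSum_triv_mul, if_pos hw,
      if_neg (hP.neg_notMem hw), add_zero, map_zero]
    exact (sub_self _).symm

theorem GW0.augmentation_map (κ : GWX X) : GW0.map X (0 : Λ →+ Unit) (GW0.map X 0 κ) = κ := by
  rw [GW0.map_map, GW0.map_unit]

/-- The forgetful map is injective on the Hermitian augmentation ideal. -/
theorem forget_injOn (hs : Function.Surjective (GW0.forget X Unit)) {P : Set Λ} (hP : IsHalf P) :
    Set.InjOn (GW0.forget X Λ) (RingHom.ker (GW0.map X (0 : Λ →+ Unit))) := by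
  intro a ha b hb h
  -- The difference has image zero, so it comes from some `κ` in `GW_0(X)`; the augmentation returns
  -- `κ`, which is therefore zero.
  obtain ⟨κ, hκ⟩ := exists_eq_map_add hs hP (a - b)
  rw [map_sub (GW0.forget X Λ), h, sub_self, map_zero, add_zero] at hκ
  have h0 : GW0.map X (0 : Λ →+ Unit) (a - b) = 0 := by
    rw [map_sub, RingHom.mem_ker.mp ha, RingHom.mem_ker.mp hb, sub_self]
  rw [hκ, GW0.augmentation_map] at h0
  rw [h0, map_zero] at hκ
  exact sub_eq_zero.mp hκ

end Forget

/-! ### The Hermitian augmentation ideal of the torus. -/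

section Torus

variable {X : Scheme.{u}} {t : ℕ}

/-- The positive weights in the lexicographic order contain one of any two opposite weights. -/
theorem isHalf_lex (t : ℕ) : IsHalf {w : Fin t → ℤ | 0 < toLex w} where
  zero_notMem := lt_irrefl (0 : Lex (Fin t → ℤ))
  neg_mem_iff w hw := by
    have h0 : toLex w ≠ 0 := hw
    change 0 < -toLex w ↔ ¬ 0 < toLex w
    rw [neg_pos]
    exact ⟨fun h h' => lt_asymm h h', fun h => lt_of_le_of_ne (not_lt.mp h) h0⟩

/-- It suffices to check additive generators, which forget to constants and to elements `b (z^w +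
z^{-w})`. -/
theorem vee_forget (hs : Function.Surjective (GW0.forget X Unit)) (a : GWTX X t) :
    vee X t (GW0.forget X _ a) = GW0.forget X _ a := by
  let φ : GWTX X t →+ KTX X t := (GW0.forget X _).toAddMonoidHom
  suffices h : hypSubgroup X {w : Fin t → ℤ | 0 < toLex w} ≤
      (((vee X t).toAddMonoidHom.comp φ).eqLocus φ) from h (mem_hypSubgroup hs (isHalf_lex t) a)
  refine (AddSubgroup.closure_le _).mpr ?_
  rintro _ (⟨κ, rfl⟩ | ⟨w, -, b, rfl⟩)
  · change vee X t (GW0.forget X _ (GW0.map X 0 κ)) = GW0.forget X _ (GW0.map X 0 κ)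
    rw [GW0.forget_map]
    exact vee_triv X t _
  · change vee X t (GW0.forget X _ (hyperbolicMap X w b)) = GW0.forget X _ (hyperbolicMap X w b)
    rw [forget_hyperbolicMap hs]
    change vee X t (triv X t b * (zCls X w + zCls X (-w))) = triv X t b * (zCls X w + zCls X (-w))
    rw [map_mul, map_add, vee_triv, vee_zCls, vee_zCls, neg_neg, add_comm]

theorem exists_forget_eq (hs : Function.Surjective (GW0.forget X Unit)) {f : KTX X t}
    (hf : vee X t f = f) : ∃ a : GWTX X t, GW0.forget X _ a = f := by
  refine vee_fixed_induction (P := fun f => ∃ a : GWTX X t, GW0.forget X _ a = f) f hf ?_ ?_ ?_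
  · intro a
    obtain ⟨κ, rfl⟩ := hs a
    exact ⟨GW0.map X 0 κ, GW0.forget_map _ _⟩
  · rintro _ _ ⟨a, rfl⟩ ⟨b, rfl⟩
    exact ⟨a + b, map_add _ _ _⟩
  · exact fun a w _ => ⟨hyperbolicMap X w a, forget_hyperbolicMap hs w a⟩

/-- Any preimage is corrected by its own augmentation, placed in weight `0`; as `f` has augmentation
zero, the correction is invisible in `R`. -/
theorem exists_mem_hermitianAugIdeal (hs : Function.Surjective (GW0.forget X Unit)) {f : KTX X t}
    (hf : vee X t f = f) (hf' : augmentation X t f = 0) :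
    ∃ a ∈ hermitianAugIdeal X t, GW0.forget X _ a = f := by
  obtain ⟨a, rfl⟩ := exists_forget_eq hs hf
  refine ⟨a - GW0.map X 0 (hermitianAugmentation X t a), ?_, ?_⟩
  · refine RingHom.mem_ker.mpr ?_
    rw [map_sub]
    exact sub_eq_zero.mpr (GW0.augmentation_map _).symm
  · rw [map_sub, GW0.forget_map, hermitianAugmentation, GW0.forget_map]
    change _ - K0.map X 0 (augmentation X t _) = _
    rw [hf', map_zero, sub_zero]

theorem bijOn_forget (hs : Function.Surjective (GW0.forget X Unit)) :
    Set.BijOn (GW0.forget X (Fin t → ℤ)) (hermitianAugIdeal X t)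
      (Subtype.val '' (IPlus X t : Set (RPlus X t))) := by
  refine ⟨fun a ha => ?_, forget_injOn hs (isHalf_lex t), ?_⟩
  · refine ⟨⟨GW0.forget X _ a, vee_forget hs a⟩, ?_, rfl⟩
    change augmentation X t (GW0.forget X _ a) = 0
    rw [augmentation, ← GW0.forget_map]
    exact (congrArg _ (RingHom.mem_ker.mp ha)).trans (map_zero _)
  · rintro _ ⟨f, hf, rfl⟩
    exact exists_mem_hermitianAugIdeal hs f.2 hf

/-- Generators and coefficients of a combination in `I_+` both lift to `RO`. The lifted combination
lies in `IO`, so injectivity there identifies it with the given element. -/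
theorem exists_generators (hs : Function.Surjective (GW0.forget X Unit)) :
    ∃ g : (Fin t → Fin 2) → GWTX X t,
      (∀ γ, γ ≠ 0 → GW0.forget X (Fin t → ℤ) (g γ) = (gen X γ : KTX X t)) ∧
      Ideal.span (g '' {γ | γ ≠ 0}) = hermitianAugIdeal X t := by
  have (γ : Fin t → Fin 2) : ∃ a : GWTX X t, γ ≠ 0 →
      a ∈ hermitianAugIdeal X t ∧ GW0.forget X _ a = (gen X γ : KTX X t) := by
    by_cases hγ : γ = 0
    · exact ⟨0, fun h => (h hγ).elim⟩
    · obtain ⟨a, ha⟩ := exists_mem_hermitianAugIdeal hs (gen X γ).2 (augmentation_gen hγ)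
      exact ⟨a, fun _ => ha⟩
  choose g hg using this
  have hle : Ideal.span (g '' {γ | γ ≠ 0}) ≤ hermitianAugIdeal X t := by
    refine Ideal.span_le.mpr ?_
    rintro _ ⟨γ, hγ, rfl⟩
    exact (hg γ hγ).1
  refine ⟨g, fun γ hγ => (hg γ hγ).2, le_antisymm hle fun a ha => ?_⟩
  obtain ⟨f, hf, hfa⟩ := (bijOn_forget hs).mapsTo ha
  have key : ∃ b ∈ Ideal.span (g '' {γ | γ ≠ 0}), GW0.forget X _ b = (f : KTX X t) := by
    rw [SetLike.mem_coe, ← span_gen] at hf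
    clear hfa
    induction hf using Submodule.span_induction with
    | mem f hf =>
      obtain ⟨γ, hγ, rfl⟩ := hf
      exact ⟨g γ, Ideal.subset_span ⟨γ, hγ, rfl⟩, (hg γ hγ).2⟩
    | zero => exact ⟨0, zero_mem _, map_zero _⟩
    | add x y _ _ hx hy =>
      obtain ⟨b, hb, h⟩ := hx
      obtain ⟨c, hc, h'⟩ := hy
      exact ⟨b + c, add_mem hb hc, (map_add _ _ _).trans (congrArg₂ _ h h')⟩
    | smul r x _ hx =>
      obtain ⟨b, hb, h⟩ := hx
      obtain ⟨c, h'⟩ := exists_forget_eq hs r.2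
      exact ⟨c * b, Ideal.mul_mem_left _ c hb, (map_mul _ _ _).trans (congrArg₂ _ h' h)⟩
  obtain ⟨b, hb, h⟩ := key
  rwa [← (bijOn_forget hs).injOn (hle hb) ha (h.trans hfa)]

end Torus

end TorusGW

end

/-! ### The theorem. -/

theorem mainTheorem2 (X : Scheme.{u}) (h2 : IsUnit (2 : Γ(X, ⊤))) (t : ℕ) :
    -- `R ≅ K_0(X)[x_i, y_i] / (x_i y_i + x_i + y_i)`
    (Function.Surjective (presentation X t) ∧
      RingHom.ker (presentation X t) = Ideal.span (Set.range fun i : Fin t =>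
        MvPolynomial.X (Sum.inl i) * MvPolynomial.X (Sum.inr i) +
          MvPolynomial.X (Sum.inl i) + MvPolynomial.X (Sum.inr i))) ∧
    -- `I_+` is generated by the `2 ^ t - 1` elements `x^γ + y^γ`
    (Ideal.span (gen X '' {γ : Fin t → Fin 2 | γ ≠ 0}) = IPlus X t ∧
      (IPlus X t).FG ∧
      (gen X '' {γ : Fin t → Fin 2 | γ ≠ 0}).ncard ≤ 2 ^ t - 1 ∧
      (Nonempty X → (gen X '' {γ : Fin t → Fin 2 | γ ≠ 0}).ncard = 2 ^ t - 1)) ∧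
    -- if the duality of vector bundles acts trivially on `K_0(X)`, it induces `∨` on `R`
    ((∀ (E F : TorusGW.Bundle X Unit) (c : Form E.mod F.mod), IsPerfect E F c →
        K0.cls E = K0.cls F) →
      ∀ (E F : TorusGW.Bundle X (Fin t → ℤ)) (c : Form E.mod F.mod), IsPerfect E F c →
        vee X t (K0.cls E) = K0.cls F) ∧
    -- if `GW_0(X) → K_0(X)` is onto, then `IO ≅ I_+` and `IO` is generated by `2 ^ t - 1` elements
    (Function.Surjective (GW0.forget X Unit) →
      Set.BijOn (GW0.forget X (Fin t → ℤ)) (hermitianAugIdeal X t)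
        (Subtype.val '' (IPlus X t : Set (RPlus X t))) ∧
      ∃ g : (Fin t → Fin 2) → GWTX X t,
        (∀ γ, γ ≠ 0 → GW0.forget X (Fin t → ℤ) (g γ) = (gen X γ : KTX X t)) ∧
        (g '' {γ | γ ≠ 0}).ncard ≤ 2 ^ t - 1 ∧
        Ideal.span (g '' {γ | γ ≠ 0}) = hermitianAugIdeal X t) := by
  refine ⟨⟨presentation_surjective X t, ker_presentation X t⟩,
    ⟨span_gen, ?_, ?_, fun _ => ?_⟩, vee_cls, fun hs => ?_⟩
  · rw [← span_gen]
    exact ⟨(finite_gens (X := X)).toFinset, by rw [Set.Finite.coe_toFinset]⟩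
  · exact (Set.ncard_image_le (Set.toFinite _)).trans ncard_nonzero.le
  · rw [gen_injOn.ncard_image, ncard_nonzero]
  · obtain ⟨g, hg, hg'⟩ := exists_generators (t := t) hs
    exact ⟨bijOn_forget hs, g, hg,
      (Set.ncard_image_le (Set.toFinite _)).trans ncard_nonzero.le, hg'⟩
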